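/- **Setting.** Let $\mathfrak g=\mathfrak{sl}_3(\mathbb C)$ with positive roots $R^+=\{\alpha_1,\alpha_2,\theta=\alpha_1+\alpha_2\}$, root vectors $x_\alpha^{\pm}$ (the matrix units $E_{12},E_{23},E_{13}$ and their transposes), coroots $h_\alpha=[x_\alpha^+,x_\alpha^-]$ and fundamental weights $\omega_1,\omega_2$. Let $\mathfrak n^+$ be the span of the $x_\alpha^+$. Let $\mathfrak g[t]=\mathfrak g\otimes\mathbb C[t]$, and let $U(\mathfrak g[t])[s]$ be the span of the products $(y_1\otimes t^{r_1})\cdots(y_p\otimes t^{r_p})$ with $r_1+\dots+r_p=s$. Write $y^{(s)}=y^s/s!$. For $\lambda=\lambda_1\omega_1+\lambda_2\omega_2$ dominant integral ($\lambda_1,\lambda_2\in\mathbb Z_{\ge0}$) put $|\lambda|=\lambda_1+\lambda_2$, and let $V(\lambda)$ be the irreducible $\mathfrak g$-module with highest weight vector $v_\lambda$ of weight $\lambda$, i.e. the cyclic module generated by $v_\lambda$ with defining relations $\mathfrak n^+v_\lambda=0$, $h_{\alpha_i}v_\lambda=\lambda_iv_\lambda$, $(x_{\alpha_i}^-)^{\lambda_i+1}v_\lambda=0$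 ($i=1,2$). **CV modules.** Let $\nu$ be dominant integral and let $\xi=(\xi^\alpha)_{\alpha\in R^+}$, where $\xi^\alpha=(\xi^\alpha_1\ge\xi^\alpha_2\ge\cdots)$ is a partition of $\nu(h_\alpha)$. The Chari–Venkatesh (CV) module $V(\xi)$ is the cyclic $\mathfrak g[t]$-module generated by $v_\xi$ with defining relations $(\mathfrak n^+\otimes\mathbb C[t])v_\xi=0$, $(h_{\alpha_i}\otimes t^s)v_\xi=\delta_{s,0}\nu(h_{\alpha_i})v_\xi$ $(s\ge 0)$, $(x_{\alpha_i}^-\otimes1)^{\nu(h_{\alpha_i})+1}v_\xi=0$ for $i=1,2$, and $(x_\alpha^+\otimes t)^{(s)}(x_\alpha^-\otimes 1)^{(r+s)}v_\xi=0$ for all $\alpha\in R^+$ and integers $r,s,k\ge1$ with $r+s\ge 1+rk+\sum_{j\ge k+1}\xi^\alpha_j$. It is graded by $V(\xi)[s]=U(\mathfrak g[t])[s]v_\xi$. For dominant integral $\lambda,\mu$ let $\mathcal F_{\lambda,\mu}$, with generator $v_{\lambda,\mu}$, be the CV module of weight $\lambda+\mu$ in which $\xi^\alpha$ has the parts $\lambda(h_\alpha),\mu(h_\alpha)$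 in non-increasing order. **Fusion products.** For distinct $z_1,z_2\in\mathbb C$ let $\mathfrak g[t]$ act on $V(\lambda)\otimes V(\mu)$ by $(x\otimes f)(a\otimes b)=f(z_1)\,xa\otimes b+f(z_2)\,a\otimes xb$, and filter this module by $M[k]=\sum_{0\le r\le k}U(\mathfrak g[t])[r](v_\lambda\otimes v_\mu)$, $M[-1]=0$. The fusion product $V(\lambda)^{z_1}*V(\mu)^{z_2}$ is the associated graded $\mathfrak g[t]$-module $\bigoplus_{k\ge0}M[k]/M[k-1]$. **Theorem.** Let $\lambda=\lambda_1\omega_1+\lambda_2\omega_2$ and $\mu=\mu_1\omega_1+\mu_2\omega_2$ be dominant integral weights with $|\lambda|\ge|\mu|$ and $\lambda_1\ge\mu_1$. (i) Suppose $\mu\ne0$ and set $$\mathcal F^+_{\lambda,\mu}=\begin{cases}\mathcal F_{\lambda+\omega_2,\,\mu-\omega_2}&\text{if }\lambda_2\ge\mu_2>0,\\ \mathcal F_{\lambda+\omega_1,\,\mu-\omega_1}&\text{if }\mu_1>0,\ \mu_2=0,\\ \mathcal F_{\lambda+(\mu_2-\lambda_2)\omega_2,\,\mu-(\mu_2-\lambda_2)\omega_2}&\text{if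 }\lambda_2<\mu_2.\end{cases}$$ Then $\mathcal F_{\lambda,\mu}$ and $\mathcal F^+_{\lambda,\mu}$ are graded $\mathfrak g[t]$-modules, and there is a short exact sequence of graded $\mathfrak g[t]$-modules $$0\to\operatorname{Ker}(\lambda,\mu)\to\mathcal F_{\lambda,\mu}\xrightarrow{\ \phi\ }\mathcal F^+_{\lambda,\mu}\to0$$ in which $\phi$ maps generator to generator, such that $\operatorname{Ker}(\lambda,\mu)$ has a finite filtration by graded submodules each of whose successive quotients is isomorphic, as a graded module, to a finite direct sum of CV modules up to grade shifts. (ii) For all distinct $z_1,z_2\in\mathbb C$ the $\mathfrak g[t]$-modules $\mathcal F_{\lambda,\mu}$ and $V(\lambda)^{z_1}*V(\mu)^{z_2}$ are isomorphic. In particular, up to isomorphism, $V(\lambda)^{z_1}*V(\mu)^{z_2}$ does not depend on the pair of distinct points $(z_1,z_2)$. -/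

import Mathlib

open scoped TensorProduct DirectSum Polynomial

noncomputable section

namespace SL3

/- An associative algebra is a Lie algebra with the commutator as bracket. -/
attribute [local instance] LieRing.ofAssociativeRing

/-! ## The Lie algebra `sl₃` and its current algebra -/

/-- The Lie algebra `sl₃(ℂ)`. -/
abbrev G : Type := LieAlgebra.SpecialLinear.sl (Fin 3) ℂ

/-- The current algebra `sl₃[t] = ℂ[t] ⊗ sl₃`, with bracket `[f ⊗ x, g ⊗ y] = fg ⊗ [x, y]`. -/
abbrev Gt : Type := ℂ[X] ⊗[ℂ] G

/-- The universal enveloping algebra of `sl₃`. -/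
abbrev U : Type := UniversalEnvelopingAlgebra ℂ G

/-- The universal enveloping algebra of `sl₃[t]`; left modules over it are the
representations of `sl₃[t]`. -/
abbrev Ut : Type := UniversalEnvelopingAlgebra ℂ Gt

/-- The positive roots `α₁`, `α₂`, `θ = α₁ + α₂`. -/
inductive PosRoot : Type
  | α₁
  | α₂
  | θ

/-- The row of the matrix unit spanning the root space. -/
def PosRoot.row : PosRoot → Fin 3
  | .α₁ => 0
  | .α₂ => 1
  | .θ => 0

/-- The column of the matrix unit spanning the root space. -/
def PosRoot.col : PosRoot → Fin 3
  | .α₁ => 1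
  | .α₂ => 2
  | .θ => 2

theorem PosRoot.row_ne_col (α : PosRoot) : α.row ≠ α.col := by
  cases α <;> decide

/-- The simple roots `α₁`, `α₂`. -/
def simpleRoot : Fin 2 → PosRoot := ![.α₁, .α₂]

/-- The root vector `x_α⁺`: `E₁₂`, `E₂₃`, `E₁₃` for `α₁`, `α₂`, `θ`. -/
def xPos (α : PosRoot) : G := LieAlgebra.SpecialLinear.single α.row α.col α.row_ne_col 1

/-- The root vector `x_α⁻`: `E₂₁`, `E₃₂`, `E₃₁` for `α₁`, `α₂`, `θ`. -/
def xNeg (α : PosRoot) : G := LieAlgebra.SpecialLinear.single α.col α.row α.row_ne_col.symm 1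

/-- The coroot `h_α = [x_α⁺, x_α⁻]`. -/
def coroot (α : PosRoot) : G := ⁅xPos α, xNeg α⁆

/-- The element `x ⊗ tʳ` of the enveloping algebra of the current algebra. -/
def cur (x : G) (r : ℕ) : Ut :=
  UniversalEnvelopingAlgebra.ι ℂ ((Polynomial.X ^ r : ℂ[X]) ⊗ₜ[ℂ] x)

/-- The divided power `y⁽ˢ⁾ = yˢ / s!`. -/
def divPow (y : Ut) (s : ℕ) : Ut := ((s.factorial : ℂ)⁻¹) • y ^ s

/-- The degree `s` part of the enveloping algebra of the current algebra: the span of the products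
`(x₁ ⊗ t^{r₁}) ⋯ (x_p ⊗ t^{r_p})` with `r₁ + ⋯ + r_p = s`. -/
def UtDeg (s : ℕ) : Submodule ℂ Ut :=
  Submodule.span ℂ
    {y | ∃ w : List (G × ℕ), (w.map Prod.snd).sum = s ∧
      y = (w.map fun p => cur p.1 p.2).prod}

/-- `Gr` is a `ℤ₊`-grading of the `sl₃[t]`-module `M`, i.e. makes it a graded representation. -/
structure IsGradedRep (M : Type) [AddCommGroup M] [Module Ut M] [Module ℂ M]
    (Gr : ℕ → Submodule ℂ M) : Prop where
  internal : DirectSum.IsInternal Gr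
  smul_mem : ∀ s r : ℕ, ∀ y ∈ UtDeg s, ∀ m ∈ Gr r, y • m ∈ Gr (r + s)

/-- The grading of `τ_d^* M`: the degree `s` part is `M[s - d]` (and `0` for `s < d`). -/
def shift {M : Type} [AddCommGroup M] [Module ℂ M] (d : ℕ) (Gr : ℕ → Submodule ℂ M) (s : ℕ) :
    Submodule ℂ M :=
  if d ≤ s then Gr (s - d) else ⊥

/-! ## Weights and irreducible modules -/

/-- Dominant integral weights; `(a, b)` stands for `a ω₁ + b ω₂`. -/
abbrev Weight : Type := ℕ × ℕ

/-- The value `λ(h_α)`. -/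
def pairing (l : Weight) : PosRoot → ℕ
  | .α₁ => l.1
  | .α₂ => l.2
  | .θ => l.1 + l.2

theorem pairing_add (l m : Weight) (α : PosRoot) :
    pairing (l + m) α = pairing l α + pairing m α := by
  cases α
  · rfl
  · rfl
  · simp only [pairing, Prod.fst_add, Prod.snd_add]; omega

/-- The defining relations of the irreducible module `V(λ)`:
`n⁺ v = 0`, `h v = λ(h) v`, `(x_{αᵢ}⁻)^{λ(h_{αᵢ}) + 1} v = 0`. -/
def irrRel (l : Weight) : Submodule U U :=
  Submodule.span U
    ({y | ∃ α, y = UniversalEnvelopingAlgebra.ι ℂ (xPos α)} ∪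
     {y | ∃ i, y = UniversalEnvelopingAlgebra.ι ℂ (coroot (simpleRoot i)) -
        algebraMap ℂ U (pairing l (simpleRoot i))} ∪
     {y | ∃ i, y = UniversalEnvelopingAlgebra.ι ℂ (xNeg (simpleRoot i)) ^
        (pairing l (simpleRoot i) + 1)})

/-- The irreducible finite-dimensional `sl₃`-module `V(λ)`, presented by generator and
relations. -/
abbrev V (l : Weight) : Type := U ⧸ irrRel l

/-- The highest weight vector `v_λ` of `V(λ)`. -/
def hwv (l : Weight) : V l := Submodule.Quotient.mk 1

/-- The representation of `sl₃` on `V(λ)`. -/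
def irrRep (l : Weight) : G →ₗ⁅ℂ⁆ Module.End ℂ (V l) :=
  (UniversalEnvelopingAlgebra.lift ℂ).symm (Algebra.lsmul ℂ ℂ (V l))

/-! ## Chari--Venkatesh modules -/

/-- The sum `∑_{j ≥ k + 1} ξ_j` over the parts `ξ₁ ≥ ξ₂ ≥ ⋯` of a partition. -/
def tailSum {n : ℕ} (ξ : n.Partition) (k : ℕ) : ℕ :=
  ((ξ.parts.sort (· ≥ ·)).drop k).sum

/-- The `λ`-compatible tuples `ξ = (ξ^α)` of partitions, indexed by the positive roots:
`ξ^α` is a partition of `λ(h_α)`. -/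
abbrev Compatible (l : Weight) : Type := ∀ α : PosRoot, (pairing l α).Partition

/-- The defining relations of the local Weyl module with highest weight `λ`. -/
def weylRelSet (l : Weight) : Set Ut :=
  {y | ∃ α s, y = cur (xPos α) s} ∪
  {y | ∃ i s, y = cur (coroot (simpleRoot i)) s -
      algebraMap ℂ Ut (if s = 0 then (pairing l (simpleRoot i) : ℂ) else 0)} ∪
  {y | ∃ i, y = cur (xNeg (simpleRoot i)) 0 ^ (pairing l (simpleRoot i) + 1)}

/-- The defining relations of the Chari--Venkatesh module `V(ξ)`. -/
def cvRel (l : Weight) (ξ : Compatible l) : Submodule Ut Ut :=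
  Submodule.span Ut
    (weylRelSet l ∪
     {y | ∃ (α : PosRoot) (r s k : ℕ), 1 ≤ r ∧ 1 ≤ s ∧ 1 ≤ k ∧
        1 + r * k + tailSum (ξ α) k ≤ s + r ∧
        y = divPow (cur (xPos α) 1) s * divPow (cur (xNeg α) 0) (r + s)})

/-- The Chari--Venkatesh module `V(ξ)` of a `λ`-compatible tuple of partitions. -/
abbrev CV (l : Weight) (ξ : Compatible l) : Type := Ut ⧸ cvRel l ξ

/-- The generator `v_ξ` of `V(ξ)`. -/
def cvGen (l : Weight) (ξ : Compatible l) : CV l ξ := Submodule.Quotient.mk 1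

/-- The grading of `V(ξ)`: the degree `s` part is `U(sl₃[t])[s] v_ξ`. -/
def cvDeg (l : Weight) (ξ : Compatible l) (s : ℕ) : Submodule ℂ (CV l ξ) :=
  (UtDeg s).map (((cvRel l ξ).mkQ).restrictScalars ℂ)

/-- The tuple of partitions attached to a pair of weights: `ξ^α` has the parts `λ(h_α)` and
`μ(h_α)`, with zeros omitted. -/
def pairPartition (l m : Weight) : Compatible (l + m) := fun α =>
  Nat.Partition.ofSums _ {pairing l α, pairing m α} (by simp [pairing_add])

/-- The module `F_{λ,μ}`. -/
abbrev F (l m : Weight) : Type := CV (l + m) (pairPartition l m)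

/-- The generator `v_{λ,μ}` of `F_{λ,μ}`. -/
abbrev fGen (l m : Weight) : F l m := cvGen (l + m) (pairPartition l m)

/-- The grading of `F_{λ,μ}`. -/
abbrev fDeg (l m : Weight) (s : ℕ) : Submodule ℂ (F l m) := cvDeg (l + m) (pairPartition l m) s

/-- The pair of weights defining `F⁺_{λ,μ}` (for `μ ≠ 0`): `(λ + ω₂, μ - ω₂)` if `λ₂ ≥ μ₂ > 0`,
`(λ + ω₁, μ - ω₁)` if `μ₁ > 0` and `μ₂ = 0`, and
`(λ + (μ₂ - λ₂) ω₂, μ - (μ₂ - λ₂) ω₂)` if `λ₂ < μ₂`. -/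
def plusPair (l m : Weight) : Weight × Weight :=
  if l.2 < m.2 then ((l.1, l.2 + (m.2 - l.2)), (m.1, m.2 - (m.2 - l.2)))
  else if 0 < m.2 then ((l.1, l.2 + 1), (m.1, m.2 - 1))
  else ((l.1 + 1, l.2), (m.1 - 1, m.2))

/-- The module `F⁺_{λ,μ}` (for `μ ≠ 0`). -/
abbrev FPlus (l m : Weight) : Type := F (plusPair l m).1 (plusPair l m).2

/-! ## Fusion products -/

/-- Evaluation `f ⊗ x ↦ f(z) x`, a homomorphism of Lie algebras `sl₃[t] → sl₃`. -/
def ev (z : ℂ) : Gt →ₗ⁅ℂ⁆ G where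
  toLinearMap := TensorProduct.lift
    ((LinearMap.lsmul ℂ G).comp (Polynomial.aeval z : ℂ[X] →ₐ[ℂ] ℂ).toLinearMap)
  map_lie' := by
    intro x y
    induction x using TensorProduct.induction_on with
    | zero => simp
    | add x₁ x₂ h₁ h₂ => simp_all [add_lie]
    | tmul f a =>
      induction y using TensorProduct.induction_on with
      | zero => simp
      | add y₁ y₂ h₁ h₂ => simp_all [lie_add]
      | tmul g b => simpa [LieAlgebra.ExtendScalars.bracket_tmul, mul_smul] using smul_comm _ _ _

theorem ev_tmul (z : ℂ) (f : ℂ[X]) (x : G) : ev z (f ⊗ₜ x) = f.eval z • x := by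
  change (Polynomial.aeval z f : ℂ) • x = _
  simp

section Tensor

variable {L A B : Type} [LieRing L] [LieAlgebra ℂ L] [AddCommGroup A] [Module ℂ A]
  [AddCommGroup B] [Module ℂ B]

/-- The tensor product of two representations: `x (a ⊗ b) = x a ⊗ b + a ⊗ x b`. -/
def tensorRep (ρ : L →ₗ⁅ℂ⁆ Module.End ℂ A) (σ : L →ₗ⁅ℂ⁆ Module.End ℂ B) :
    L →ₗ⁅ℂ⁆ Module.End ℂ (A ⊗[ℂ] B) where
  toFun x := LinearMap.rTensor B (ρ x) + LinearMap.lTensor A (σ x)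
  map_add' x y := by
    ext a b
    simp
    abel
  map_smul' c x := by
    ext a b
    simp [TensorProduct.smul_tmul']
  map_lie' := by
    intro x y
    ext a b
    simp [LieRing.of_associative_ring_bracket]
    abel

end Tensor

section AssociatedGraded

variable {M : Type} [AddCommGroup M] [Module ℂ M] (ρ : Gt →ₗ⁅ℂ⁆ Module.End ℂ M) (v : M)

/-- The subspace `U(sl₃[t])[r] v`. -/
def degSpan (r : ℕ) : Submodule ℂ M :=
  (UtDeg r).map
    ((LinearMap.applyₗ v).comp (UniversalEnvelopingAlgebra.lift ℂ ρ).toLinearMap)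

/-- The filtration `M[k] = ∑_{0 ≤ r ≤ k} U(sl₃[t])[r] v`. -/
def fil (k : ℕ) : Submodule ℂ M := ⨆ r ∈ Set.Iic k, degSpan ρ v r

/-- The preceding step `M[k - 1]` of the filtration, which is `0` for `k = 0`. -/
def filPred : ℕ → Submodule ℂ M
  | 0 => ⊥
  | k + 1 => fil ρ v k

theorem act_degSpan (x : G) (r k : ℕ) {m : M} (hm : m ∈ degSpan ρ v k) :
    ρ ((Polynomial.X ^ r : ℂ[X]) ⊗ₜ x) m ∈ degSpan ρ v (k + r) := by
  obtain ⟨y, hy, rfl⟩ := hm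
  refine ⟨cur x r * y, ?_, ?_⟩
  · refine Submodule.span_induction (p := fun y _ => cur x r * y ∈ UtDeg (k + r))
      ?_ ?_ ?_ ?_ hy
    · rintro _ ⟨w, hw, rfl⟩
      exact Submodule.subset_span ⟨(x, r) :: w, by simp [hw, add_comm], by simp⟩
    · simp
    · intro a b _ _ ha hb
      rw [mul_add]
      exact add_mem ha hb
    · intro c a _ ha
      rw [mul_smul_comm]
      exact Submodule.smul_mem _ _ ha
  · simp [cur]

theorem act_fil (x : G) (r k : ℕ) {m : M} (hm : m ∈ fil ρ v k) :
    ρ ((Polynomial.X ^ r : ℂ[X]) ⊗ₜ x) m ∈ fil ρ v (k + r) := by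
  have h : fil ρ v k ≤ (fil ρ v (k + r)).comap (ρ ((Polynomial.X ^ r : ℂ[X]) ⊗ₜ x)) := by
    refine iSup₂_le fun j hj m hm => ?_
    have hj' : j + r ∈ Set.Iic (k + r) := Nat.add_le_add_right hj r
    exact le_iSup₂_of_le (f := fun r _ => degSpan ρ v r) (j + r) hj' le_rfl
      (act_degSpan ρ v x r j hm)
  exact h hm

theorem act_filPred (x : G) (r k : ℕ) {m : M} (hm : m ∈ filPred ρ v k) :
    ρ ((Polynomial.X ^ r : ℂ[X]) ⊗ₜ x) m ∈ filPred ρ v (k + r) := by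
  cases k with
  | zero =>
    have : m = 0 := by simpa [filPred] using hm
    simp [this]
  | succ k =>
    have : k + 1 + r = (k + r) + 1 := by omega
    rw [this]
    exact act_fil ρ v x r k hm

/-- The degree `k` part `M[k] / M[k - 1]` of the associated graded space. -/
abbrev GrPart (k : ℕ) : Type := fil ρ v k ⧸ (filPred ρ v k).submoduleOf (fil ρ v k)

/-- The associated graded space `⨁ₖ M[k] / M[k - 1]`. -/
def Gr : Type := ⨁ k : ℕ, GrPart ρ v k

instance : AddCommGroup (Gr ρ v) := inferInstanceAs (AddCommGroup (⨁ k : ℕ, GrPart ρ v k))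

instance : Module ℂ (Gr ρ v) := inferInstanceAs (Module ℂ (⨁ k : ℕ, GrPart ρ v k))

/-- The inclusion of the degree `k` part in the associated graded space. -/
def grIncl (k : ℕ) : GrPart ρ v k →ₗ[ℂ] Gr ρ v := DirectSum.lof ℂ ℕ (GrPart ρ v) k

/-- The class in `M[k] / M[k - 1]`, placed in degree `k`, of an element of `M[k]`. -/
def grMk (k : ℕ) (m : M) (hm : m ∈ fil ρ v k) : Gr ρ v :=
  grIncl ρ v k (Submodule.Quotient.mk ⟨m, hm⟩)

/-- The map `M[k] / M[k - 1] → M[k + r] / M[k + r - 1]` induced by `x ⊗ tʳ`. -/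
def actPart (x : G) (r k : ℕ) : GrPart ρ v k →ₗ[ℂ] GrPart ρ v (k + r) :=
  Submodule.mapQ _ _
    ((ρ ((Polynomial.X ^ r : ℂ[X]) ⊗ₜ x)).restrict fun _ hm => act_fil ρ v x r k hm)
    fun m hm => act_filPred ρ v x r k (m := (m : M)) hm

/-- The operator by which `x ⊗ tʳ` acts on the associated graded space. -/
def actGr (x : G) (r : ℕ) : Module.End ℂ (Gr ρ v) :=
  DirectSum.toModule ℂ ℕ (Gr ρ v) (M := GrPart ρ v) fun k =>
    (grIncl ρ v (k + r)).comp (actPart ρ v x r k)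

theorem actGr_grMk (x : G) (r k : ℕ) (m : M) (hm : m ∈ fil ρ v k) :
    actGr ρ v x r (grMk ρ v k m hm) =
      grMk ρ v (k + r) (ρ ((Polynomial.X ^ r : ℂ[X]) ⊗ₜ x) m) (act_fil ρ v x r k hm) := by
  have := DirectSum.toModule_lof ℂ (M := GrPart ρ v) (φ := fun k =>
    (grIncl ρ v (k + r)).comp (actPart ρ v x r k)) k
    (Submodule.Quotient.mk ⟨m, hm⟩)
  exact this

theorem grMk_congr {k k' : ℕ} {m m' : M} (hk : k = k') (h : m = m') (hm : m ∈ fil ρ v k) :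
    grMk ρ v k m hm = grMk ρ v k' m' (hk ▸ h ▸ hm) := by
  subst hk h; rfl

theorem grMk_add (k : ℕ) (m m' : M) (hm : m ∈ fil ρ v k) (hm' : m' ∈ fil ρ v k) :
    grMk ρ v k (m + m') (add_mem hm hm') = grMk ρ v k m hm + grMk ρ v k m' hm' :=
  map_add ((grIncl ρ v k).comp (Submodule.mkQ _)) (⟨m, hm⟩ : fil ρ v k) ⟨m', hm'⟩

theorem grMk_sub (k : ℕ) (m m' : M) (hm : m ∈ fil ρ v k) (hm' : m' ∈ fil ρ v k) :
    grMk ρ v k (m - m') (sub_mem hm hm') = grMk ρ v k m hm - grMk ρ v k m' hm' :=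
  map_sub ((grIncl ρ v k).comp (Submodule.mkQ _)) (⟨m, hm⟩ : fil ρ v k) ⟨m', hm'⟩

theorem grMk_smul (k : ℕ) (c : ℂ) (m : M) (hm : m ∈ fil ρ v k) :
    grMk ρ v k (c • m) (Submodule.smul_mem _ c hm) = c • grMk ρ v k m hm :=
  map_smul ((grIncl ρ v k).comp (Submodule.mkQ _)) c (⟨m, hm⟩ : fil ρ v k)

theorem gr_hom_ext {f g : Module.End ℂ (Gr ρ v)}
    (h : ∀ k m hm, f (grMk ρ v k m hm) = g (grMk ρ v k m hm)) : f = g := by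
  refine DirectSum.linearMap_ext (M := GrPart ρ v) ℂ fun k => ?_
  refine LinearMap.ext fun q => ?_
  obtain ⟨⟨m, hm⟩, rfl⟩ := Submodule.Quotient.mk_surjective _ q
  exact h k m hm

theorem actGr_lie (x y : G) (r s : ℕ) :
    actGr ρ v ⁅x, y⁆ (r + s) = ⁅actGr ρ v x r, actGr ρ v y s⁆ := by
  refine gr_hom_ext ρ v fun k m hm => ?_
  rw [LieRing.of_associative_ring_bracket, LinearMap.sub_apply, Module.End.mul_apply,
    Module.End.mul_apply]
  simp only [actGr_grMk]
  have e : k + s + r = k + (r + s) := by omega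
  have e' : k + r + s = k + (r + s) := by omega
  rw [grMk_congr ρ v e rfl, grMk_congr ρ v e' rfl, ← grMk_sub]
  refine grMk_congr ρ v rfl ?_ _
  have : ((Polynomial.X ^ (r + s) : ℂ[X]) ⊗ₜ[ℂ] ⁅x, y⁆ : Gt) =
      ⁅((Polynomial.X ^ r : ℂ[X]) ⊗ₜ[ℂ] x : Gt), (Polynomial.X ^ s : ℂ[X]) ⊗ₜ[ℂ] y⁆ := by
    rw [LieAlgebra.ExtendScalars.bracket_tmul, pow_add]
  rw [this, LieHom.map_lie, LieRing.of_associative_ring_bracket]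
  rfl

/-- `x ↦` the operator of `x ⊗ tʳ` on the associated graded space, as a linear map. -/
def actGrₗ (r : ℕ) : G →ₗ[ℂ] Module.End ℂ (Gr ρ v) where
  toFun x := actGr ρ v x r
  map_add' x y := by
    refine gr_hom_ext ρ v fun k m hm => ?_
    rw [LinearMap.add_apply]
    simp only [actGr_grMk]
    rw [← grMk_add]
    refine grMk_congr ρ v rfl ?_ _
    simp [TensorProduct.tmul_add]
  map_smul' c x := by
    refine gr_hom_ext ρ v fun k m hm => ?_
    rw [RingHom.id_apply, LinearMap.smul_apply]
    simp only [actGr_grMk]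
    rw [← grMk_smul]
    refine grMk_congr ρ v rfl ?_ _
    simp

/-- The linear map `sl₃[t] → End(gr M)` with `tʳ ⊗ x ↦ actGr x r`. -/
def grLin : Gt →ₗ[ℂ] Module.End ℂ (Gr ρ v) :=
  TensorProduct.lift ((Polynomial.basisMonomials ℂ).constr ℂ (actGrₗ ρ v))

theorem grLin_monomial (r : ℕ) (c : ℂ) (x : G) :
    grLin ρ v (Polynomial.monomial r c ⊗ₜ x) = c • actGr ρ v x r := by
  have h : (Polynomial.monomial r c : ℂ[X]) = c • Polynomial.basisMonomials ℂ r := by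
    simp [Polynomial.smul_monomial]
  rw [grLin, TensorProduct.lift.tmul, h, map_smul, Module.Basis.constr_basis]
  rfl

/-- The representation of `sl₃[t]` on the associated graded space of the filtration. -/
def grRep : Gt →ₗ⁅ℂ⁆ Module.End ℂ (Gr ρ v) where
  toLinearMap := grLin ρ v
  map_lie' := by
    intro x y
    change grLin ρ v (LieRing.toBracket.bracket x y) = ⁅grLin ρ v x, grLin ρ v y⁆
    have hL : ∀ x₁ x₂ y : Gt, grLin ρ v ⁅x₁, y⁆ = ⁅grLin ρ v x₁, grLin ρ v y⁆ →
        grLin ρ v ⁅x₂, y⁆ = ⁅grLin ρ v x₂, grLin ρ v y⁆ →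
        grLin ρ v ⁅x₁ + x₂, y⁆ = ⁅grLin ρ v (x₁ + x₂), grLin ρ v y⁆ := by
      intro x₁ x₂ y h₁ h₂
      refine ((congrArg (grLin ρ v) (add_lie x₁ x₂ y)).trans
        ((map_add (grLin ρ v) _ _).trans (congrArg₂ (· + ·) h₁ h₂))).trans ?_
      rw [map_add (grLin ρ v) x₁ x₂, add_lie]
    have hR : ∀ x y₁ y₂ : Gt, grLin ρ v ⁅x, y₁⁆ = ⁅grLin ρ v x, grLin ρ v y₁⁆ →
        grLin ρ v ⁅x, y₂⁆ = ⁅grLin ρ v x, grLin ρ v y₂⁆ →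
        grLin ρ v ⁅x, y₁ + y₂⁆ = ⁅grLin ρ v x, grLin ρ v (y₁ + y₂)⁆ := by
      intro x y₁ y₂ h₁ h₂
      refine ((congrArg (grLin ρ v) (lie_add x y₁ y₂)).trans
        ((map_add (grLin ρ v) _ _).trans (congrArg₂ (· + ·) h₁ h₂))).trans ?_
      rw [map_add (grLin ρ v) y₁ y₂, lie_add]
    induction x using TensorProduct.induction_on with
    | zero =>
      refine ((congrArg (grLin ρ v) (zero_lie y)).trans (map_zero _)).trans ?_
      rw [map_zero, zero_lie]
    | add x₁ x₂ h₁ h₂ => exact hL x₁ x₂ y h₁ h₂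
    | tmul f a =>
      induction y using TensorProduct.induction_on with
      | zero =>
        refine ((congrArg (grLin ρ v) (lie_zero (f ⊗ₜ[ℂ] a : Gt))).trans (map_zero _)).trans ?_
        rw [map_zero, lie_zero]
      | add y₁ y₂ h₁ h₂ => exact hR _ y₁ y₂ h₁ h₂
      | tmul g b =>
        induction f using Polynomial.induction_on' with
        | add f₁ f₂ h₁ h₂ =>
          rw [TensorProduct.add_tmul]
          exact hL _ _ _ h₁ h₂
        | monomial r c =>
          induction g using Polynomial.induction_on' with
          | add g₁ g₂ h₁ h₂ =>
            rw [TensorProduct.add_tmul]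
            exact hR _ _ _ h₁ h₂
          | monomial s d =>
            refine (congrArg (grLin ρ v)
              (LieAlgebra.ExtendScalars.bracket_tmul ℂ ℂ[X] G G _ _ _ _)).trans ?_
            rw [Polynomial.monomial_mul_monomial,
              grLin_monomial, grLin_monomial, grLin_monomial, actGr_lie, smul_lie, lie_smul,
              smul_smul]

end AssociatedGraded

/-- The representation of `sl₃[t]` on `V(λ) ⊗ V(μ)` evaluated at `(z₁, z₂)`:
`f ⊗ x` acts as `f(z₁) x ⊗ 1 + f(z₂) 1 ⊗ x`. -/
def evalRep (l m : Weight) (z₁ z₂ : ℂ) : Gt →ₗ⁅ℂ⁆ Module.End ℂ (V l ⊗[ℂ] V m) :=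
  tensorRep ((irrRep l).comp (ev z₁)) ((irrRep m).comp (ev z₂))

/-- The fusion product `V(λ)^{z₁} * V(μ)^{z₂}`: the associated graded space of the filtration
generated by `v_λ ⊗ v_μ` on the evaluation module. -/
def Fusion (l m : Weight) (z₁ z₂ : ℂ) : Type :=
  Gr (evalRep l m z₁ z₂) (hwv l ⊗ₜ hwv m)

instance (l m : Weight) (z₁ z₂ : ℂ) : AddCommGroup (Fusion l m z₁ z₂) :=
  inferInstanceAs (AddCommGroup (Gr (evalRep l m z₁ z₂) (hwv l ⊗ₜ hwv m)))

/-- The action of `U(sl₃[t])` on the fusion product. -/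
instance (l m : Weight) (z₁ z₂ : ℂ) : Module Ut (Fusion l m z₁ z₂) :=
  Module.compHom (Gr (evalRep l m z₁ z₂) (hwv l ⊗ₜ hwv m))
    (UniversalEnvelopingAlgebra.lift ℂ
      (grRep (evalRep l m z₁ z₂) (hwv l ⊗ₜ hwv m))).toRingHom

/-- The submodule `N` of `F_{λ,μ}` is a graded submodule: it is the sum of its intersections with
the homogeneous components. -/
def IsGradedSub (l m : Weight) (N : Submodule Ut (F l m)) : Prop :=
  N.restrictScalars ℂ = ⨆ s, N.restrictScalars ℂ ⊓ fDeg l m s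

/-- For graded submodules `N ≤ N'` of `F_{λ,μ}`: the graded module `N' / N` is isomorphic to a
finite direct sum of grade shifted Chari--Venkatesh modules. -/
def QuotientIsSumOfCV (l m : Weight) (N N' : Submodule Ut (F l m)) : Prop :=
  ∃ (k : ℕ) (ν : Fin k → Weight) (ξ : ∀ j, Compatible (ν j)) (d : Fin k → ℕ)
    (e : (N' ⧸ N.submoduleOf N') ≃ₗ[Ut] ⨁ j : Fin k, CV (ν j) (ξ j)),
    ∀ (s : ℕ) (x : N'), (x : F l m) ∈ fDeg l m s →
      ∀ j, e (Submodule.Quotient.mk x) j ∈ shift (d j) (cvDeg (ν j) (ξ j)) s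

end SL3

end

/-!
# Chari--Venkatesh modules and fusion products for `sl₃`

The argument compares upper and lower bounds for the dimension of `F_{λ,μ}`.

**Presentation.** The Garland identities show that `F_{λ,μ}` is a module over `sl₃ ⊗ ℂ[t]/t²`,
cyclic on a highest weight vector of weight `ν = λ + μ` killed by the power
`min (λ(h_α)) (μ(h_α)) + 1` of `x_α⁻ ⊗ t`, and that these relations (`TakiffRel`) present it
(`takiffRel_fGen`, `TakiffRel.exists_lift`). The generator of the fusion product satisfies them too
(`takiffRel_fusGen`), so that `F_{λ,μ}` maps onto the fusion product, and
`dim V(λ) * dim V(μ) ≤ dim F_{λ,μ}`.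

**Filtration.** The commuting elements `x_α⁻ ⊗ t` produce the monomials `tMonomial w i j k`. An
argument with `α₁`- and `α₂`-strings in integrable `sl₂`-modules shows that the submodule generated
by a monomial is already generated by the *essential* ones above it (`essential`,
`TakiffRel.tMonomial_mem`). Hence upper sets of essential triples of exponents give submodules
`tSpan`, and the successive quotients are quotients of `F_{κ,0}`, which is `V(κ)` with `sl₃ ⊗ t`
acting by zero, for `κ` the weight of the monomial (`TakiffRel.step`). So `dim F_{λ,μ}` is at most
the sum of the dimensions of these `V(κ)`.

**Comparison.** Put `weylDim x y = (x + 1) (y + 1) (x + y + 2)`. Twice the sum of the values of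
`weylDim` over the weights of the essential monomials is `weylDim λ * weylDim μ`
(`sum_essential_minPart`): the non-essential monomials may be added, since their contributions
cancel under reflection of strings, and the sum over all monomials has a closed form. A spanning
set gives `2 dim V(κ) ≤ weylDim κ`. If equality holds for `λ` and `μ` as in the theorem, then all
the inequalities above are equalities; in particular equality holds for the weight `λ + μ` of the
generator. Starting from the trivial and the two fundamental representations this proves the Weyl
dimension formula (`two_mul_finrank_V`), and then all the inequalities are equalities for all `λ`
and `μ` as in the theorem. Therefore `F_{λ,μ}` is isomorphic to the fusion product
(`nonempty_equiv_fusion`), and each step of the filtration is isomorphic to `F_{κ,0}`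
(`quotientIsSumOfCV_tSpan`). The kernel of the map to `F⁺`, again by counting dimensions, is the
submodule `tSpan` of the essential monomials which are not essential for `F⁺` (`exists_map_plus`),
so it is filtered in the same way.

All relations are homogeneous in `t`. The components of an element are read off from the coaction
`coact`, which sends `x ⊗ tʳ` to `(x ⊗ tʳ) Xʳ`.
-/

noncomputable section

namespace SL3

attribute [local instance] LieRing.ofAssociativeRing

/-! ### Chevalley generators of `sl₃` and their brackets -/

theorem val_bracket (x y : G) : (⁅x, y⁆ : G).val = x.val * y.val - y.val * x.val := rfl

open PosRoot in
theorem val_chevalley :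
    (xPos α₁).val = !![0, 1, 0; 0, 0, 0; 0, 0, 0] ∧ (xPos α₂).val = !![0, 0, 0; 0, 0, 1; 0, 0, 0] ∧
    (xPos θ).val = !![0, 0, 1; 0, 0, 0; 0, 0, 0] ∧ (xNeg α₁).val = !![0, 0, 0; 1, 0, 0; 0, 0, 0] ∧
    (xNeg α₂).val = !![0, 0, 0; 0, 0, 0; 0, 1, 0] ∧
    (xNeg θ).val = !![0, 0, 0; 0, 0, 0; 1, 0, 0] := by
  refine ⟨?_, ?_, ?_, ?_, ?_, ?_⟩ <;> ext i j <;> fin_cases i <;> fin_cases j <;> rfl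

open PosRoot in
theorem val_coroot :
    (coroot α₁).val = !![1, 0, 0; 0, -1, 0; 0, 0, 0] ∧
    (coroot α₂).val = !![0, 0, 0; 0, 1, 0; 0, 0, -1] ∧
    (coroot θ).val = !![1, 0, 0; 0, 0, 0; 0, 0, -1] := by
  obtain ⟨h1, h2, h3, h4, h5, h6⟩ := val_chevalley
  refine ⟨?_, ?_, ?_⟩ <;> rw [← Matrix.ext_iff] <;>
    simp [coroot, val_bracket, h1, h2, h3, h4, h5, h6, Fin.forall_fin_succ,
      -LieSubalgebra.coe_bracket]

open PosRoot in
theorem bracket_table :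
    ⁅xPos α₁, xNeg α₂⁆ = 0 ∧ ⁅xPos α₂, xNeg α₁⁆ = 0 ∧ ⁅xPos α₁, xNeg θ⁆ = -xNeg α₂ ∧
    ⁅xPos α₂, xNeg θ⁆ = xNeg α₁ ∧ ⁅xPos α₁, xPos α₂⁆ = xPos θ ∧ ⁅xNeg α₁, xNeg α₂⁆ = -xNeg θ ∧
    ⁅xNeg α₁, xNeg θ⁆ = 0 ∧ ⁅xNeg α₂, xNeg θ⁆ = 0 ∧ coroot θ = coroot α₁ + coroot α₂ ∧
    (∀ α, ⁅coroot α, xNeg α⁆ = (-2 : ℂ) • xNeg α) ∧ (∀ α, ⁅coroot α, xPos α⁆ = (2 : ℂ) • xPos α) ∧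
    ⁅coroot α₁, xNeg α₂⁆ = xNeg α₂ ∧ ⁅coroot α₁, xNeg θ⁆ = -xNeg θ ∧
    ⁅coroot α₂, xNeg α₁⁆ = xNeg α₁ ∧ ⁅coroot α₂, xNeg θ⁆ = -xNeg θ := by
  obtain ⟨h1, h2, h3, h4, h5, h6⟩ := val_chevalley
  obtain ⟨c1, c2, c3⟩ := val_coroot
  refine ⟨?_, ?_, ?_, ?_, ?_, ?_, ?_, ?_, ?_, fun α => ?_, fun α => ?_, ?_, ?_, ?_, ?_⟩ <;>
  (try cases α) <;> apply Subtype.ext <;> rw [← Matrix.ext_iff] <;>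
  simp [val_bracket, h1, h2, h3, h4, h5, h6, c1, c2, c3, Fin.forall_fin_succ,
    -LieSubalgebra.coe_bracket] <;> norm_num

section Brackets

open PosRoot

theorem lie_xPos₁_xNeg₂ : ⁅xPos α₁, xNeg α₂⁆ = 0 := bracket_table.1

theorem lie_xPos₂_xNeg₁ : ⁅xPos α₂, xNeg α₁⁆ = 0 := bracket_table.2.1

theorem lie_xPos₁_xNegθ : ⁅xPos α₁, xNeg θ⁆ = -xNeg α₂ := bracket_table.2.2.1

theorem lie_xPos₂_xNegθ : ⁅xPos α₂, xNeg θ⁆ = xNeg α₁ := bracket_table.2.2.2.1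

theorem lie_xPos₁_xPos₂ : ⁅xPos α₁, xPos α₂⁆ = xPos θ := bracket_table.2.2.2.2.1

theorem lie_xNeg₁_xNeg₂ : ⁅xNeg α₁, xNeg α₂⁆ = -xNeg θ := bracket_table.2.2.2.2.2.1

theorem lie_xNeg₁_xNegθ : ⁅xNeg α₁, xNeg θ⁆ = 0 := bracket_table.2.2.2.2.2.2.1

theorem lie_xNeg₂_xNegθ : ⁅xNeg α₂, xNeg θ⁆ = 0 := bracket_table.2.2.2.2.2.2.2.1

theorem coroot_θ : coroot θ = coroot α₁ + coroot α₂ := bracket_table.2.2.2.2.2.2.2.2.1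

theorem lie_coroot_xNeg : ∀ α, ⁅coroot α, xNeg α⁆ = (-2 : ℂ) • xNeg α :=
  bracket_table.2.2.2.2.2.2.2.2.2.1

theorem lie_coroot_xPos : ∀ α, ⁅coroot α, xPos α⁆ = (2 : ℂ) • xPos α :=
  bracket_table.2.2.2.2.2.2.2.2.2.2.1

theorem lie_coroot₁_xNeg₂ : ⁅coroot α₁, xNeg α₂⁆ = xNeg α₂ := bracket_table.2.2.2.2.2.2.2.2.2.2.2.1

theorem lie_coroot₁_xNegθ : ⁅coroot α₁, xNeg θ⁆ = -xNeg θ := bracket_table.2.2.2.2.2.2.2.2.2.2.2.2.1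

theorem lie_coroot₂_xNeg₁ : ⁅coroot α₂, xNeg α₁⁆ = xNeg α₁ :=
  bracket_table.2.2.2.2.2.2.2.2.2.2.2.2.2.1

theorem lie_coroot₂_xNegθ : ⁅coroot α₂, xNeg θ⁆ = -xNeg θ :=
  bracket_table.2.2.2.2.2.2.2.2.2.2.2.2.2.2

end Brackets

/-! ### The elements `x ⊗ tʳ` of the enveloping algebra -/

theorem cur_mul (x y : G) (r s : ℕ) :
    cur x r * cur y s = cur y s * cur x r + cur ⁅x, y⁆ (r + s) := by
  have h : (Polynomial.X ^ (r + s) : ℂ[X]) ⊗ₜ[ℂ] ⁅x, y⁆ =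
      ⁅((Polynomial.X ^ r : ℂ[X]) ⊗ₜ[ℂ] x : Gt), (Polynomial.X ^ s : ℂ[X]) ⊗ₜ[ℂ] y⁆ := by
    rw [LieAlgebra.ExtendScalars.bracket_tmul, pow_add]
  rw [cur, cur, cur, h, LieHom.map_lie, LieRing.of_associative_ring_bracket]
  abel

/-- The map `x ↦ x ⊗ tʳ` from `sl₃` to the enveloping algebra of `sl₃[t]`, as a linear map. -/
def curₗ (r : ℕ) : G →ₗ[ℂ] Ut :=
  (UniversalEnvelopingAlgebra.ι ℂ : Gt →ₗ⁅ℂ⁆ Ut).toLinearMap ∘ₗ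
    TensorProduct.mk ℂ ℂ[X] G (Polynomial.X ^ r)

theorem curₗ_apply (r x) : curₗ r x = cur x r := rfl

theorem cur_add (x y : G) (r) : cur (x + y) r = cur x r + cur y r := map_add (curₗ r) x y

theorem cur_neg (x : G) (r) : cur (-x) r = -cur x r := map_neg (curₗ r) x

theorem cur_zero (r) : cur 0 r = 0 := map_zero (curₗ r)

theorem cur_smul (c : ℂ) (x : G) (r) : cur (c • x) r = c • cur x r := map_smul (curₗ r) c x

theorem span_chevalley (P : Submodule ℂ G) (hx : ∀ α, xPos α ∈ P) (hy : ∀ α, xNeg α ∈ P)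
    (hh : ∀ i, coroot (simpleRoot i) ∈ P) (x : G) : x ∈ P := by
  have htr : x.val 0 0 + x.val 1 1 + x.val 2 2 = 0 := by
    have : Matrix.trace x.val = 0 := LinearMap.mem_ker.1 x.2
    simpa [Matrix.trace, Fin.sum_univ_three] using this
  have : x = x.val 0 1 • xPos .α₁ + x.val 1 2 • xPos .α₂ + x.val 0 2 • xPos .θ +
      x.val 1 0 • xNeg .α₁ + x.val 2 1 • xNeg .α₂ + x.val 2 0 • xNeg .θ +
      x.val 0 0 • coroot (simpleRoot 0) + (-x.val 2 2) • coroot (simpleRoot 1) := by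
    obtain ⟨h1, h2, h3, h4, h5, h6⟩ := val_chevalley
    obtain ⟨c1, c2, c3⟩ := val_coroot
    apply Subtype.ext
    have e : x.val 1 1 = -x.val 0 0 - x.val 2 2 := by linear_combination htr
    rw [Matrix.eta_fin_three x.val, e]
    simp [simpleRoot, h1, h2, h3, h4, h5, h6, c1, c2, sub_eq_add_neg]
  rw [this]
  exact P.add_mem (P.add_mem (P.add_mem (P.add_mem (P.add_mem (P.add_mem (P.add_mem
    (P.smul_mem _ (hx _)) (P.smul_mem _ (hx _))) (P.smul_mem _ (hx _))) (P.smul_mem _ (hy _)))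
    (P.smul_mem _ (hy _))) (P.smul_mem _ (hy _))) (P.smul_mem _ (hh _))) (P.smul_mem _ (hh _))

/-! ### Triples `(e, f, h)` in associative algebras -/

section Sl2

variable {A M : Type*} [Ring A] [Algebra ℂ A] [AddCommGroup M] [Module ℂ M] [Module A M]
  [IsScalarTower ℂ A M]

/-- The commutation relations of the standard basis `e`, `f`, `h` of `sl₂`, for elements of an
associative algebra. -/
structure IsSl2 (e f h : A) : Prop where
  ef : e * f = f * e + h
  hf : h * f = f * h - (2 : ℂ) • f
  he : h * e = e * h + (2 : ℂ) • e

namespace IsSl2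

variable {e f h : A}

theorem symm (t : IsSl2 e f h) : IsSl2 f e (-h) where
  ef := by rw [t.ef]; abel
  hf := by rw [neg_mul, t.he]; simp only [mul_neg]; abel
  he := by rw [neg_mul, t.hf]; simp only [mul_neg]; abel

theorem h_smul_pow (t : IsSl2 e f h) {u : M} {c : ℂ} (hu : h • u = c • u) (n : ℕ) :
    h • f ^ n • u = (c - 2 * n) • f ^ n • u := by
  induction n with
  | zero => simpa using hu
  | succ n ih =>
    rw [pow_succ', mul_smul, ← mul_smul h f, t.hf, sub_smul, mul_smul, ih, smul_comm f, smul_assoc]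
    push_cast
    generalize f • f ^ n • u = w
    module

theorem e_smul_pow_succ (t : IsSl2 e f h) {u : M} {c : ℂ} (hu : h • u = c • u) (n : ℕ) :
    e • f ^ (n + 1) • u = f ^ (n + 1) • e • u + ((n + 1) * (c - n) : ℂ) • f ^ n • u := by
  induction n with
  | zero =>
    simp only [zero_add, pow_one, pow_zero, one_smul]
    rw [← mul_smul, t.ef, add_smul, mul_smul, hu]
    simp
  | succ n ih =>
    rw [pow_succ' f (n + 1), mul_smul, ← mul_smul e f, t.ef, add_smul, mul_smul, ih,
      t.h_smul_pow hu, smul_add,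
      smul_comm f ((n + 1) * (c - n) : ℂ) (f ^ n • u), ← mul_smul f (f ^ n),
      ← mul_smul f (f ^ (n + 1)),
      ← pow_succ', ← pow_succ']
    push_cast
    generalize f ^ (n + 1) • u = w
    generalize f ^ (n + 1 + 1) • e • u = w'
    module

/-- A vector which is highest modulo `P`, of weight `c`, satisfies the integrability relation
`fⁿ u ∈ P` for `n > c` as soon as some power of `f` takes it into `P`. -/
theorem pow_smul_mem (t : IsSl2 e f h) {P : Submodule ℂ M} (hPe : ∀ m ∈ P, e • m ∈ P)
    (hPf : ∀ m ∈ P, f • m ∈ P) {u : M} {c : ℤ} (hu : h • u = (c : ℂ) • u) (heu : e • u ∈ P)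
    (hN : ∃ N : ℕ, f ^ N • u ∈ P) {n : ℕ} (hn : c < n) : f ^ n • u ∈ P := by
  have hpow : ∀ k : ℕ, ∀ m ∈ P, f ^ k • m ∈ P := by
    intro k
    induction k with
    | zero => simp
    | succ k ih => intro m hm; rw [pow_succ', mul_smul]; exact hPf _ (ih m hm)
  have key : ∀ k : ℕ, f ^ (n + k) • u ∈ P → f ^ n • u ∈ P := by
    intro k
    induction k with
    | zero => exact id
    | succ k ih =>
      intro hk
      refine ih ?_
      have h1 := hPe _ hk
      rw [← add_assoc, t.e_smul_pow_succ hu] at h1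
      have h2 := (P.add_mem_iff_right (hpow _ _ heu)).1 h1
      refine (P.smul_mem_iff ?_).1 h2
      have h3 : ((n + k : ℕ) : ℤ) + 1 ≠ 0 := by positivity
      have h4 : c - ((n + k : ℕ) : ℤ) ≠ 0 := by push_cast; omega
      exact_mod_cast mul_ne_zero h3 h4
  obtain ⟨N, hN⟩ := hN
  refine key N ?_
  rw [pow_add, mul_smul]
  exact hpow _ _ hN

/-- In an integrable `sl₂`-module, the operator `e ^ n` is injective on the space of weight `c`,
modulo any submodule, for `n ≤ -c`. -/
theorem mem_of_pow_smul_mem (t : IsSl2 e f h) {P : Submodule ℂ M} (hPe : ∀ m ∈ P, e • m ∈ P)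
    (hPf : ∀ m ∈ P, f • m ∈ P) (hloc : ∀ m : M, ∃ N : ℕ, f ^ N • m = 0) {c : ℤ}
    {n : ℕ} (hn : (n : ℤ) ≤ -c) {y : M} (hy : h • y = (c : ℂ) • y) (hmem : e ^ n • y ∈ P) :
    y ∈ P := by
  have hpow : ∀ k : ℕ, ∀ m ∈ P, f ^ k • m ∈ P := by
    intro k
    induction k with
    | zero => simp
    | succ k ih => intro m hm; rw [pow_succ', mul_smul]; exact hPf _ (ih m hm)
  induction n generalizing y with
  | zero => simpa using hmem
  | succ n ih =>
    have hey : h • e • y = ((c : ℂ) + 2) • e • y := by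
      have := t.symm.h_smul_pow (u := y) (c := -c) (by rw [neg_smul, hy, neg_smul]) 1
      rw [pow_one, neg_smul] at this
      rw [← neg_neg (h • e • y), this]
      push_cast
      generalize e • y = w
      module
    have hfey : h • f • e • y = (c : ℂ) • f • e • y := by
      have := t.h_smul_pow hey 1
      rw [pow_one] at this
      rw [this]
      push_cast
      generalize f • e • y = w
      module
    -- The combination of `y` and `f e y` killed by `e ^ n` modulo `P`.
    have hcomb : f • e • y - ((n : ℂ) * (c + n + 1)) • y ∈ P := by
      refine ih (by push_cast at hn; omega) ?_ ?_
      · rw [smul_sub, hfey, smul_comm h _ y, hy]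
        generalize f • e • y = w
        module
      · rcases n with _ | n
        · simpa using hPf _ (by simpa using hmem)
        · have h1 := t.symm.e_smul_pow_succ (u := e • y) (c := -((c : ℂ) + 2))
            (by rw [neg_smul, hey, neg_smul]) n
          have h2 : e ^ (n + 1) • (f • e • y - (((n + 1 : ℕ) : ℂ) * (c + (n + 1 : ℕ) + 1)) • y) =
              f • e ^ (n + 1 + 1) • y := by
            rw [pow_succ e (n + 1), mul_smul (e ^ (n + 1)), h1, smul_sub,
                smul_comm (e ^ (n + 1)) _ y,
              ← mul_smul (e ^ n) e y, ← pow_succ]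
            push_cast
            generalize e ^ (n + 1) • f • e • y = w
            generalize e ^ (n + 1) • y = w'
            module
          rw [h2]
          exact hPf _ hmem
    have key : ∀ N : ℕ, f ^ N • y ∈ P → y ∈ P := by
      intro N
      induction N with
      | zero => simp
      | succ N ihN =>
        intro hN
        refine ihN ?_
        have h1 := hPe _ hN
        rw [t.e_smul_pow_succ hy, pow_succ, mul_smul] at h1
        have h2 := hpow N _ hcomb
        rw [smul_sub, smul_comm (f ^ N) _ y] at h2
        have h3 := P.sub_mem h1 h2
        have h4 : ((n : ℂ) * (c + n + 1) + (N + 1) * (c - N)) • f ^ N • y ∈ P := by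
          convert h3 using 1
          generalize f ^ N • f • e • y = w
          generalize f ^ N • y = w'
          generalize f ^ N • e • y = w''
          module
        refine (P.smul_mem_iff ?_).1 h4
        have h5 : (n : ℤ) * (c + n + 1) + (N + 1) * (c - N) ≠ 0 := by
          have h6 : (n : ℤ) * (c + n + 1) ≤ 0 :=
            mul_nonpos_of_nonneg_of_nonpos (by positivity) (by push_cast at hn; omega)
          have h7 : ((N : ℤ) + 1) * (c - N) < 0 :=
            mul_neg_of_pos_of_neg (by positivity) (by omega)
          omega
        exact_mod_cast h5
    obtain ⟨N, hN⟩ := hloc y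
    exact key N (by rw [hN]; exact P.zero_mem)

end IsSl2

omit [Algebra ℂ A] [Module ℂ M] [IsScalarTower ℂ A M] in
/-- If `z` is killed by a power of `ad x`, then it preserves the set of vectors killed by some
power of `x`. -/
theorem exists_pow_smul_eq_zero_smul (x : A) (K : ℕ) :
    ∀ (z : A), (fun z => x * z - z * x)^[K] z = 0 →
      ∀ m : M, (∃ N, x ^ N • m = 0) → ∃ N, x ^ N • z • m = 0 := by
  induction K with
  | zero =>
    intro z hz m _
    exact ⟨0, by simp [show z = 0 from hz]⟩
  | succ K ih =>
    rintro z hz m ⟨N, hN⟩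
    induction N generalizing m with
    | zero => exact ⟨0, by simp [show m = 0 by simpa using hN]⟩
    | succ N ihN =>
      obtain ⟨N₁, h₁⟩ := ihN (x • m) (by rw [← mul_smul, ← pow_succ, hN])
      obtain ⟨N₂, h₂⟩ := ih _ hz m ⟨N + 1, hN⟩
      refine ⟨N₁ + N₂ + 1, ?_⟩
      have h₃ : x • z • m = z • x • m + (x * z - z * x) • m := by
        rw [sub_smul, mul_smul, mul_smul]; abel
      have h₄ : x ^ (N₁ + N₂) • z • x • m = 0 := by
        rw [add_comm, pow_add, mul_smul, h₁, smul_zero]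
      rw [pow_succ, mul_smul, h₃, smul_add, h₄, pow_add, mul_smul, h₂, smul_zero, zero_add]

end Sl2

/-! ### Cyclic modules over enveloping algebras -/

/-- A Lie algebra generates its enveloping algebra. -/
theorem uea_adjoin {L : Type} [LieRing L] [LieAlgebra ℂ L] :
    Algebra.adjoin ℂ (Set.range (UniversalEnvelopingAlgebra.ι ℂ :
      L →ₗ⁅ℂ⁆ UniversalEnvelopingAlgebra ℂ L)) = ⊤ := by
  set S := Algebra.adjoin ℂ (Set.range (UniversalEnvelopingAlgebra.ι ℂ :
    L →ₗ⁅ℂ⁆ UniversalEnvelopingAlgebra ℂ L)) with hS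
  let g : L →ₗ⁅ℂ⁆ S :=
    { toFun := fun x => ⟨UniversalEnvelopingAlgebra.ι ℂ x, Algebra.subset_adjoin ⟨x, rfl⟩⟩
      map_add' := fun x y => Subtype.ext (map_add _ x y)
      map_smul' := fun c x => Subtype.ext (map_smul _ c x)
      map_lie' := fun {x y} => Subtype.ext (LieHom.map_lie _ x y) }
  have h : S.val.comp (UniversalEnvelopingAlgebra.lift ℂ g) = AlgHom.id ℂ _ := by
    apply UniversalEnvelopingAlgebra.hom_ext
    ext x
    simp [g]
  refine eq_top_iff.2 fun y _ => ?_
  have := congrArg (fun f : _ →ₐ[ℂ] _ => f y) h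
  rw [← show S.val (UniversalEnvelopingAlgebra.lift ℂ g y) = y from this]
  exact (UniversalEnvelopingAlgebra.lift ℂ g y).2

section Stable

variable {A M : Type*} [Ring A] [Algebra ℂ A] [AddCommGroup M] [Module ℂ M] [Module A M]
  [IsScalarTower ℂ A M]

theorem smul_mem_of_adjoin {s : Set A} (hs : Algebra.adjoin ℂ s = ⊤) (P : Submodule ℂ M)
    (h : ∀ a ∈ s, ∀ m ∈ P, a • m ∈ P) (a : A) : ∀ m ∈ P, a • m ∈ P := by
  have ha : a ∈ Algebra.adjoin ℂ s := hs ▸ trivial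
  induction ha using Algebra.adjoin_induction with
  | mem a ha => exact h a ha
  | algebraMap c => intro m hm; rw [algebraMap_smul]; exact P.smul_mem _ hm
  | add a b _ _ ha hb => intro m hm; rw [add_smul]; exact P.add_mem (ha m hm) (hb m hm)
  | mul a b _ _ ha hb => intro m hm; rw [mul_smul]; exact ha _ (hb m hm)

/-- If `x` is ad-nilpotent on a set of generators of the algebra and acts nilpotently on a cyclic
vector, then it acts locally nilpotently. -/
theorem exists_pow_smul_eq_zero_of_adjoin {s : Set A} (hs : Algebra.adjoin ℂ s = ⊤) {x : A} {K : ℕ}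
    (hK : ∀ z ∈ s, (fun z => x * z - z * x)^[K] z = 0) {w : M} (hw : Submodule.span A {w} = ⊤)
    (h : ∃ N, x ^ N • w = 0) (m : M) : ∃ N, x ^ N • m = 0 := by
  let P : Submodule ℂ M :=
    { carrier := {m | ∃ N, x ^ N • m = 0}
      add_mem' := by
        rintro a b ⟨N, hN⟩ ⟨N', hN'⟩
        refine ⟨N + N', ?_⟩
        rw [smul_add, pow_add, mul_smul _ _ b, hN', smul_zero, add_zero, ← pow_add, add_comm,
          pow_add, mul_smul, hN, smul_zero]
      zero_mem' := ⟨0, smul_zero _⟩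
      smul_mem' := by
        rintro c a ⟨N, hN⟩
        exact ⟨N, by rw [smul_comm, hN, smul_zero]⟩ }
  obtain ⟨y, rfl⟩ := Submodule.mem_span_singleton.1
    (show m ∈ Submodule.span A {w} from hw ▸ Submodule.mem_top)
  exact smul_mem_of_adjoin hs P
    (fun z hz m hm => exists_pow_smul_eq_zero_smul x K z (hK z hz) m hm) y w h

end Stable

theorem adjoin_cur : Algebra.adjoin ℂ {y : Ut | ∃ x r, y = cur x r} = ⊤ := by
  rw [eq_top_iff, ← uea_adjoin, Algebra.adjoin_le_iff]
  rintro _ ⟨z, rfl⟩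
  induction z using TensorProduct.induction_on with
  | zero => simp
  | add x y hx hy => rw [map_add]; exact add_mem hx hy
  | tmul f x =>
    induction f using Polynomial.induction_on' with
    | add f g hf hg => rw [TensorProduct.add_tmul, map_add]; exact add_mem hf hg
    | monomial r c =>
      rw [← Polynomial.smul_X_eq_monomial, ← TensorProduct.smul_tmul', map_smul]
      have h : cur x r ∈ Algebra.adjoin ℂ {y : Ut | ∃ x r, y = cur x r} :=
        Algebra.subset_adjoin ⟨x, r, rfl⟩
      exact Subalgebra.smul_mem _ h c

section UtModule

variable {M : Type*} [AddCommGroup M] [Module ℂ M] [Module Ut M] [IsScalarTower ℂ Ut M]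

theorem smul_mem_of_cur (P : Submodule ℂ M) (h : ∀ x r, ∀ m ∈ P, cur x r • m ∈ P) (y : Ut) :
    ∀ m ∈ P, y • m ∈ P :=
  smul_mem_of_adjoin adjoin_cur P (by rintro _ ⟨x, r, rfl⟩; exact h x r) y

/-- A subspace containing a cyclic vector and stable under all `x ⊗ tʳ` is everything. -/
theorem eq_top_of_cur {w : M} (hw : Submodule.span Ut {w} = ⊤) (P : Submodule ℂ M)
    (h : ∀ x r, ∀ m ∈ P, cur x r • m ∈ P) (hwP : w ∈ P) : P = ⊤ := by
  refine eq_top_iff.2 fun m _ => ?_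
  obtain ⟨y, rfl⟩ :=
    Submodule.mem_span_singleton.1 (show m ∈ Submodule.span Ut {w} from hw ▸ trivial)
  exact smul_mem_of_cur P h y w hwP

theorem cur_induction {r : ℕ} {p : Ut → Prop} (hadd : ∀ a b, p a → p b → p (a + b))
    (hsmul : ∀ (c : ℂ) a, p a → p (c • a)) (hx : ∀ α, p (cur (xPos α) r))
    (hy : ∀ α, p (cur (xNeg α) r)) (hh : ∀ i, p (cur (coroot (simpleRoot i)) r)) (x : G) :
    p (cur x r) :=
  span_chevalley
    { carrier := {x | p (cur x r)}
      add_mem' := fun {x y} h h' => by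
        change p (cur (x + y) r); rw [cur_add]; exact hadd _ _ h h'
      smul_mem' := fun c x h => by change p (cur (c • x) r); rw [cur_smul]; exact hsmul _ _ h
      zero_mem' := by
        change p (cur 0 r)
        have := hsmul 0 _ (hx .α₁)
        rwa [zero_smul, ← cur_zero] at this } hx hy hh x

end UtModule

/-! ### The grading of the enveloping algebra -/

theorem cur_mem_UtDeg (x : G) (r : ℕ) : cur x r ∈ UtDeg r :=
  Submodule.subset_span ⟨[(x, r)], by simp, by simp⟩

theorem one_mem_UtDeg : (1 : Ut) ∈ UtDeg 0 := Submodule.subset_span ⟨[], by simp, by simp⟩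

theorem mul_mem_UtDeg {r s : ℕ} {y z : Ut} (hy : y ∈ UtDeg r) (hz : z ∈ UtDeg s) :
    y * z ∈ UtDeg (r + s) := by
  have := Submodule.mul_mem_mul hy hz
  rw [UtDeg, UtDeg, Submodule.span_mul_span] at this
  refine Submodule.span_mono ?_ this
  rintro _ ⟨_, ⟨w, hw, rfl⟩, _, ⟨w', hw', rfl⟩, rfl⟩
  exact ⟨w ++ w', by simp [hw, hw'], by simp⟩

theorem pow_mem_UtDeg {r : ℕ} {y : Ut} (hy : y ∈ UtDeg r) (n : ℕ) : y ^ n ∈ UtDeg (n * r) := by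
  induction n with
  | zero => simpa using one_mem_UtDeg
  | succ n ih => rw [pow_succ, Nat.succ_mul]; exact mul_mem_UtDeg ih hy

theorem iSup_UtDeg : ⨆ s, UtDeg s = ⊤ := by
  refine eq_top_of_cur (w := (1 : Ut)) (by simp) _ (fun x r m hm => ?_)
    (Submodule.mem_iSup_of_mem 0 one_mem_UtDeg)
  refine Submodule.iSup_induction UtDeg (motive := fun m => cur x r • m ∈ ⨆ s, UtDeg s) hm ?_ ?_ ?_
  · intro i m hm
    exact Submodule.mem_iSup_of_mem (r + i) (mul_mem_UtDeg (cur_mem_UtDeg x r) hm)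
  · simp
  · intro a b ha hb
    rw [smul_add]
    exact add_mem ha hb

/-- The homomorphism of Lie algebras from `sl₃[t]` to an associative algebra with prescribed
values `φ r x` on the elements `x ⊗ tʳ`. -/
def lieHomOfMonomials {A : Type} [Ring A] [Algebra ℂ A] (φ : ℕ → G →ₗ[ℂ] A)
    (hφ : ∀ r s x y, φ (r + s) ⁅x, y⁆ = φ r x * φ s y - φ s y * φ r x) : Gt →ₗ⁅ℂ⁆ A where
  toLinearMap := TensorProduct.lift ((Polynomial.basisMonomials ℂ).constr ℂ φ)
  map_lie' := by
    intro x y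
    set F : Gt →ₗ[ℂ] A := TensorProduct.lift ((Polynomial.basisMonomials ℂ).constr ℂ φ) with hF
    have hmon : ∀ (r : ℕ) (c : ℂ) (x : G), F (Polynomial.monomial r c ⊗ₜ x) = c • φ r x := by
      intro r c x
      have h : (Polynomial.monomial r c : ℂ[X]) = c • Polynomial.basisMonomials ℂ r := by
        simp [Polynomial.smul_monomial]
      rw [hF, TensorProduct.lift.tmul, h, map_smul, Module.Basis.constr_basis]
      rfl
    change F ⁅x, y⁆ = ⁅F x, F y⁆
    have hL : ∀ x₁ x₂ y : Gt, F ⁅x₁, y⁆ = ⁅F x₁, F y⁆ → F ⁅x₂, y⁆ = ⁅F x₂, F y⁆ →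
        F ⁅x₁ + x₂, y⁆ = ⁅F (x₁ + x₂), F y⁆ := by
      intro x₁ x₂ y h₁ h₂
      rw [map_add F, add_lie (F x₁), ← h₁, ← h₂, ← map_add F]
      exact congrArg F (add_lie x₁ x₂ y)
    have hR : ∀ x y₁ y₂ : Gt, F ⁅x, y₁⁆ = ⁅F x, F y₁⁆ → F ⁅x, y₂⁆ = ⁅F x, F y₂⁆ →
        F ⁅x, y₁ + y₂⁆ = ⁅F x, F (y₁ + y₂)⁆ := by
      intro x y₁ y₂ h₁ h₂
      rw [map_add F, lie_add (F x), ← h₁, ← h₂, ← map_add F]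
      exact congrArg F (lie_add x y₁ y₂)
    induction x using TensorProduct.induction_on with
    | zero => rw [map_zero F, zero_lie]; exact (congrArg F (zero_lie y)).trans (map_zero F)
    | add x₁ x₂ h₁ h₂ => exact hL x₁ x₂ y h₁ h₂
    | tmul f a =>
      induction y using TensorProduct.induction_on with
      | zero =>
        rw [map_zero F, lie_zero]
        exact (congrArg F (lie_zero (f ⊗ₜ[ℂ] a : Gt))).trans (map_zero F)
      | add y₁ y₂ h₁ h₂ => exact hR _ y₁ y₂ h₁ h₂
      | tmul g b =>
        induction f using Polynomial.induction_on' with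
        | add f₁ f₂ h₁ h₂ => rw [TensorProduct.add_tmul]; exact hL _ _ _ h₁ h₂
        | monomial r c =>
          induction g using Polynomial.induction_on' with
          | add g₁ g₂ h₁ h₂ => rw [TensorProduct.add_tmul]; exact hR _ _ _ h₁ h₂
          | monomial s d =>
            refine (congrArg F (LieAlgebra.ExtendScalars.bracket_tmul ℂ ℂ[X] G G _ _ _ _)).trans ?_
            rw [Polynomial.monomial_mul_monomial, hmon, hmon, hmon, hφ,
              LieRing.of_associative_ring_bracket, smul_mul_smul_comm, smul_mul_smul_comm,
              smul_sub, mul_comm d c]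

theorem lieHomOfMonomials_X_pow {A : Type} [Ring A] [Algebra ℂ A] (φ : ℕ → G →ₗ[ℂ] A) (hφ)
    (r : ℕ) (x : G) :
    lieHomOfMonomials φ hφ ((Polynomial.X ^ r : ℂ[X]) ⊗ₜ x) = φ r x := by
  have h : (Polynomial.X ^ r : ℂ[X]) = Polynomial.basisMonomials ℂ r := by
    simp [Polynomial.X_pow_eq_monomial]
  change TensorProduct.lift ((Polynomial.basisMonomials ℂ).constr ℂ φ) _ = _
  rw [TensorProduct.lift.tmul, h, Module.Basis.constr_basis]

/-- The coaction `y ↦ ∑ₛ yₛ Xˢ`, where `yₛ` is the component of `y` of degree `s`. -/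
def coact : Ut →ₐ[ℂ] Ut[X] :=
  UniversalEnvelopingAlgebra.lift ℂ (lieHomOfMonomials
    (fun r => ((Polynomial.monomial r : Ut →ₗ[Ut] Ut[X]).restrictScalars ℂ) ∘ₗ curₗ r) (by
      intro r s x y
      simp only [LinearMap.comp_apply, LinearMap.restrictScalars_apply, curₗ_apply,
        Polynomial.monomial_mul_monomial, add_comm s r, ← map_sub]
      rw [cur_mul x y, add_sub_cancel_left]))

theorem coact_cur (x : G) (r : ℕ) : coact (cur x r) = Polynomial.monomial r (cur x r) := by
  rw [coact, cur, UniversalEnvelopingAlgebra.lift_ι_apply, lieHomOfMonomials_X_pow]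
  rfl

theorem coact_of_mem {s : ℕ} {y : Ut} (hy : y ∈ UtDeg s) : coact y = Polynomial.monomial s y := by
  induction hy using Submodule.span_induction with
  | mem y h =>
    obtain ⟨w, hw, rfl⟩ := h
    induction w generalizing s with
    | nil => simp at hw; subst hw; simp
    | cons p w ih =>
      simp only [List.map_cons, List.sum_cons] at hw
      rw [List.map_cons, List.prod_cons, map_mul, coact_cur, ih rfl,
        Polynomial.monomial_mul_monomial, hw]
  | zero => simp
  | add a b _ _ ha hb => rw [map_add, ha, hb, map_add]
  | smul c a _ ha => rw [map_smul, ha, Polynomial.smul_monomial]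

/-- The component of degree `s` of an element of the enveloping algebra. -/
def utComp (s : ℕ) : Ut →ₗ[ℂ] Ut :=
  ((Polynomial.lcoeff Ut s).restrictScalars ℂ) ∘ₗ coact.toLinearMap

theorem utComp_apply (s : ℕ) (y : Ut) : utComp s y = (coact y).coeff s := rfl

theorem utComp_of_mem {r : ℕ} {y : Ut} (hy : y ∈ UtDeg r) (s : ℕ) :
    utComp s y = if r = s then y else 0 := by
  rw [utComp_apply, coact_of_mem hy, Polynomial.coeff_monomial]

theorem utComp_mem (s : ℕ) (y : Ut) : utComp s y ∈ UtDeg s := by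
  have hy : y ∈ ⨆ s, UtDeg s := iSup_UtDeg ▸ trivial
  induction hy using Submodule.iSup_induction' with
  | mem i x hx =>
    rw [utComp_of_mem hx]
    split_ifs with h
    · exact h ▸ hx
    · exact zero_mem _
  | zero => simp
  | add a b _ _ ha hb => rw [map_add]; exact add_mem ha hb

theorem exists_sum_utComp (y : Ut) : ∃ n, ∀ m, n ≤ m → y = ∑ s ∈ Finset.range m, utComp s y := by
  have hy : y ∈ ⨆ s, UtDeg s := iSup_UtDeg ▸ trivial
  induction hy using Submodule.iSup_induction' with
  | mem i x hx =>
    refine ⟨i + 1, fun m hm => ?_⟩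
    simp only [utComp_of_mem hx]
    rw [Finset.sum_ite_eq, if_pos (Finset.mem_range.2 hm)]
  | zero => exact ⟨0, by simp⟩
  | add a b _ _ ha hb =>
    obtain ⟨n, hn⟩ := ha
    obtain ⟨n', hn'⟩ := hb
    refine ⟨max n n', fun m hm => ?_⟩
    simp only [map_add, Finset.sum_add_distrib]
    rw [← hn m (by omega), ← hn' m (by omega)]

theorem utComp_mul_of_mem {d : ℕ} {g : Ut} (hg : g ∈ UtDeg d) (a : Ut) (s : ℕ) :
    utComp s (a * g) = if d ≤ s then utComp (s - d) a * g else 0 := by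
  rw [utComp_apply, map_mul, coact_of_mem hg]
  split_ifs with h
  · obtain ⟨k, rfl⟩ := Nat.exists_eq_add_of_le' h
    rw [Polynomial.coeff_mul_monomial, Nat.add_sub_cancel, utComp_apply]
  · rw [← Polynomial.C_mul_X_pow_eq_monomial, ← mul_assoc, Polynomial.coeff_mul_X_pow', if_neg h]

/-! ### The grading of Chari--Venkatesh modules -/

variable {l : Weight} {ξ : Compatible l}

/-- The defining relations of a Chari--Venkatesh module are homogeneous. -/
theorem exists_mem_UtDeg_of_rel {y : Ut} (hy : y ∈ weylRelSet l ∪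
     {y | ∃ (α : PosRoot) (r s k : ℕ), 1 ≤ r ∧ 1 ≤ s ∧ 1 ≤ k ∧
        1 + r * k + tailSum (ξ α) k ≤ s + r ∧
        y = divPow (cur (xPos α) 1) s * divPow (cur (xNeg α) 0) (r + s)}) : ∃ d, y ∈ UtDeg d := by
  rcases hy with ((⟨α, s, rfl⟩ | ⟨i, s, rfl⟩) | ⟨i, rfl⟩) | ⟨α, r, s, k, -, -, -, -, rfl⟩
  · exact ⟨s, cur_mem_UtDeg _ _⟩
  · refine ⟨s, sub_mem (cur_mem_UtDeg _ _) ?_⟩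
    split_ifs with h
    · subst h
      rw [Algebra.algebraMap_eq_smul_one]
      exact Submodule.smul_mem _ _ one_mem_UtDeg
    · simp
  · exact ⟨_, pow_mem_UtDeg (cur_mem_UtDeg _ _) _⟩
  · exact ⟨_, mul_mem_UtDeg (Submodule.smul_mem _ _ (pow_mem_UtDeg (cur_mem_UtDeg _ _) _))
      (Submodule.smul_mem _ _ (pow_mem_UtDeg (cur_mem_UtDeg _ _) _))⟩

/-- The left ideal of relations is graded, being generated by homogeneous elements. -/
theorem utComp_mem_cvRel (s : ℕ) {y : Ut} (hy : y ∈ cvRel l ξ) : utComp s y ∈ cvRel l ξ := by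
  induction hy using Submodule.closure_induction with
  | zero => simp
  | add a b _ _ ha hb => rw [map_add]; exact add_mem ha hb
  | smul_mem a g hg =>
    obtain ⟨d, hd⟩ := exists_mem_UtDeg_of_rel hg
    rw [smul_eq_mul, utComp_mul_of_mem hd]
    split_ifs
    · exact Submodule.smul_mem _ _ (Submodule.subset_span hg)
    · exact zero_mem _

/-- The component of degree `s` of an element of `V(ξ)`. -/
def cvComp (l : Weight) (ξ : Compatible l) (s : ℕ) : CV l ξ →ₗ[ℂ] CV l ξ :=
  Submodule.mapQ ((cvRel l ξ).restrictScalars ℂ) ((cvRel l ξ).restrictScalars ℂ) (utComp s)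
    fun _ hy => utComp_mem_cvRel s hy

theorem cvComp_smul_cvGen (s : ℕ) (y : Ut) :
    cvComp l ξ s (y • cvGen l ξ) = utComp s y • cvGen l ξ := by
  have h : ∀ z : Ut, z • cvGen l ξ = Submodule.Quotient.mk z := fun z => by
    rw [cvGen, ← Submodule.Quotient.mk_smul, smul_eq_mul, mul_one]
  rw [h, h]
  rfl

theorem exists_smul_cvGen (x : CV l ξ) : ∃ y : Ut, x = y • cvGen l ξ := by
  obtain ⟨y, rfl⟩ := Submodule.Quotient.mk_surjective _ x
  exact ⟨y, by rw [cvGen, ← Submodule.Quotient.mk_smul, smul_eq_mul, mul_one]⟩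

theorem span_cvGen : Submodule.span Ut {cvGen l ξ} = ⊤ := by
  refine eq_top_iff.2 fun x _ => ?_
  obtain ⟨y, rfl⟩ := exists_smul_cvGen x
  exact Submodule.smul_mem _ _ (Submodule.mem_span_singleton_self _)

theorem mem_cvDeg {s : ℕ} {x : CV l ξ} : x ∈ cvDeg l ξ s ↔ ∃ y ∈ UtDeg s, x = y • cvGen l ξ := by
  have h : ∀ z : Ut, z • cvGen l ξ = Submodule.Quotient.mk z := fun z => by
    rw [cvGen, ← Submodule.Quotient.mk_smul, smul_eq_mul, mul_one]
  constructor
  · rintro ⟨y, hy, rfl⟩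
    exact ⟨y, hy, (h y).symm⟩
  · rintro ⟨y, hy, rfl⟩
    exact ⟨y, hy, (h y).symm⟩

theorem smul_mem_cvDeg {r s : ℕ} {y : Ut} (hy : y ∈ UtDeg s) {x : CV l ξ} (hx : x ∈ cvDeg l ξ r) :
    y • x ∈ cvDeg l ξ (r + s) := by
  obtain ⟨z, hz, rfl⟩ := mem_cvDeg.1 hx
  exact mem_cvDeg.2 ⟨y * z, add_comm r s ▸ mul_mem_UtDeg hy hz, (mul_smul _ _ _).symm⟩

theorem cvComp_of_mem {r : ℕ} {x : CV l ξ} (hx : x ∈ cvDeg l ξ r) (s : ℕ) :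
    cvComp l ξ s x = if r = s then x else 0 := by
  obtain ⟨y, hy, rfl⟩ := mem_cvDeg.1 hx
  rw [cvComp_smul_cvGen, utComp_of_mem hy]
  split_ifs <;> simp

theorem cvComp_mem (s : ℕ) (x : CV l ξ) : cvComp l ξ s x ∈ cvDeg l ξ s := by
  obtain ⟨y, rfl⟩ := exists_smul_cvGen x
  rw [cvComp_smul_cvGen]
  exact mem_cvDeg.2 ⟨_, utComp_mem s y, rfl⟩

theorem cvComp_smul_of_mem {d : ℕ} {x : CV l ξ} (hx : x ∈ cvDeg l ξ d) (y : Ut) (s : ℕ) :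
    cvComp l ξ s (y • x) = if d ≤ s then utComp (s - d) y • x else 0 := by
  obtain ⟨z, hz, rfl⟩ := mem_cvDeg.1 hx
  rw [← mul_smul, cvComp_smul_cvGen, utComp_mul_of_mem hz]
  split_ifs
  · rw [mul_smul]
  · rw [zero_smul]

theorem exists_sum_cvComp (x : CV l ξ) : ∃ n, x = ∑ s ∈ Finset.range n, cvComp l ξ s x := by
  obtain ⟨y, rfl⟩ := exists_smul_cvGen x
  obtain ⟨n, hn⟩ := exists_sum_utComp y
  refine ⟨n, ?_⟩
  simp only [cvComp_smul_cvGen]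
  rw [← Finset.sum_smul, ← hn n le_rfl]

theorem isGradedRep_CV (l : Weight) (ξ : Compatible l) : IsGradedRep (CV l ξ) (cvDeg l ξ) where
  internal := by
    rw [DirectSum.isInternal_submodule_iff_iSupIndep_and_iSup_eq_top]
    constructor
    · rw [iSupIndep_def]
      intro s
      rw [Submodule.disjoint_def]
      intro x hx hx'
      have h : (⨆ r, ⨆ (_ : r ≠ s), cvDeg l ξ r) ≤ LinearMap.ker (cvComp l ξ s) := by
        refine iSup₂_le fun r hr x hx => ?_
        rw [LinearMap.mem_ker, cvComp_of_mem hx, if_neg hr]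
      have := h hx'
      rwa [LinearMap.mem_ker, cvComp_of_mem hx, if_pos rfl] at this
    · refine eq_top_iff.2 fun x _ => ?_
      obtain ⟨n, hn⟩ := exists_sum_cvComp x
      rw [hn]
      exact sum_mem fun s _ => Submodule.mem_iSup_of_mem s (cvComp_mem s x)
  smul_mem s r y hy m hm := smul_mem_cvDeg hy hm

/-! ### Modules over the truncated current algebra -/

section Takiff

variable {M : Type*} [AddCommGroup M] [Module ℂ M] [Module Ut M]

/-- The relations satisfied by the generator of `F_{λ,μ}`, with `ν = λ + μ` and
`p α = min (λ(h_α)) (μ(h_α))`: the module is one over `sl₃ ⊗ ℂ[t]/t²`, and `w` is a highest weight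
vector of weight `ν` killed by `(x_α⁻ ⊗ t)^{p α + 1}`. -/
structure TakiffRel (w : M) (ν : Weight) (p : PosRoot → ℕ) : Prop where
  xPos_smul : ∀ α s, cur (xPos α) s • w = 0
  coroot_smul : ∀ α s, cur (coroot α) s • w = ((if s = 0 then pairing ν α else 0 : ℕ) : ℂ) • w
  xNeg_pow : ∀ i, cur (xNeg (simpleRoot i)) 0 ^ (pairing ν (simpleRoot i) + 1) • w = 0
  two_le : ∀ x r, 2 ≤ r → ∀ m : M, cur x r • m = 0
  xNeg_t_pow : ∀ α, cur (xNeg α) 1 ^ (p α + 1) • w = 0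

omit [Module ℂ M] in
theorem cur_smul_cur_smul (x y : G) (r s : ℕ) (m : M) :
    cur x r • cur y s • m = cur y s • cur x r • m + cur ⁅x, y⁆ (r + s) • m := by
  rw [← mul_smul, cur_mul, add_smul, mul_smul]

variable [IsScalarTower ℂ Ut M]

theorem cur_smul_cur_smul_xNeg (α : PosRoot) (r s : ℕ) (m : M) :
    cur (coroot α) r • cur (xNeg α) s • m =
      cur (xNeg α) s • cur (coroot α) r • m - (2 : ℂ) • cur (xNeg α) (r + s) • m := by
  rw [cur_smul_cur_smul, lie_coroot_xNeg, cur_smul, smul_assoc, neg_smul,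
    sub_eq_add_neg]

/-- The elements of degree at least `R` act by zero on a cyclic module as soon as they kill its
generator. -/
theorem cur_smul_eq_zero {w : M} (hw : Submodule.span Ut {w} = ⊤) {R : ℕ}
    (h : ∀ x r, R ≤ r → cur x r • w = 0) (x : G) (r : ℕ) (hr : R ≤ r) (m : M) :
    cur x r • m = 0 := by
  let P : Submodule ℂ M :=
    { carrier := {m | ∀ x r, R ≤ r → cur x r • m = 0}
      add_mem' := fun {a b} ha hb x r hr => by rw [smul_add, ha x r hr, hb x r hr, add_zero]
      zero_mem' := fun x r _ => smul_zero _
      smul_mem' := fun c a ha x r hr => by rw [smul_comm, ha x r hr, smul_zero] }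
  have hP : P = ⊤ := eq_top_of_cur hw P (fun y s m hm x r hr => by
    rw [cur_smul_cur_smul, hm x r hr, smul_zero, zero_add]
    exact hm _ _ (hr.trans (Nat.le_add_right _ _))) h
  have hm : m ∈ P := hP ▸ Submodule.mem_top
  exact hm x r hr

theorem cur_smul_eq_zero_of_basis {r : ℕ} {m : M} (hx : ∀ α, cur (xPos α) r • m = 0)
    (hy : ∀ α, cur (xNeg α) r • m = 0) (hh : ∀ i, cur (coroot (simpleRoot i)) r • m = 0) (x : G) :
    cur x r • m = 0 :=
  cur_induction (p := fun a => a • m = 0) (fun a b ha hb => by rw [add_smul, ha, hb, add_zero])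
    (fun c a ha => by rw [smul_assoc, ha, smul_zero]) hx hy hh x

/-- The Garland identity for `s = 2`, `r = 1`, without any truncation. -/
theorem xPos_t_smul_pow_three {w : M} {α : PosRoot} (hx : ∀ s, cur (xPos α) s • w = 0)
    (hh : ∀ s, cur (coroot α) (s + 1) • w = 0) :
    cur (xPos α) 1 ^ 2 • cur (xNeg α) 0 ^ 3 • w = (12 : ℂ) • cur (xNeg α) 2 • w := by
  have hf : ∀ m : M, cur (xNeg α) 1 • cur (xNeg α) 0 • m = cur (xNeg α) 0 • cur (xNeg α) 1 • m :=
    fun m => by rw [cur_smul_cur_smul, lie_self, cur_zero, zero_smul, add_zero]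
  have he : ∀ r s (m : M), cur (xPos α) r • cur (xNeg α) s • m =
      cur (xNeg α) s • cur (xPos α) r • m + cur (coroot α) (r + s) • m :=
    fun r s m => cur_smul_cur_smul _ _ _ _ _
  have hc : ∀ (y : Ut) (m : M), y • (2 : ℂ) • m = (2 : ℂ) • y • m := fun y m => smul_comm _ _ _
  simp only [pow_succ, pow_zero, one_mul, mul_smul, he, cur_smul_cur_smul_xNeg, hx, hh, hf, hc,
    smul_zero, zero_add, zero_sub, add_zero, smul_neg, smul_add, smul_sub, Nat.reduceAdd]
  generalize cur (xNeg α) 2 • w = v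
  module

section Garland

variable {w : M} {α : PosRoot} (htop : ∀ x r, 2 ≤ r → ∀ m : M, cur x r • m = 0)
  (hx : cur (xPos α) 1 • w = 0) (hh : cur (coroot α) 1 • w = 0)
include htop hx hh

omit htop hx in
theorem coroot_t_smul_pow (n : ℕ) :
    cur (coroot α) 1 • cur (xNeg α) 0 ^ n • w =
      (-(2 * n) : ℂ) • cur (xNeg α) 1 • cur (xNeg α) 0 ^ (n - 1) • w := by
  induction n with
  | zero => simpa using hh
  | succ n ih =>
    rw [pow_succ', mul_smul, cur_smul_cur_smul_xNeg, ih, smul_comm (cur (xNeg α) 0) _ (_ • _),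
      cur_smul_cur_smul (xNeg α), lie_self, cur_zero, zero_smul, add_zero,
      ← mul_smul (cur (xNeg α) 0),
      ← pow_succ']
    rcases n with _ | n
    · simp
    · simp only [Nat.add_sub_cancel]
      generalize cur (xNeg α) 1 • cur (xNeg α) 0 ^ (n + 1) • w = v
      push_cast
      module

omit htop in
theorem xPos_t_smul_pow (n : ℕ) :
    cur (xPos α) 1 • cur (xNeg α) 0 ^ n • w =
      (-(n * (n - 1)) : ℂ) • cur (xNeg α) 1 • cur (xNeg α) 0 ^ (n - 2) • w := by
  induction n with
  | zero => simpa using hx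
  | succ n ih =>
    rw [pow_succ', mul_smul, cur_smul_cur_smul, ih, smul_comm (cur (xNeg α) 0) _ (_ • _),
      cur_smul_cur_smul (xNeg α), lie_self, cur_zero, zero_smul, add_zero,
      ← mul_smul (cur (xNeg α) 0),
      ← pow_succ']
    change _ + cur (coroot α) 1 • _ = _
    rw [coroot_t_smul_pow hh]
    rcases n with _ | _ | n
    · simp
    · norm_num
    · have e1 : n + 1 + 1 - 2 + 1 = n + 1 := by omega
      have e2 : n + 1 + 1 + 1 - 2 = n + 1 := by omega
      rw [e1, e2, Nat.add_sub_cancel]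
      generalize cur (xNeg α) 1 • cur (xNeg α) 0 ^ (n + 1) • w = v
      push_cast
      module

/-- The Garland identity over `ℂ[t]/t²`. -/
theorem xPos_t_pow_smul_pow (s n : ℕ) :
    cur (xPos α) 1 ^ s • cur (xNeg α) 0 ^ n • w =
      ((-1) ^ s * n.descFactorial (2 * s) : ℂ) •
        cur (xNeg α) 1 ^ s • cur (xNeg α) 0 ^ (n - 2 * s) • w := by
  have hcomm : ∀ (s : ℕ) (m : M),
      cur (xPos α) 1 ^ s • cur (xNeg α) 1 • m = cur (xNeg α) 1 • cur (xPos α) 1 ^ s • m := by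
    intro s
    induction s with
    | zero => simp
    | succ s ih =>
      intro m
      rw [pow_succ', mul_smul, ih, cur_smul_cur_smul, htop _ _ le_rfl, add_zero, mul_smul]
  induction s generalizing n with
  | zero => simp
  | succ s ih =>
    rw [pow_succ, mul_smul, xPos_t_smul_pow hx hh, smul_comm _ _ (_ • _), hcomm, ih,
      smul_comm (cur (xNeg α) 1), ← mul_smul (cur (xNeg α) 1), ← pow_succ', smul_smul]
    rcases n with _ | _ | n
    · simp [Nat.descFactorial_of_lt (show 0 < 2 * (s + 1) by omega)]
    · simp [Nat.descFactorial_of_lt (show 1 < 2 * (s + 1) by omega)]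
    · have e : n + 1 + 1 - 2 - 2 * s = n + 1 + 1 - 2 * (s + 1) := by omega
      have e' : (n + 1 + 1).descFactorial (2 * (s + 1)) =
          (n + 2) * ((n + 1) * n.descFactorial (2 * s)) := by
        rw [show 2 * (s + 1) = 2 * s + 1 + 1 by ring, Nat.succ_descFactorial_succ,
          Nat.succ_descFactorial_succ]
      rw [e, e', show n + 1 + 1 - 2 = n by omega]
      congr 1
      push_cast
      ring

end Garland

/-! ### The monomials in the root vectors of degree one -/

/-- The vector `(x₁⁻ ⊗ t)ⁱ (x₂⁻ ⊗ t)ʲ (x_θ⁻ ⊗ t)ᵏ w`. -/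
def tMonomial (w : M) (i j k : ℕ) : M :=
  cur (xNeg .α₁) 1 ^ i • cur (xNeg .α₂) 1 ^ j • cur (xNeg .θ) 1 ^ k • w

section Top

variable (htop : ∀ x r, 2 ≤ r → ∀ m : M, cur x r • m = 0)
include htop

omit [Module ℂ M] [IsScalarTower ℂ Ut M] in
theorem t_smul_comm (x y : G) (m : M) : cur x 1 • cur y 1 • m = cur y 1 • cur x 1 • m := by
  rw [cur_smul_cur_smul, htop _ _ le_rfl, add_zero]

omit [Module ℂ M] [IsScalarTower ℂ Ut M] in
theorem t_smul_pow_comm (x y : G) (n : ℕ) (m : M) :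
    cur x 1 • cur y 1 ^ n • m = cur y 1 ^ n • cur x 1 • m := by
  induction n with
  | zero => simp
  | succ n ih => rw [pow_succ', mul_smul, t_smul_comm htop, ih, mul_smul]

/-- Modulo degree two, `x ⊗ 1` acts on powers of `y ⊗ t` by a derivation, since the elements of
degree one commute. -/
theorem cur_zero_smul_t_pow (x y : G) (n : ℕ) (m : M) :
    cur x 0 • cur y 1 ^ n • m =
      cur y 1 ^ n • cur x 0 • m + (n : ℂ) • cur y 1 ^ (n - 1) • cur ⁅x, y⁆ 1 • m := by
  induction n with
  | zero => simp
  | succ n ih =>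
    rw [pow_succ', mul_smul, cur_smul_cur_smul, ih, smul_add, zero_add, t_smul_pow_comm htop ⁅x, y⁆,
      smul_comm (cur y 1) (n : ℂ) (_ • _), ← mul_smul (cur y 1) _ (cur x 0 • m), ← pow_succ',
      ← mul_smul (cur y 1) _ (cur ⁅x, y⁆ 1 • m), ← pow_succ', Nat.add_sub_cancel]
    rcases n with _ | n
    · simp
    · rw [Nat.add_sub_cancel, add_assoc]
      congr 1
      generalize cur y 1 ^ (n + 1) • cur ⁅x, y⁆ 1 • m = v
      push_cast
      module

omit [Module ℂ M] [IsScalarTower ℂ Ut M] in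
theorem t_smul_tMonomial (x : G) (w : M) (i j k : ℕ) :
    cur x 1 • tMonomial w i j k = tMonomial (cur x 1 • w) i j k := by
  simp only [tMonomial, t_smul_pow_comm htop x]

omit [Module ℂ M] [IsScalarTower ℂ Ut M] in
theorem tMonomial_succ_left (w : M) (i j k : ℕ) :
    tMonomial (cur (xNeg .α₁) 1 • w) i j k = tMonomial w (i + 1) j k := by
  rw [← t_smul_tMonomial htop, tMonomial, tMonomial, pow_succ', mul_smul]

omit [Module ℂ M] [IsScalarTower ℂ Ut M] in
theorem tMonomial_succ_mid (w : M) (i j k : ℕ) :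
    tMonomial (cur (xNeg .α₂) 1 • w) i j k = tMonomial w i (j + 1) k := by
  rw [← t_smul_tMonomial htop, tMonomial, tMonomial, t_smul_pow_comm htop, pow_succ' _ j, mul_smul]

omit htop [Module ℂ M] [IsScalarTower ℂ Ut M] in
theorem tMonomial_succ_right (w : M) (i j k : ℕ) :
    tMonomial (cur (xNeg .θ) 1 • w) i j k = tMonomial w i j (k + 1) := by
  rw [tMonomial, tMonomial, pow_succ _ k, mul_smul]

omit htop in
theorem tMonomial_smul (c : ℂ) (w : M) (i j k : ℕ) :
    tMonomial (c • w) i j k = c • tMonomial w i j k := by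
  simp only [tMonomial]
  rw [smul_comm _ c, smul_comm _ c, smul_comm _ c]

omit htop [Module ℂ M] [IsScalarTower ℂ Ut M] in
theorem tMonomial_zero (i j k : ℕ) : tMonomial (0 : M) i j k = 0 := by
  simp only [tMonomial, smul_zero]

/-- An element `x` of `sl₃` acts on the monomials by a derivation. -/
theorem cur_zero_smul_tMonomial (x : G) (w : M) (i j k : ℕ) :
    cur x 0 • tMonomial w i j k = tMonomial (cur x 0 • w) i j k +
      ((i : ℂ) • tMonomial (cur ⁅x, xNeg .α₁⁆ 1 • w) (i - 1) j k +
       (j : ℂ) • tMonomial (cur ⁅x, xNeg .α₂⁆ 1 • w) i (j - 1) k +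
       (k : ℂ) • tMonomial (cur ⁅x, xNeg .θ⁆ 1 • w) i j (k - 1)) := by
  simp only [tMonomial, cur_zero_smul_t_pow htop x, smul_add, t_smul_pow_comm htop ⁅x, xNeg .α₁⁆,
    t_smul_pow_comm htop ⁅x, xNeg .α₂⁆]
  rw [smul_comm (_ ^ i) (j : ℂ), smul_comm (cur (xNeg .α₂) 1 ^ j) (k : ℂ),
      smul_comm (_ ^ i) (k : ℂ)]
  abel

end Top

end Takiff

/-! ### The action of `sl₃` on monomials and the essential monomials -/

theorem ad_xNeg_cube (α : PosRoot) (x : G) : ⁅xNeg α, ⁅xNeg α, ⁅xNeg α, x⁆⁆⁆ = 0 := by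
  have h : (xNeg α).val * (xNeg α).val = 0 :=
    Matrix.single_mul_single_of_ne _ _ _ _ α.row_ne_col _
  apply Subtype.ext
  change _ = (0 : Matrix (Fin 3) (Fin 3) ℂ)
  simp only [val_bracket]
  generalize (xNeg α).val = Y at h
  generalize x.val = X
  have h1 : ∀ Z, Y * (Y * Z) = 0 := fun Z => by rw [← mul_assoc, h, zero_mul]
  simp only [mul_sub, sub_mul, mul_assoc, h, h1, mul_zero, sub_zero, zero_sub, neg_zero, neg_mul,
      mul_neg]

theorem isSl2_cur (α : PosRoot) :
    IsSl2 (cur (xPos α) 0) (cur (xNeg α) 0) (cur (coroot α) 0) where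
  ef := cur_mul _ _ 0 0
  hf := by
    rw [cur_mul, lie_coroot_xNeg, cur_smul, neg_smul, sub_eq_add_neg]
  he := by rw [cur_mul, lie_coroot_xPos, cur_smul]

section Takiff

variable {M : Type*} [AddCommGroup M] [Module ℂ M] [Module Ut M] [IsScalarTower ℂ Ut M]

/-- The root vectors `x_α⁻` act locally nilpotently on a cyclic module as soon as they act
nilpotently on the generator. -/
theorem exists_xNeg_pow_smul_eq_zero {w : M} (hw : Submodule.span Ut {w} = ⊤) {α : PosRoot}
    (h : ∃ N, cur (xNeg α) 0 ^ N • w = 0) (m : M) : ∃ N, cur (xNeg α) 0 ^ N • m = 0 := by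
  refine exists_pow_smul_eq_zero_of_adjoin adjoin_cur (K := 3) ?_ hw h m
  rintro _ ⟨x, r, rfl⟩
  have had : ∀ x : G, cur (xNeg α) 0 * cur x r - cur x r * cur (xNeg α) 0 = cur ⁅xNeg α, x⁆ r :=
    fun x => by rw [cur_mul, zero_add, add_sub_cancel_left]
  simp only [Function.iterate_succ, Function.iterate_zero, Function.comp_apply, id_eq, had,
    ad_xNeg_cube, cur_zero]

namespace TakiffRel

variable {w : M} {ν : Weight} {p : PosRoot → ℕ}

omit [IsScalarTower ℂ Ut M] in
theorem xPos_t_smul (T : TakiffRel w ν p) (α i j k) :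
    cur (xPos α) 1 • tMonomial w i j k = 0 := by
  rw [t_smul_tMonomial T.two_le, T.xPos_smul, tMonomial_zero]

omit [IsScalarTower ℂ Ut M] in
theorem coroot_t_smul (T : TakiffRel w ν p) (α i j k) :
    cur (coroot α) 1 • tMonomial w i j k = 0 := by
  rw [t_smul_tMonomial T.two_le, T.coroot_smul, if_neg one_ne_zero, Nat.cast_zero, zero_smul,
    tMonomial_zero]

omit [IsScalarTower ℂ Ut M] in
theorem coroot_one_smul (T : TakiffRel w ν p) (α) : cur (coroot α) 1 • w = 0 := by
  rw [T.coroot_smul, if_neg one_ne_zero, Nat.cast_zero, zero_smul]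

theorem xPos₁_smul (T : TakiffRel w ν p) (i j k) :
    cur (xPos .α₁) 0 • tMonomial w i j k = (-k : ℂ) • tMonomial w i (j + 1) (k - 1) := by
  rw [cur_zero_smul_tMonomial T.two_le, T.xPos_smul, lie_xPos₁_xNeg₂, lie_xPos₁_xNegθ, cur_zero,
    zero_smul, tMonomial_zero, tMonomial_zero, cur_neg,
    show (⁅xPos .α₁, xNeg .α₁⁆ : G) = coroot .α₁ from rfl, T.coroot_one_smul, tMonomial_zero,
    ← neg_one_smul ℂ (cur (xNeg _) 1), smul_assoc, tMonomial_smul, tMonomial_succ_mid T.two_le]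
  simp

theorem xPos₂_smul (T : TakiffRel w ν p) (i j k) :
    cur (xPos .α₂) 0 • tMonomial w i j k = (k : ℂ) • tMonomial w (i + 1) j (k - 1) := by
  rw [cur_zero_smul_tMonomial T.two_le, T.xPos_smul, lie_xPos₂_xNeg₁, lie_xPos₂_xNegθ,
    cur_zero, zero_smul, tMonomial_zero, tMonomial_zero,
    show (⁅xPos .α₂, xNeg .α₂⁆ : G) = coroot .α₂ from rfl, T.coroot_one_smul, tMonomial_zero,
    tMonomial_succ_left T.two_le]
  simp

theorem coroot₁_smul (T : TakiffRel w ν p) (i j k : ℕ) :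
    cur (coroot .α₁) 0 • tMonomial w i j k =
      ((ν.1 - 2 * i + j - k : ℤ) : ℂ) • tMonomial w i j k := by
  have h1 := lie_coroot_xNeg
  have h2 := lie_coroot₁_xNeg₂
  have h3 := lie_coroot₁_xNegθ
  rw [cur_zero_smul_tMonomial T.two_le, T.coroot_smul, h1, h2, h3, cur_neg, cur_smul, smul_assoc,
    ← neg_one_smul ℂ (cur (xNeg _) 1), smul_assoc, tMonomial_smul, tMonomial_smul, tMonomial_smul,
    tMonomial_succ_left T.two_le, tMonomial_succ_mid T.two_le, tMonomial_succ_right, if_pos rfl]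
  have e1 : (i : ℂ) • (-2 : ℂ) • tMonomial w (i - 1 + 1) j k =
      (-2 * i : ℂ) • tMonomial w i j k := by
    rcases i with _ | i
    · simp
    · rw [Nat.add_sub_cancel, smul_smul, mul_comm]
  have e2 : (j : ℂ) • tMonomial w i (j - 1 + 1) k = (j : ℂ) • tMonomial w i j k := by
    rcases j with _ | j
    · simp
    · rw [Nat.add_sub_cancel]
  have e3 : (k : ℂ) • (-1 : ℂ) • tMonomial w i j (k - 1 + 1) = (-k : ℂ) • tMonomial w i j k := by
    rcases k with _ | k
    · simp
    · rw [Nat.add_sub_cancel, smul_smul]; simp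
  rw [e1, e2, e3]
  simp only [pairing]
  push_cast
  module

theorem coroot₂_smul (T : TakiffRel w ν p) (i j k : ℕ) :
    cur (coroot .α₂) 0 • tMonomial w i j k =
      ((ν.2 - 2 * j + i - k : ℤ) : ℂ) • tMonomial w i j k := by
  have h1 := lie_coroot_xNeg
  have h2 := lie_coroot₂_xNeg₁
  have h3 := lie_coroot₂_xNegθ
  rw [cur_zero_smul_tMonomial T.two_le, T.coroot_smul, h1, h2, h3, cur_neg, cur_smul, smul_assoc,
    ← neg_one_smul ℂ (cur (xNeg _) 1), smul_assoc, tMonomial_smul, tMonomial_smul, tMonomial_smul,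
    tMonomial_succ_left T.two_le, tMonomial_succ_mid T.two_le, tMonomial_succ_right, if_pos rfl]
  have e1 : (j : ℂ) • (-2 : ℂ) • tMonomial w i (j - 1 + 1) k =
      (-2 * j : ℂ) • tMonomial w i j k := by
    rcases j with _ | j
    · simp
    · rw [Nat.add_sub_cancel, smul_smul, mul_comm]
  have e2 : (i : ℂ) • tMonomial w (i - 1 + 1) j k = (i : ℂ) • tMonomial w i j k := by
    rcases i with _ | i
    · simp
    · rw [Nat.add_sub_cancel]
  have e3 : (k : ℂ) • (-1 : ℂ) • tMonomial w i j (k - 1 + 1) = (-k : ℂ) • tMonomial w i j k := by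
    rcases k with _ | k
    · simp
    · rw [Nat.add_sub_cancel, smul_smul]; simp
  rw [e1, e2, e3]
  simp only [pairing]
  push_cast
  module

/-- The monomials with fixed `i` and `j + k` form a string for the root `α₁`. -/
theorem xPos₁_pow_smul (T : TakiffRel w ν p) (i j k n : ℕ) : ∃ c : ℂ, c ≠ 0 ∧
    cur (xPos .α₁) 0 ^ n • tMonomial w i j (k + n) = c • tMonomial w i (j + n) k := by
  induction n generalizing j with
  | zero => exact ⟨1, one_ne_zero, by simp⟩
  | succ n ih =>
    obtain ⟨c, hc, h⟩ := ih (j + 1)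
    refine ⟨-((k + (n + 1) : ℕ) : ℂ) * c, mul_ne_zero (neg_ne_zero.2 (by norm_cast)) hc, ?_⟩
    rw [pow_succ, mul_smul, T.xPos₁_smul, smul_comm, show k + (n + 1) - 1 = k + n by omega, h,
      smul_smul, add_right_comm, add_assoc]

/-- The monomials with fixed `j` and `i + k` form a string for the root `α₂`. -/
theorem xPos₂_pow_smul (T : TakiffRel w ν p) (i j k n : ℕ) : ∃ c : ℂ, c ≠ 0 ∧
    cur (xPos .α₂) 0 ^ n • tMonomial w i j (k + n) = c • tMonomial w (i + n) j k := by
  induction n generalizing i with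
  | zero => exact ⟨1, one_ne_zero, by simp⟩
  | succ n ih =>
    obtain ⟨c, hc, h⟩ := ih (i + 1)
    refine ⟨((k + (n + 1) : ℕ) : ℂ) * c, mul_ne_zero (by norm_cast) hc, ?_⟩
    rw [pow_succ, mul_smul, T.xPos₂_smul, smul_comm, show k + (n + 1) - 1 = k + n by omega, h,
      smul_smul, add_right_comm, add_assoc]

/-- The monomials outside the region `i ≤ p α₁`, `j ≤ p α₂`, `i + j + k ≤ p θ` vanish. -/
theorem tMonomial_eq_zero (T : TakiffRel w ν p) {i j k : ℕ}
    (h : p .α₁ < i ∨ p .α₂ < j ∨ p .θ < i + j + k) : tMonomial w i j k = 0 := by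
  have hpow : ∀ α n, p α < n → cur (xNeg α) 1 ^ n • w = 0 := by
    intro α n hn
    obtain ⟨d, rfl⟩ := Nat.exists_eq_add_of_lt hn
    rw [show p α + d + 1 = d + (p α + 1) by ring, pow_add, mul_smul, T.xNeg_t_pow, smul_zero]
  have hcomm : ∀ (x : G) (a b c n : ℕ), cur x 1 ^ n • tMonomial w a b c =
      tMonomial (cur x 1 ^ n • w) a b c := by
    intro x a b c n
    induction n with
    | zero => simp
    | succ n ih => rw [pow_succ', mul_smul, ih, t_smul_tMonomial T.two_le, mul_smul]
  rcases h with h | h | h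
  · have := hcomm (xNeg .α₁) 0 j k i
    rw [hpow _ _ h, tMonomial_zero] at this
    rw [← this, tMonomial, tMonomial, pow_zero, one_smul]
  · have := hcomm (xNeg .α₂) 0 0 k j
    rw [hpow _ _ h, tMonomial_zero] at this
    rw [tMonomial, show cur (xNeg .α₂) 1 ^ j • cur (xNeg .θ) 1 ^ k • w = 0 by
      rw [← this, tMonomial, pow_zero, one_smul, pow_zero, one_smul], smul_zero]
  · obtain ⟨c, hc, h1⟩ := T.xPos₂_pow_smul 0 0 (j + k) i
    obtain ⟨c', hc', h2⟩ := T.xPos₁_pow_smul i 0 k j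
    have h0 : tMonomial w 0 0 (j + k + i) = 0 := by
      rw [tMonomial, hpow _ _ (by omega), smul_zero, smul_zero]
    rw [h0, smul_zero, zero_add] at h1
    have h1' := (smul_eq_zero.1 h1.symm).resolve_left hc
    rw [add_comm j k] at h1'
    rw [h1', smul_zero, zero_add] at h2
    exact (smul_eq_zero.1 h2.symm).resolve_left hc'

end TakiffRel

/-- The triples `(i, j, k)` of exponents of the monomials which need not vanish. -/
def region (p : PosRoot → ℕ) : Finset (ℕ × ℕ × ℕ) :=
  (Finset.range (p .α₁ + 1) ×ˢ Finset.range (p .α₂ + 1) ×ˢ Finset.range (p .θ + 1)).filter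
    fun q => q.1 + q.2.1 + q.2.2 ≤ p .θ

/-- The triples of exponents `(i, j, k)` in the region with `2 i + k ≤ ν(h_{α₁})` and
`2 j + k ≤ ν(h_{α₂})`. As the monomial has weight
`(ν(h_{α₁}) - 2 i - k + j, ν(h_{α₂}) - 2 j - k + i)`, this says that its weight is at least `j` on
`h_{α₁}` and at least `i` on `h_{α₂}`. -/
def essential (ν : Weight) (p : PosRoot → ℕ) : Finset (ℕ × ℕ × ℕ) :=
  (region p).filter fun q => 2 * q.1 + q.2.2 ≤ ν.1 ∧ 2 * q.2.1 + q.2.2 ≤ ν.2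

theorem mem_region {p : PosRoot → ℕ} {i j k : ℕ} :
    (i, j, k) ∈ region p ↔ i ≤ p .α₁ ∧ j ≤ p .α₂ ∧ i + j + k ≤ p .θ := by
  simp only [region, Finset.mem_filter, Finset.mem_product, Finset.mem_range]
  omega

theorem mem_essential {ν : Weight} {p : PosRoot → ℕ} {i j k : ℕ} :
    (i, j, k) ∈ essential ν p ↔ (i ≤ p .α₁ ∧ j ≤ p .α₂ ∧ i + j + k ≤ p .θ) ∧
      2 * i + k ≤ ν.1 ∧ 2 * j + k ≤ ν.2 := by
  rw [essential, Finset.mem_filter, mem_region]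

/-- The numerical condition on `p` satisfied by the smaller parts of partitions of `ν(h_α)` into
two parts. -/
def IsHalf (ν : Weight) (p : PosRoot → ℕ) : Prop := ∀ α, 2 * p α ≤ pairing ν α

/-- Every monomial lies in the submodule generated by the essential monomials of the same degree
with at least the same exponents of `x_{α₁}⁻ ⊗ t` and `x_{α₂}⁻ ⊗ t`. If `2 i + k > ν(h_{α₁})`, then
the `α₁`-string of the monomial starts with the monomial of exponents `(i, 0, j + k)`, of negative
weight `c` on `h_{α₁}`. In an integrable module this start lies in any submodule containing its
image under `(x_{α₁}⁺)^{-c}`, and that image is a multiple of a monomial which is essential or zero.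
-/
theorem TakiffRel.tMonomial_mem {w : M} {ν : Weight} {p : PosRoot → ℕ} (T : TakiffRel w ν p)
    (hw : Submodule.span Ut {w} = ⊤) (hp : IsHalf ν p) (N : Submodule Ut M) {i j k : ℕ}
    (hN : ∀ i' j' k', (i', j', k') ∈ essential ν p → i ≤ i' → j ≤ j' → i' + j' + k' = i + j + k →
      tMonomial w i' j' k' ∈ N) : tMonomial w i j k ∈ N := by
  by_cases hreg : p .α₁ < i ∨ p .α₂ < j ∨ p .θ < i + j + k
  · rw [T.tMonomial_eq_zero hreg]
    exact N.zero_mem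
  have h1 : 2 * p .α₁ ≤ ν.1 := hp .α₁
  have h2 : 2 * p .α₂ ≤ ν.2 := hp .α₂
  have h3 : 2 * p .θ ≤ ν.1 + ν.2 := hp .θ
  have hloc : ∀ s, ∀ m : M, ∃ N, cur (xNeg (simpleRoot s)) 0 ^ N • m = 0 := fun s =>
    exists_xNeg_pow_smul_eq_zero hw ⟨_, T.xNeg_pow s⟩
  have hstab : ∀ y : Ut, ∀ m ∈ N.restrictScalars ℂ, y • m ∈ N.restrictScalars ℂ :=
    fun y m hm => N.smul_mem y hm
  have hsmul : ∀ (c : ℂ) m, m ∈ N → c • m ∈ N := fun c m hm =>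
    (N.restrictScalars ℂ).smul_mem c hm
  by_cases hi : ν.1 < 2 * i + k
  · have hy : tMonomial w i 0 (j + k) ∈ N.restrictScalars ℂ := by
      refine (isSl2_cur .α₁).mem_of_pow_smul_mem (hstab _) (hstab _) (hloc 0)
        (n := 2 * i + j + k - ν.1) (c := ν.1 - 2 * i + (0 : ℕ) - (j + k : ℕ))
        (by push_cast; omega) (T.coroot₁_smul _ _ _) ?_
      obtain ⟨c, hc, h⟩ := T.xPos₁_pow_smul i 0 (ν.1 - 2 * i) (2 * i + j + k - ν.1)
      rw [show j + k = ν.1 - 2 * i + (2 * i + j + k - ν.1) by omega, h]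
      refine hsmul _ _ ?_
      by_cases hreg' : p .α₂ < 0 + (2 * i + j + k - ν.1)
      · rw [T.tMonomial_eq_zero (Or.inr (Or.inl hreg'))]
        exact N.zero_mem
      · exact hN _ _ _ (mem_essential.2 (by omega)) le_rfl (by omega) (by omega)
    obtain ⟨c, hc, h⟩ := T.xPos₁_pow_smul i 0 k j
    rw [zero_add, add_comm k] at h
    have := hsmul c⁻¹ _ (h ▸ hstab _ _ hy)
    rwa [smul_smul, inv_mul_cancel₀ hc, one_smul] at this
  by_cases hj : ν.2 < 2 * j + k
  · have hy : tMonomial w 0 j (i + k) ∈ N.restrictScalars ℂ := by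
      refine (isSl2_cur .α₂).mem_of_pow_smul_mem (hstab _) (hstab _) (hloc 1)
        (n := 2 * j + i + k - ν.2) (c := ν.2 - 2 * j + (0 : ℕ) - (i + k : ℕ))
        (by push_cast; omega) (T.coroot₂_smul _ _ _) ?_
      obtain ⟨c, hc, h⟩ := T.xPos₂_pow_smul 0 j (ν.2 - 2 * j) (2 * j + i + k - ν.2)
      rw [show i + k = ν.2 - 2 * j + (2 * j + i + k - ν.2) by omega, h]
      refine hsmul _ _ ?_
      by_cases hreg' : p .α₁ < 0 + (2 * j + i + k - ν.2)
      · rw [T.tMonomial_eq_zero (Or.inl hreg')]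
        exact N.zero_mem
      · exact hN _ _ _ (mem_essential.2 (by omega)) (by omega) le_rfl (by omega)
    obtain ⟨c, hc, h⟩ := T.xPos₂_pow_smul 0 j k i
    rw [zero_add, add_comm k] at h
    have := hsmul c⁻¹ _ (h ▸ hstab _ _ hy)
    rwa [smul_smul, inv_mul_cancel₀ hc, one_smul] at this
  exact hN i j k (mem_essential.2 (by omega)) le_rfl le_rfl rfl

end Takiff

/-! ### The modules `F_{λ,μ}` by generator and relations over the truncated current algebra -/

/-- The tail sums `∑_{j > k} ξ_j` of a partition into at most two parts `x` and `y`. -/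
theorem tailSum_ofSums_pair {n x y : ℕ} (h : ({x, y} : Multiset ℕ).sum = n) :
    tailSum (Nat.Partition.ofSums n {x, y} h) 1 = min x y ∧
      ∀ k, 2 ≤ k → tailSum (Nat.Partition.ofSums n {x, y} h) k = 0 := by
  have key : ∀ x y : ℕ, y ≤ x →
      (((({x, y} : Multiset ℕ).filter (· ≠ 0)).sort (· ≥ ·)).drop 1).sum = y ∧
      ∀ k, 2 ≤ k → (((({x, y} : Multiset ℕ).filter (· ≠ 0)).sort (· ≥ ·)).drop k).sum = 0 := by
    intro x y hxy
    rw [Multiset.insert_eq_cons]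
    rcases Nat.eq_zero_or_pos y with rfl | hy
    · rcases Nat.eq_zero_or_pos x with rfl | hx
      · have h0 : ((0 ::ₘ {0} : Multiset ℕ).filter (· ≠ 0)) = 0 := by simp
        simp only [h0]
        simp
      · have h0 : ((x ::ₘ {0} : Multiset ℕ).filter (· ≠ 0)) = {x} := by
          simp [Multiset.filter_singleton, hx.ne']
        simp only [h0, Multiset.sort_singleton]
        refine ⟨by simp, fun k hk => ?_⟩
        rw [List.drop_eq_nil_of_le (by simp; omega)]
        rfl
    · have h0 : ((x ::ₘ {y} : Multiset ℕ).filter (· ≠ 0)) = x ::ₘ {y} := by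
        refine Multiset.filter_eq_self.2 fun a ha => ?_
        simp at ha
        omega
      have h1 : (x ::ₘ {y} : Multiset ℕ).sort (· ≥ ·) = [x, y] := by
        rw [Multiset.sort_cons (r := (· ≥ ·)) _ _ (by simpa using hxy), Multiset.sort_singleton]
      simp only [h0, h1]
      refine ⟨by simp, fun k hk => ?_⟩
      rw [List.drop_eq_nil_of_le (by simpa using hk)]
      rfl
  rcases le_total y x with hxy | hxy
  · rw [min_eq_right hxy]
    exact key x y hxy
  · rw [min_eq_left hxy]
    simp only [Multiset.pair_comm x y]
    exact key y x hxy

/-- The smaller of the two parts of each partition attached to a pair of weights. -/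
def minPart (l m : Weight) (α : PosRoot) : ℕ := min (pairing l α) (pairing m α)

theorem isHalf_minPart (l m : Weight) : IsHalf (l + m) (minPart l m) := fun α => by
  rw [pairing_add, minPart]; omega

theorem smul_cvGen_eq_zero {l : Weight} {ξ : Compatible l} {y : Ut} (hy : y ∈ cvRel l ξ) :
    y • cvGen l ξ = 0 := by
  rw [cvGen, ← Submodule.Quotient.mk_smul, smul_eq_mul, mul_one]
  exact (Submodule.Quotient.mk_eq_zero _).2 hy

theorem smul_cvGen_eq_zero_of_weylRel {l : Weight} {ξ : Compatible l} {y : Ut}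
    (hy : y ∈ weylRelSet l) : y • cvGen l ξ = 0 :=
  smul_cvGen_eq_zero (Submodule.subset_span (Or.inl hy))

theorem divPow_mul_divPow_smul_eq_zero_iff {M : Type*} [AddCommGroup M] [Module ℂ M] [Module Ut M]
    [IsScalarTower ℂ Ut M] (x y : Ut) (s n : ℕ) (w : M) :
    (divPow x s * divPow y n) • w = 0 ↔ x ^ s • y ^ n • w = 0 := by
  have h : ∀ k : ℕ, ((k.factorial : ℂ)⁻¹) ≠ 0 := fun k =>
    inv_ne_zero (Nat.cast_ne_zero.2 k.factorial_ne_zero)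
  rw [divPow, divPow, smul_mul_smul_comm, smul_assoc, mul_smul (x ^ s),
    smul_eq_zero_iff_right (mul_ne_zero (h _) (h _))]

theorem coroot_smul_cvGen {l : Weight} {ξ : Compatible l} (α : PosRoot) (s : ℕ) :
    cur (coroot α) s • cvGen l ξ =
      ((if s = 0 then pairing l α else 0 : ℕ) : ℂ) • cvGen l ξ := by
  have key : ∀ i, cur (coroot (simpleRoot i)) s • cvGen l ξ =
      ((if s = 0 then pairing l (simpleRoot i) else 0 : ℕ) : ℂ) • cvGen l ξ := by
    intro i
    have := smul_cvGen_eq_zero_of_weylRel (l := l) (ξ := ξ) (Or.inl (Or.inr ⟨i, s, rfl⟩))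
    rw [sub_smul, algebraMap_smul, sub_eq_zero] at this
    rw [this]
    split_ifs <;> simp
  cases α with
  | α₁ => exact key 0
  | α₂ => exact key 1
  | θ =>
    have h0 := key 0
    have h1 := key 1
    simp only [simpleRoot, Matrix.cons_val_zero, Matrix.cons_val_one] at h0 h1
    rw [coroot_θ, cur_add, add_smul, h0, h1, ← add_smul]
    split_ifs <;> simp [pairing]

/-- The generator of `F_{λ,μ}` satisfies the simplified relations. The Garland identities turn the
relation with `r = 1`, `s = k = 2` into the vanishing of `x_α⁻ ⊗ t²`, and the relations with `k = 1`
and `r = s` into that of a power of `x_α⁻ ⊗ t`. -/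
theorem takiffRel_fGen (l m : Weight) : TakiffRel (fGen l m) (l + m) (minPart l m) := by
  have hx : ∀ α s, cur (xPos α) s • fGen l m = 0 := fun α s =>
    smul_cvGen_eq_zero_of_weylRel (Or.inl (Or.inl ⟨α, s, rfl⟩))
  have hcv : ∀ (α : PosRoot) (r s k : ℕ), 1 ≤ r → 1 ≤ s → 1 ≤ k →
      1 + r * k + tailSum (pairPartition l m α) k ≤ s + r →
      cur (xPos α) 1 ^ s • cur (xNeg α) 0 ^ (r + s) • fGen l m = 0 := fun α r s k hr hs hk h => by
    rw [← divPow_mul_divPow_smul_eq_zero_iff]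
    exact smul_cvGen_eq_zero (Submodule.subset_span (Or.inr ⟨α, r, s, k, hr, hs, hk, h, rfl⟩))
  have hh1 : ∀ α s, cur (coroot α) (s + 1) • fGen l m = 0 := fun α s => by
    rw [coroot_smul_cvGen, if_neg s.succ_ne_zero, Nat.cast_zero, zero_smul]
  -- The relation with `r = 1`, `s = k = 2` says that `x_α⁻ ⊗ t²` kills the generator.
  have hy2 : ∀ α, cur (xNeg α) 2 • fGen l m = 0 := by
    intro α
    have h0 := hcv α 1 2 2 le_rfl one_le_two one_le_two
      (by rw [pairPartition, (tailSum_ofSums_pair _).2 2 le_rfl])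
    rw [xPos_t_smul_pow_three (hx α) (hh1 α)] at h0
    exact (smul_eq_zero.1 h0).resolve_left (by norm_num)
  have htop : ∀ x r, 2 ≤ r → ∀ m' : F l m, cur x r • m' = 0 := by
    refine fun x r hr => cur_smul_eq_zero span_cvGen (R := 2) (fun x r hr => ?_) x r hr
    obtain ⟨d, rfl⟩ := Nat.exists_eq_add_of_le' hr
    refine cur_smul_eq_zero_of_basis (fun α => hx α _) (fun α => ?_) (fun i => hh1 _ (d + 1)) x
    rcases d with _ | d
    · exact hy2 α
    · have h1 := cur_smul_cur_smul_xNeg α (d + 1) 2 (fGen l m)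
      rw [hy2, smul_zero, hh1, smul_zero, zero_sub, eq_comm, neg_eq_zero] at h1
      exact (smul_eq_zero.1 h1).resolve_left two_ne_zero
  refine ⟨hx, coroot_smul_cvGen, fun i => ?_, htop, fun α => ?_⟩
  · exact smul_cvGen_eq_zero_of_weylRel (Or.inr ⟨i, rfl⟩)
  · have h0 := hcv α (minPart l m α + 1) (minPart l m α + 1) 1 (by omega) (by omega) le_rfl
      (by rw [pairPartition, (tailSum_ofSums_pair _).1, minPart]; omega)
    rw [xPos_t_pow_smul_pow htop (hx α 1) (hh1 α 0), ← two_mul, Nat.sub_self, pow_zero, one_smul,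
      Nat.descFactorial_self] at h0
    refine (smul_eq_zero.1 h0).resolve_left (mul_ne_zero (pow_ne_zero _ (by norm_num)) ?_)
    exact Nat.cast_ne_zero.2 (Nat.factorial_ne_zero _)

section Lift

variable {M : Type*} [AddCommGroup M] [Module ℂ M] [Module Ut M] [IsScalarTower ℂ Ut M] {w : M}

/-- The simplified relations imply all the defining relations of `F_{λ,μ}`. -/
theorem TakiffRel.cvRel_le {l m : Weight} {p : PosRoot → ℕ} (T : TakiffRel w (l + m) p)
    (hp : ∀ α, p α ≤ minPart l m α) :
    cvRel (l + m) (pairPartition l m) ≤ LinearMap.ker (LinearMap.toSpanSingleton Ut M w) := by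
  refine Submodule.span_le.2 ?_
  rintro y (((⟨α, s, rfl⟩ | ⟨i, s, rfl⟩) | ⟨i, rfl⟩) | ⟨α, r, s, k, hr, hs, hk, h, rfl⟩) <;>
    rw [SetLike.mem_coe, LinearMap.mem_ker, LinearMap.toSpanSingleton_apply]
  · exact T.xPos_smul α s
  · rw [sub_smul, algebraMap_smul, T.coroot_smul, sub_eq_zero]
    split_ifs <;> simp
  · exact T.xNeg_pow i
  · rw [divPow_mul_divPow_smul_eq_zero_iff,
      xPos_t_pow_smul_pow T.two_le (T.xPos_smul α 1) (T.coroot_one_smul α)]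
    by_cases hk2 : 2 ≤ k
    · have : r * 2 ≤ r * k := Nat.mul_le_mul_left r hk2
      rw [Nat.descFactorial_of_lt (by omega), Nat.cast_zero, mul_zero, zero_smul]
    · obtain rfl : k = 1 := by omega
      rw [pairPartition, (tailSum_ofSums_pair _).1] at h
      have hps := hp α
      rw [minPart] at hps
      obtain ⟨d, rfl⟩ : ∃ d, s = d + (p α + 1) := ⟨s - (p α + 1), by omega⟩
      have hcomm : Commute (cur (xNeg α) 1) (cur (xNeg α) 0) := by
        rw [Commute, SemiconjBy, cur_mul, lie_self, cur_zero, add_zero]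
      rw [← mul_smul (_ ^ _) (_ ^ _) w, (hcomm.pow_pow _ _).eq, pow_add (cur (xNeg α) 1),
        mul_smul _ _ w, mul_smul _ _ w, T.xNeg_t_pow, smul_zero, smul_zero, smul_zero]

/-- The universal property of `F_{λ,μ}` with respect to the simplified relations. -/
theorem TakiffRel.exists_lift {l m : Weight} {p : PosRoot → ℕ} (T : TakiffRel w (l + m) p)
    (hp : ∀ α, p α ≤ minPart l m α) : ∃ g : F l m →ₗ[Ut] M, g (fGen l m) = w := by
  refine ⟨(cvRel (l + m) (pairPartition l m)).liftQ (LinearMap.toSpanSingleton Ut M w)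
    (T.cvRel_le hp), ?_⟩
  rw [fGen, cvGen, Submodule.liftQ_apply, LinearMap.toSpanSingleton_apply, one_smul]

omit [Module ℂ M] [IsScalarTower ℂ Ut M] in
theorem surjective_of_map_gen {M' : Type*} [AddCommGroup M'] [Module Ut M'] {w' : M'}
    (hw : Submodule.span Ut {w'} = ⊤) (g : M →ₗ[Ut] M') (hg : g w = w') :
    Function.Surjective g := by
  rw [← LinearMap.range_eq_top, eq_top_iff, ← hw, Submodule.span_le, Set.singleton_subset_iff]
  exact ⟨w, hg⟩

end Lift

/-! ### Sums of Weyl dimensions -/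

/-- Twice the value of the Weyl dimension formula at the weight `x ω₁ + y ω₂`. -/
def weylDim (x y : ℤ) : ℤ := (x + 1) * (y + 1) * (x + y + 2)

/-- The value of `weylDim` at the weight of the monomial with exponents `q`. -/
def weylDimAt (ν : Weight) (q : ℕ × ℕ × ℕ) : ℤ :=
  weylDim (ν.1 - 2 * q.1 - q.2.2 + q.2.1) (ν.2 - 2 * q.2.1 - q.2.2 + q.1)

/-- The sum telescopes, as `P k * (A + B - 2 * k) = (P k * P (k - 1) - P (k + 1) * P k) / 2` for
`P k = (A - k) * (B - k)`. -/
theorem sum_weylDim_diagonal (A B : ℚ) (n : ℕ) :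
    2 * ∑ k ∈ Finset.range n, (A - k) * (B - k) * (A + B - 2 * k) =
      A * (A + 1) * (B * (B + 1)) - (A - n) * (A - n + 1) * ((B - n) * (B - n + 1)) := by
  induction n with
  | zero => simp
  | succ n ih =>
    rw [Finset.sum_range_succ, mul_add, ih]
    push_cast
    ring

/-- The closed form of `∑_{j < J} (X + j)(X + j + 1)(Y - 2j)(Y - 2j + 1)`. -/
def rowSum (X Y J : ℚ) : ℚ :=
  (24 * J ^ 5 + 60 * J ^ 4 * X - 30 * J ^ 4 * Y - 45 * J ^ 4 + 40 * J ^ 3 * X ^ 2 - 80 * J ^ 3 *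
    X * Y - 120 * J ^ 3 * X + 10 * J ^ 3 * Y ^ 2 + 30 * J ^ 3 * Y - 10 * J ^ 3 - 60 * J ^ 2 * X ^
    2 * Y - 90 * J ^ 2 * X ^ 2 + 30 * J ^ 2 * X * Y ^ 2 + 90 * J ^ 2 * X * Y + 30 * J ^ 2 * X +
    30 * J ^ 2 * Y + 45 * J ^ 2 + 30 * J * X ^ 2 * Y ^ 2 + 90 * J * X ^ 2 * Y + 50 * J * X ^ 2 +
    20 * J * X * Y + 30 * J * X - 10 * J * Y ^ 2 - 30 * J * Y - 14 * J) / 30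

theorem sum_row (X Y : ℚ) (n : ℕ) :
    ∑ j ∈ Finset.range n, (X + j) * (X + j + 1) * ((Y - 2 * j) * (Y - 2 * j + 1)) =
      rowSum X Y n := by
  induction n with
  | zero => simp [rowSum]
  | succ n ih =>
    rw [Finset.sum_range_succ, ih]
    simp only [rowSum]
    push_cast
    ring

/-- The closed form of the sum of `rowSum (X - 2i) (Y + i) J` over `i < I`. -/
def rectSum (X Y I J : ℚ) : ℚ :=
  (24 * I ^ 5 * J - 75 * I ^ 4 * J ^ 2 - 30 * I ^ 4 * J * X + 60 * I ^ 4 * J * Y + 30 * I ^ 4 *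
    J + 110 * I ^ 3 * J ^ 3 + 90 * I ^ 3 * J ^ 2 * X - 120 * I ^ 3 * J ^ 2 * Y - 30 * I ^ 3 * J ^
    2 + 10 * I ^ 3 * J * X ^ 2 - 80 * I ^ 3 * J * X * Y - 60 * I ^ 3 * J * X + 40 * I ^ 3 * J * Y
    ^ 2 - 90 * I ^ 3 * J - 75 * I ^ 2 * J ^ 4 - 120 * I ^ 2 * J ^ 3 * X + 90 * I ^ 2 * J ^ 3 * Y
    - 30 * I ^ 2 * J ^ 3 - 30 * I ^ 2 * J ^ 2 * X ^ 2 + 150 * I ^ 2 * J ^ 2 * X * Y + 90 * I ^ 2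
    * J ^ 2 * X - 30 * I ^ 2 * J ^ 2 * Y ^ 2 + 90 * I ^ 2 * J ^ 2 * Y + 180 * I ^ 2 * J ^ 2 + 30
    * I ^ 2 * J * X ^ 2 * Y + 30 * I ^ 2 * J * X ^ 2 - 60 * I ^ 2 * J * X * Y ^ 2 - 60 * I ^ 2 *
    J * X * Y + 60 * I ^ 2 * J * X - 60 * I ^ 2 * J * Y ^ 2 - 150 * I ^ 2 * J * Y - 30 * I ^ 2 *
    J + 24 * I * J ^ 5 + 60 * I * J ^ 4 * X - 30 * I * J ^ 4 * Y + 30 * I * J ^ 4 + 40 * I * J ^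
    3 * X ^ 2 - 80 * I * J ^ 3 * X * Y + 10 * I * J ^ 3 * Y ^ 2 - 60 * I * J ^ 3 * Y - 90 * I * J
    ^ 3 - 60 * I * J ^ 2 * X ^ 2 * Y - 60 * I * J ^ 2 * X ^ 2 + 30 * I * J ^ 2 * X * Y ^ 2 - 60 *
    I * J ^ 2 * X * Y - 150 * I * J ^ 2 * X + 30 * I * J ^ 2 * Y ^ 2 + 60 * I * J ^ 2 * Y - 30 *
    I * J ^ 2 + 30 * I * J * X ^ 2 * Y ^ 2 + 60 * I * J * X ^ 2 * Y + 10 * I * J * X ^ 2 + 60 * I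
    * J * X * Y ^ 2 + 160 * I * J * X * Y + 60 * I * J * X + 10 * I * J * Y ^ 2 + 60 * I * J * Y
    + 52 * I * J) / 30

theorem sum_rect (X Y J : ℚ) (n : ℕ) :
    ∑ i ∈ Finset.range n, rowSum (X - 2 * i) (Y + i) J = rectSum X Y n J := by
  induction n with
  | zero => simp [rectSum]
  | succ n ih =>
    rw [Finset.sum_range_succ, ih]
    simp only [rowSum, rectSum]
    push_cast
    ring

theorem sum_region {R : Type*} [AddCommMonoid R] (p : PosRoot → ℕ) (f : ℕ × ℕ × ℕ → R) :
    ∑ q ∈ region p, f q = ∑ i ∈ Finset.range (p .α₁ + 1), ∑ j ∈ Finset.range (p .α₂ + 1),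
      ∑ k ∈ Finset.range (p .θ + 1 - i - j), f (i, j, k) := by
  rw [region, Finset.sum_filter, Finset.sum_product]
  refine Finset.sum_congr rfl fun i _ => ?_
  rw [Finset.sum_product]
  refine Finset.sum_congr rfl fun j _ => ?_
  rw [← Finset.sum_filter]
  refine Finset.sum_congr ?_ fun _ _ => rfl
  ext k
  simp only [Finset.mem_filter, Finset.mem_range]
  omega

/-- The sum over the third exponent `k` telescopes. Its two end terms are products of the form
summed by `rowSum` and `rectSum`. -/
theorem sum_region_weylDimAt (ν : Weight) (p : PosRoot → ℕ) (hp : p .α₁ + p .α₂ ≤ p .θ) :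
    ((2 * ∑ q ∈ region p, weylDimAt ν q : ℤ) : ℚ) =
      rectSum (ν.1 + 1) (ν.2 + 1) (p .α₁ + 1) (p .α₂ + 1) -
        rectSum (p .θ - ν.2 - 1) (p .θ - ν.1 - 1) (p .α₁ + 1) (p .α₂ + 1) := by
  have h1 := sum_rect (ν.1 + 1) (ν.2 + 1) (p .α₂ + 1 : ℕ) (p .α₁ + 1)
  have h2 := sum_rect (p .θ - ν.2 - 1) (p .θ - ν.1 - 1) (p .α₂ + 1 : ℕ) (p .α₁ + 1)
  push_cast at h1 h2
  rw [← h1, ← h2, ← Finset.sum_sub_distrib, sum_region]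
  push_cast
  rw [Finset.mul_sum]
  refine Finset.sum_congr rfl fun i hi => ?_
  have h3 := sum_row (ν.1 + 1 - 2 * i) (ν.2 + 1 + i) (p .α₂ + 1)
  have h4 := sum_row (p .θ - ν.2 - 1 - 2 * i) (p .θ - ν.1 - 1 + i) (p .α₂ + 1)
  push_cast at h3 h4
  rw [← h3, ← h4, ← Finset.sum_sub_distrib, Finset.mul_sum]
  refine Finset.sum_congr rfl fun j hj => ?_
  have h5 := sum_weylDim_diagonal (ν.1 + 1 - 2 * i + j) (ν.2 + 1 - 2 * j + i) (p .θ + 1 - i - j)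
  rw [Finset.mem_range] at hi hj
  have h6 : ((p .θ + 1 - i - j : ℕ) : ℚ) = p .θ + 1 - i - j := by
    rw [Nat.sub_sub, Nat.cast_sub (by omega)]
    push_cast
    ring
  rw [h6] at h5
  have h7 : ∑ k ∈ Finset.range (p .θ + 1 - i - j), ((weylDimAt ν (i, j, k) : ℤ) : ℚ) =
      ∑ k ∈ Finset.range (p .θ + 1 - i - j), (ν.1 + 1 - 2 * i + j - k : ℚ) *
        (ν.2 + 1 - 2 * j + i - k) * (ν.1 + 1 - 2 * i + j + (ν.2 + 1 - 2 * j + i) - 2 * k) := by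
    refine Finset.sum_congr rfl fun k _ => ?_
    simp only [weylDimAt, weylDim]
    push_cast
    ring
  rw [h7, h5]
  ring

/-- The contributions of the non-essential monomials cancel in pairs under the reflections of the
`α₁`- and `α₂`-strings, as `weylDim` is odd under the dotted action of a simple reflection. -/
theorem sum_essential_weylDimAt {ν : Weight} {p : PosRoot → ℕ} (hp : IsHalf ν p)
    (h1 : p .α₁ + p .θ ≤ ν.1 + p .α₂ + 1) (h2 : p .α₂ + p .θ ≤ ν.2 + p .α₁ + 1) :
    ∑ q ∈ essential ν p, weylDimAt ν q = ∑ q ∈ region p, weylDimAt ν q := by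
  have h3 : 2 * p .α₁ ≤ ν.1 := hp .α₁
  have h4 : 2 * p .α₂ ≤ ν.2 := hp .α₂
  have h5 : 2 * p .θ ≤ ν.1 + ν.2 := hp .θ
  rw [essential, ← Finset.sum_filter_add_sum_filter_not (region p)
    (fun q => 2 * q.1 + q.2.2 ≤ ν.1 ∧ 2 * q.2.1 + q.2.2 ≤ ν.2)]
  rw [left_eq_add]
  refine Finset.sum_involution (fun q _ => if ν.1 < 2 * q.1 + q.2.2 then
      (q.1, 2 * q.1 + q.2.2 - ν.1 - 1, ν.1 + 1 + q.2.1 - 2 * q.1) else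
      (2 * q.2.1 + q.2.2 - ν.2 - 1, q.2.1, ν.2 + 1 + q.1 - 2 * q.2.1)) ?_ ?_ ?_ ?_
  · rintro ⟨i, j, k⟩ h
    rw [Finset.mem_filter, mem_region] at h
    dsimp only at h ⊢
    simp only [weylDimAt, weylDim]
    split_ifs with hc
    · have e1 : ((2 * i + k - ν.1 - 1 : ℕ) : ℤ) = 2 * i + k - ν.1 - 1 := by omega
      have e2 : ((ν.1 + 1 + j - 2 * i : ℕ) : ℤ) = ν.1 + 1 + j - 2 * i := by omega
      rw [e1, e2]
      ring
    · have e1 : ((2 * j + k - ν.2 - 1 : ℕ) : ℤ) = 2 * j + k - ν.2 - 1 := by omega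
      have e2 : ((ν.2 + 1 + i - 2 * j : ℕ) : ℤ) = ν.2 + 1 + i - 2 * j := by omega
      rw [e1, e2]
      ring
  · rintro ⟨i, j, k⟩ h hne heq
    rw [Finset.mem_filter, mem_region] at h
    dsimp only at h heq
    refine hne ?_
    simp only [weylDimAt, weylDim]
    split_ifs at heq with hc
    · rw [Prod.mk.injEq, Prod.mk.injEq] at heq
      rw [show (ν.1 : ℤ) - 2 * i - k + j + 1 = 0 by omega, zero_mul, zero_mul]
    · rw [Prod.mk.injEq, Prod.mk.injEq] at heq
      rw [show (ν.2 : ℤ) - 2 * j - k + i + 1 = 0 by omega, mul_zero, zero_mul]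
  · rintro ⟨i, j, k⟩ h
    rw [Finset.mem_filter, mem_region] at h
    dsimp only at h ⊢
    split_ifs with hc
    · rw [Finset.mem_filter, mem_region]
      dsimp only
      omega
    · rw [Finset.mem_filter, mem_region]
      dsimp only
      omega
  · rintro ⟨i, j, k⟩ h
    rw [Finset.mem_filter, mem_region] at h
    dsimp only at h ⊢
    by_cases hc : ν.1 < 2 * i + k
    · simp only [if_pos hc]
      rw [if_pos (by omega), Prod.mk.injEq, Prod.mk.injEq]
      omega
    · simp only [if_neg hc]
      rw [if_neg (by omega), Prod.mk.injEq, Prod.mk.injEq]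
      omega

/-- The numerical form of the decomposition of `V(λ) ⊗ V(μ)` into the irreducible modules with the
weights of the essential monomials. -/
theorem sum_essential_minPart (l m : Weight) (hsize : m.1 + m.2 ≤ l.1 + l.2) (hfst : m.1 ≤ l.1) :
    2 * ∑ q ∈ essential (l + m) (minPart l m), weylDimAt (l + m) q =
      weylDim l.1 l.2 * weylDim m.1 m.2 := by
  obtain ⟨a, b⟩ := l
  obtain ⟨c, d⟩ := m
  dsimp only at hsize hfst
  have e1 : minPart (a, b) (c, d) .α₁ = c := min_eq_right hfst
  have e2 : minPart (a, b) (c, d) .α₂ = min b d := rfl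
  have e3 : minPart (a, b) (c, d) .θ = c + d := min_eq_right hsize
  rw [sum_essential_weylDimAt (isHalf_minPart _ _)
    (by rw [e1, e2, e3]; change _ ≤ a + c + _ + 1; omega)
    (by rw [e1, e2, e3]; change _ ≤ b + d + _ + 1; omega)]
  have h := sum_region_weylDimAt ((a, b) + (c, d)) (minPart (a, b) (c, d))
    (by rw [e1, e2, e3]; omega)
  have key : ((2 * ∑ q ∈ region (minPart (a, b) (c, d)), weylDimAt ((a, b) + (c, d)) q : ℤ) : ℚ) =
      ((weylDim a b * weylDim c d : ℤ) : ℚ) := by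
    rw [h, e1, e2, e3]
    simp only [Prod.mk_add_mk, weylDim]
    rcases le_total b d with hbd | hbd
    · rw [min_eq_left hbd]
      simp only [rectSum]
      push_cast
      ring
    · rw [min_eq_right hbd]
      simp only [rectSum]
      push_cast
      ring
  exact_mod_cast key

/-! ### The irreducible modules -/

section Irreducible

/-- The element `x` of the enveloping algebra of `sl₃`. -/
abbrev ug (x : G) : U := UniversalEnvelopingAlgebra.ι ℂ x

theorem ug_mul (x y : G) : ug x * ug y = ug y * ug x + ug ⁅x, y⁆ := by
  rw [ug, ug, ug, LieHom.map_lie, LieRing.of_associative_ring_bracket]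
  abel

theorem isSl2_ug (α : PosRoot) : IsSl2 (ug (xPos α)) (ug (xNeg α)) (ug (coroot α)) where
  ef := ug_mul _ _
  hf := by
    rw [ug_mul, lie_coroot_xNeg, ug, ug, ug, map_smul, neg_smul, sub_eq_add_neg]
  he := by rw [ug_mul, lie_coroot_xPos, ug, ug, ug, map_smul]

variable {l : Weight}

theorem smul_hwv_eq_zero {y : U} (hy : y ∈ irrRel l) : y • hwv l = 0 := by
  rw [hwv, ← Submodule.Quotient.mk_smul, smul_eq_mul, mul_one]
  exact (Submodule.Quotient.mk_eq_zero _).2 hy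

theorem xPos_smul_hwv (α : PosRoot) : ug (xPos α) • hwv l = 0 :=
  smul_hwv_eq_zero (Submodule.subset_span (Or.inl (Or.inl ⟨α, rfl⟩)))

theorem coroot_smul_hwv (α : PosRoot) : ug (coroot α) • hwv l = (pairing l α : ℂ) • hwv l := by
  have key : ∀ i, ug (coroot (simpleRoot i)) • hwv l =
      (pairing l (simpleRoot i) : ℂ) • hwv l := by
    intro i
    have := smul_hwv_eq_zero (l := l) (Submodule.subset_span (Or.inl (Or.inr ⟨i, rfl⟩)))
    rwa [sub_smul, algebraMap_smul, sub_eq_zero] at this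
  cases α with
  | α₁ => exact key 0
  | α₂ => exact key 1
  | θ =>
    have h0 := key 0
    have h1 := key 1
    simp only [simpleRoot, Matrix.cons_val_zero, Matrix.cons_val_one] at h0 h1
    rw [coroot_θ, ug, map_add, add_smul, h0, h1, ← add_smul]
    simp [pairing]

theorem xNeg_pow_smul_hwv (i : Fin 2) :
    ug (xNeg (simpleRoot i)) ^ (pairing l (simpleRoot i) + 1) • hwv l = 0 :=
  smul_hwv_eq_zero (Submodule.subset_span (Or.inr ⟨i, rfl⟩))

theorem exists_smul_hwv (x : V l) : ∃ y : U, x = y • hwv l := by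
  obtain ⟨y, rfl⟩ := Submodule.Quotient.mk_surjective _ x
  exact ⟨y, by rw [hwv, ← Submodule.Quotient.mk_smul, smul_eq_mul, mul_one]⟩

theorem span_hwv : Submodule.span U {hwv l} = ⊤ := by
  refine eq_top_iff.2 fun x _ => ?_
  obtain ⟨y, rfl⟩ := exists_smul_hwv x
  exact Submodule.smul_mem _ _ (Submodule.mem_span_singleton_self _)

theorem exists_xNeg_pow_smul_V (i : Fin 2) (m : V l) :
    ∃ N, ug (xNeg (simpleRoot i)) ^ N • m = 0 := by
  refine exists_pow_smul_eq_zero_of_adjoin uea_adjoin (K := 3) ?_ span_hwv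
    ⟨_, xNeg_pow_smul_hwv i⟩ m
  rintro _ ⟨x, rfl⟩
  have had : ∀ x : G, ug (xNeg (simpleRoot i)) * ug x - ug x * ug (xNeg (simpleRoot i)) =
      ug ⁅xNeg (simpleRoot i), x⁆ := fun x => by rw [ug_mul, add_sub_cancel_left]
  change (fun z => ug (xNeg (simpleRoot i)) * z - z * ug (xNeg (simpleRoot i)))^[3] (ug x) = 0
  simp only [Function.iterate_succ, Function.iterate_zero, Function.comp_apply, id_eq, had,
    ad_xNeg_cube]
  exact map_zero _

/-- Universal property of `V(λ)`, for a representation of the enveloping algebra. -/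
theorem exists_lift_V {X : Type*} [AddCommGroup X] [Module ℂ X] (φ : U →ₐ[ℂ] Module.End ℂ X) {w : X}
    (hx : ∀ α, φ (ug (xPos α)) w = 0)
    (hh : ∀ i, φ (ug (coroot (simpleRoot i))) w = (pairing l (simpleRoot i) : ℂ) • w)
    (hy : ∀ i, (φ (ug (xNeg (simpleRoot i))) ^ (pairing l (simpleRoot i) + 1)) w = 0) :
    ∃ f : V l →ₗ[ℂ] X, ∀ y : U, f (y • hwv l) = φ y w := by
  let K : Submodule U U :=
    { carrier := {y | φ y w = 0}
      add_mem' := fun {a b} ha hb => by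
        change φ (a + b) w = 0
        rw [map_add, LinearMap.add_apply, show φ a w = 0 from ha, show φ b w = 0 from hb, add_zero]
      zero_mem' := by change φ 0 w = 0; rw [map_zero]; rfl
      smul_mem' := fun c a ha => by
        change φ (c * a) w = 0
        rw [map_mul, Module.End.mul_apply, show φ a w = 0 from ha, map_zero] }
  have hK : irrRel l ≤ K := by
    refine Submodule.span_le.2 ?_
    rintro y ((⟨α, rfl⟩ | ⟨i, rfl⟩) | ⟨i, rfl⟩)
    · exact hx α
    · change φ _ w = 0
      rw [map_sub, AlgHom.commutes, LinearMap.sub_apply, hh, Module.algebraMap_end_apply, sub_self]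
    · change φ _ w = 0
      rw [map_pow, hy]
  refine ⟨((irrRel l).restrictScalars ℂ).liftQ ((LinearMap.applyₗ w).comp φ.toLinearMap)
    fun y hy => hK hy, fun y => ?_⟩
  rw [hwv, ← Submodule.Quotient.mk_smul, smul_eq_mul, mul_one]
  rfl

/-- The vector `(x₁⁻)ⁱ (x_θ⁻)ᶜ (x₂⁻)ʲ v_λ`. -/
def pbwVec (l : Weight) (i c j : ℕ) : V l :=
  ug (xNeg .α₁) ^ i • ug (xNeg .θ) ^ c • ug (xNeg .α₂) ^ j • hwv l

theorem xNeg₁_θ_comm : Commute (ug (xNeg .α₁)) (ug (xNeg .θ)) := by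
  rw [Commute, SemiconjBy, ug_mul, lie_xNeg₁_xNegθ, ug, ug, ug, map_zero, add_zero]

theorem xNeg₂_θ_comm : Commute (ug (xNeg .α₂)) (ug (xNeg .θ)) := by
  rw [Commute, SemiconjBy, ug_mul, lie_xNeg₂_xNegθ, ug, ug, ug, map_zero, add_zero]

theorem xPos₂_xNeg₁_comm : Commute (ug (xPos .α₂)) (ug (xNeg .α₁)) := by
  rw [Commute, SemiconjBy, ug_mul, lie_xPos₂_xNeg₁, ug, ug, ug, map_zero, add_zero]

theorem xPos₁_xNeg₂_comm : Commute (ug (xPos .α₁)) (ug (xNeg .α₂)) := by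
  rw [Commute, SemiconjBy, ug_mul, lie_xPos₁_xNeg₂, ug, ug, ug, map_zero, add_zero]

/-- The commutator of `x` with a power of `y`, when it commutes with `y`. -/
theorem mul_pow_of_commute {A : Type*} [Ring A] [Algebra ℂ A] {x y z : A} (h : x * y = y * x + z)
    (hz : Commute z y) (n : ℕ) : x * y ^ n = y ^ n * x + (n : ℂ) • (y ^ (n - 1) * z) := by
  induction n with
  | zero => simp
  | succ n ih =>
    have h1 : y ^ (n - 1) * z * y = y ^ (n - 1) * y * z := by rw [mul_assoc, hz.eq, mul_assoc]
    rw [pow_succ, ← mul_assoc, ih, add_mul, mul_assoc, h, smul_mul_assoc, h1, mul_add, ← pow_succ,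
      ← mul_assoc, ← pow_succ, Nat.add_sub_cancel, add_assoc]
    congr 1
    rcases n with _ | n
    · simp
    · rw [Nat.add_sub_cancel, Nat.cast_succ (n + 1), add_smul, one_smul, add_comm]

theorem xPos₁_smul_pbwVec (c j : ℕ) :
    ug (xPos .α₁) • pbwVec l 0 c j = (-c : ℂ) • pbwVec l 0 (c - 1) (j + 1) := by
  have h1 : ug (xPos .α₁) * ug (xNeg .θ) = ug (xNeg .θ) * ug (xPos .α₁) + -ug (xNeg .α₂) := by
    rw [ug_mul, lie_xPos₁_xNegθ, ug, ug, ug, ug, map_neg]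
  have h2 := mul_pow_of_commute h1 xNeg₂_θ_comm.neg_left c
  simp only [pbwVec, pow_zero, one_smul]
  rw [← mul_smul, h2, add_smul, mul_smul, ← mul_smul (ug (xPos .α₁)),
    (xPos₁_xNeg₂_comm.pow_right j).eq, mul_smul, xPos_smul_hwv, smul_zero, smul_zero, zero_add,
    smul_assoc, mul_neg, neg_smul, smul_neg, neg_smul, mul_smul, ← mul_smul (ug (xNeg .α₂)),
    ← pow_succ']

theorem xPos₂_smul_pbwVec (i c j : ℕ) :
    ug (xPos .α₂) • pbwVec l i c j = (c : ℂ) • pbwVec l (i + 1) (c - 1) j +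
      (j * (l.2 - (j - 1)) : ℂ) • pbwVec l i c (j - 1) := by
  have h1 : ug (xPos .α₂) * ug (xNeg .θ) = ug (xNeg .θ) * ug (xPos .α₂) + ug (xNeg .α₁) := by
    rw [ug_mul, lie_xPos₂_xNegθ]
  have h2 := mul_pow_of_commute h1 xNeg₁_θ_comm c
  have h3 : ug (xPos .α₂) • ug (xNeg .α₂) ^ j • hwv l =
      (j * (l.2 - (j - 1)) : ℂ) • ug (xNeg .α₂) ^ (j - 1) • hwv l := by
    rcases j with _ | j
    · simpa using xPos_smul_hwv _
    · rw [(isSl2_ug .α₂).e_smul_pow_succ (coroot_smul_hwv _), xPos_smul_hwv, smul_zero, zero_add,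
        Nat.add_sub_cancel]
      simp [pairing]
  simp only [pbwVec]
  rw [← mul_smul, (xPos₂_xNeg₁_comm.pow_right i).eq, mul_smul, ← mul_smul (ug (xPos .α₂)), h2,
    add_smul, mul_smul, h3, smul_assoc, ← ((xNeg₁_θ_comm.pow_right (c - 1)).eq), smul_add,
    smul_comm _ (c : ℂ) _, mul_smul (ug (xNeg .α₁)), ← mul_smul _ (ug (xNeg .α₁)), ← pow_succ,
    smul_comm (ug (xNeg .θ) ^ c), smul_comm (ug (xNeg .α₁) ^ i), add_comm]

theorem xNeg₁_smul_pbwVec (i c j : ℕ) :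
    ug (xNeg .α₁) • pbwVec l i c j = pbwVec l (i + 1) c j := by
  rw [pbwVec, pbwVec, ← mul_smul, ← pow_succ']

theorem xNegθ_smul_pbwVec (i c j : ℕ) :
    ug (xNeg .θ) • pbwVec l i c j = pbwVec l i (c + 1) j := by
  rw [pbwVec, pbwVec, ← mul_smul, ← (xNeg₁_θ_comm.pow_left i).eq, mul_smul,
    ← mul_smul (ug (xNeg .θ)), ← pow_succ']

theorem xNeg₂_smul_pbwVec (i c j : ℕ) :
    ug (xNeg .α₂) • pbwVec l i c j =
      pbwVec l i c (j + 1) + (i : ℂ) • pbwVec l (i - 1) (c + 1) j := by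
  have h1 : ug (xNeg .α₂) * ug (xNeg .α₁) = ug (xNeg .α₁) * ug (xNeg .α₂) + ug (xNeg .θ) := by
    rw [ug_mul, ← lie_skew, lie_xNeg₁_xNeg₂, neg_neg]
  have h2 := mul_pow_of_commute h1 xNeg₁_θ_comm.symm i
  rw [pbwVec, ← mul_smul, h2, add_smul, mul_smul, ← mul_smul (ug (xNeg .α₂)),
    (xNeg₂_θ_comm.pow_right c).eq, mul_smul (_ ^ c), ← mul_smul (ug (xNeg .α₂)), ← pow_succ',
    smul_assoc, mul_smul, ← mul_smul (ug (xNeg .θ)), ← pow_succ', pbwVec, pbwVec]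

theorem coroot_smul_pbwVec (i c j : ℕ) :
    ug (coroot .α₁) • pbwVec l i c j = ((l.1 - 2 * i - c + j : ℤ) : ℂ) • pbwVec l i c j ∧
    ug (coroot .α₂) • pbwVec l i c j = ((l.2 - 2 * j - c + i : ℤ) : ℂ) • pbwVec l i c j := by
  have h := lie_coroot_xNeg
  have h3 := lie_coroot₁_xNeg₂
  have h4 := lie_coroot₁_xNegθ
  have h5 := lie_coroot₂_xNeg₁
  have h6 := lie_coroot₂_xNegθ
  have key : ∀ (x y : G) (s : ℂ), ⁅x, y⁆ = s • y → ∀ (n : ℕ) (m : V l) (r : ℂ),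
      ug x • m = r • m → ug x • ug y ^ n • m = (r + s * n) • ug y ^ n • m := by
    intro x y s hs n m r hm
    induction n with
    | zero => simpa using hm
    | succ n ih =>
      rw [pow_succ', mul_smul, ← mul_smul (ug x), ug_mul, hs, ug, ug, ug, map_smul, add_smul,
        mul_smul, ih, smul_comm, smul_assoc]
      push_cast
      generalize (UniversalEnvelopingAlgebra.ι ℂ) y • ug y ^ n • m = v
      module
  constructor
  · rw [pbwVec, key _ _ (-2) (h _) i _ _ (key _ _ (-1) (by rw [h4, neg_one_smul]) c _ _
      (key _ _ 1 (by rw [h3, one_smul]) j _ _ (coroot_smul_hwv _)))]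
    congr 1
    simp only [pairing]
    push_cast
    ring
  · rw [pbwVec, key _ _ 1 (by rw [h5, one_smul]) i _ _
      (key _ _ (-1) (by rw [h6, neg_one_smul]) c _ _
      (key _ _ (-2) (h _) j _ _ (coroot_smul_hwv _)))]
    congr 1
    simp only [pairing]
    push_cast
    ring

/-- The case of arbitrary `i`, deduced from the case `i = 0` by the commutation of `x₁⁺` with powers
of `x₁⁻`. -/
theorem xPos₁_smul_pbwVec_pow (i c j : ℕ) :
    ug (xPos .α₁) • pbwVec l i c j = (-c : ℂ) • pbwVec l i (c - 1) (j + 1) +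
      (i * ((l.1 - c + j : ℤ) - (i - 1)) : ℂ) • pbwVec l (i - 1) c j := by
  have h0 : ∀ i c j, pbwVec l i c j = ug (xNeg .α₁) ^ i • pbwVec l 0 c j := by
    intro i c j; simp [pbwVec]
  rcases i with _ | i
  · simpa using xPos₁_smul_pbwVec c j
  · have hw := (coroot_smul_pbwVec (l := l) 0 c j).1
    rw [h0, (isSl2_ug .α₁).e_smul_pow_succ hw, xPos₁_smul_pbwVec, smul_comm, ← h0,
        Nat.add_sub_cancel,
      ← h0]
    push_cast
    simp

/-- The span of the vectors `pbwVec l i c j` is stable under `sl₃`, hence is all of `V(λ)`. -/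
theorem eq_top_of_pbwVec_mem (P : Submodule ℂ (V l)) (hP : ∀ i c j, pbwVec l i c j ∈ P) :
    P = ⊤ := by
  let Q : Submodule ℂ (V l) := Submodule.span ℂ {m | ∃ i c j, m = pbwVec l i c j}
  have hmem : ∀ i c j, pbwVec l i c j ∈ Q := fun i c j => Submodule.subset_span ⟨i, c, j, rfl⟩
  have hQP : Q ≤ P := Submodule.span_le.2 (by rintro _ ⟨i, c, j, rfl⟩; exact hP i c j)
  let S : Submodule ℂ G :=
    { carrier := {x | ∀ m ∈ Q, ug x • m ∈ Q}
      add_mem' := fun {x y} hx hy m hm => by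
        rw [ug, map_add, add_smul]; exact Q.add_mem (hx m hm) (hy m hm)
      zero_mem' := fun m _ => by rw [ug, map_zero, zero_smul]; exact Q.zero_mem
      smul_mem' := fun c x hx m hm => by
        rw [ug, map_smul, smul_assoc]; exact Q.smul_mem _ (hx m hm) }
  have hS : ∀ x, (∀ i c j, ug x • pbwVec l i c j ∈ Q) → x ∈ S := by
    intro x h m hm
    induction hm using Submodule.span_induction with
    | mem m h' => obtain ⟨i, c, j, rfl⟩ := h'; exact h i c j
    | zero => rw [smul_zero]; exact Q.zero_mem
    | add a b _ _ ha hb => rw [smul_add]; exact Q.add_mem ha hb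
    | smul r a _ ha => rw [smul_comm]; exact Q.smul_mem _ ha
  have hx1 : xPos .α₁ ∈ S := hS _ fun i c j => by
    rw [xPos₁_smul_pbwVec_pow]
    exact Q.add_mem (Q.smul_mem _ (hmem _ _ _)) (Q.smul_mem _ (hmem _ _ _))
  have hx2 : xPos .α₂ ∈ S := hS _ fun i c j => by
    rw [xPos₂_smul_pbwVec]
    exact Q.add_mem (Q.smul_mem _ (hmem _ _ _)) (Q.smul_mem _ (hmem _ _ _))
  have hall : ∀ x, x ∈ S := by
    refine span_chevalley S (fun α => ?_) (fun α => hS _ fun i c j => ?_)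
      (fun s => hS _ fun i c j => ?_)
    · cases α with
      | α₁ => exact hx1
      | α₂ => exact hx2
      | θ =>
        intro m hm
        have : ug (xPos .θ) • m = ug (xPos .α₁) • ug (xPos .α₂) • m -
            ug (xPos .α₂) • ug (xPos .α₁) • m := by
          rw [← mul_smul, ug_mul, lie_xPos₁_xPos₂, add_smul, mul_smul, add_sub_cancel_left]
        rw [this]
        exact Q.sub_mem (hx1 _ (hx2 _ hm)) (hx2 _ (hx1 _ hm))
    · cases α with
      | α₁ => rw [xNeg₁_smul_pbwVec]; exact hmem _ _ _
      | α₂ =>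
        rw [xNeg₂_smul_pbwVec]
        exact Q.add_mem (hmem _ _ _) (Q.smul_mem _ (hmem _ _ _))
      | θ => rw [xNegθ_smul_pbwVec]; exact hmem _ _ _
    · fin_cases s
      · change ug (coroot .α₁) • _ ∈ Q
        rw [(coroot_smul_pbwVec i c j).1]
        exact Q.smul_mem _ (hmem _ _ _)
      · change ug (coroot .α₂) • _ ∈ Q
        rw [(coroot_smul_pbwVec i c j).2]
        exact Q.smul_mem _ (hmem _ _ _)
  refine eq_top_iff.2 fun m _ => hQP ?_
  obtain ⟨y, rfl⟩ := exists_smul_hwv m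
  refine smul_mem_of_adjoin uea_adjoin Q (by rintro _ ⟨x, rfl⟩; exact hall x) y _ ?_
  simpa [pbwVec] using hmem 0 0 0

/-- The vectors `(x₁⁻)ⁱ (x_θ⁻)ᶜ (x₂⁻)ʲ v_λ` with `c ≤ λ₁`, `j ≤ λ₂` and `i ≤ λ₁ - c + j` span. For
fixed `c + j`, those with `c > λ₁` reduce to smaller `c` because `(x₁⁻)^{λ₁ + 1}` kills `v_λ`.
Modulo those with smaller `c`, the vector with `i = 0` is a highest weight vector for `α₁` of weight
`λ₁ - c + j`, which bounds `i`. -/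
theorem pbwVec_mem (P : Submodule ℂ (V l))
    (hP : ∀ i c j, c ≤ l.1 → j ≤ l.2 → i + c ≤ l.1 + j → pbwVec l i c j ∈ P) (k c : ℕ) :
    ∀ i j, c + j = k → pbwVec l i c j ∈ P := by
  have h0 : ∀ i c j, pbwVec l i c j = ug (xNeg .α₁) ^ i • pbwVec l 0 c j := by
    intro i c j; simp [pbwVec]
  -- `Y D` is the span of the vectors with `c ≤ D` in a fixed degree `k` in `α₂`.
  let Y : ℕ → Submodule ℂ (V l) := fun D =>
    Submodule.span ℂ {m | ∃ i e j, e ≤ D ∧ e + j = k ∧ m = pbwVec l i e j}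
  have hYmem : ∀ {D} i e j, e ≤ D → e + j = k → pbwVec l i e j ∈ Y D := fun i e j h1 h2 =>
    Submodule.subset_span ⟨i, e, j, h1, h2, rfl⟩
  have hYmono : ∀ {D D'}, D ≤ D' → Y D ≤ Y D' := fun h => Submodule.span_mono (by
    rintro _ ⟨i, e, j, h1, h2, rfl⟩
    exact ⟨i, e, j, h1.trans h, h2, rfl⟩)
  have hYstab : ∀ (x : G) D, (∀ i e j, e ≤ D → e + j = k → ug x • pbwVec l i e j ∈ Y D) →
      ∀ m ∈ Y D, ug x • m ∈ Y D := by
    intro x D h m hm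
    induction hm using Submodule.span_induction with
    | mem m h' => obtain ⟨i, e, j, h1, h2, rfl⟩ := h'; exact h i e j h1 h2
    | zero => rw [smul_zero]; exact (Y D).zero_mem
    | add a b _ _ ha hb => rw [smul_add]; exact (Y D).add_mem ha hb
    | smul r a _ ha => rw [smul_comm]; exact (Y D).smul_mem _ ha
  have hYy : ∀ D, ∀ m ∈ Y D, ug (xNeg .α₁) • m ∈ Y D := fun D => hYstab _ _ fun i e j h1 h2 => by
    rw [xNeg₁_smul_pbwVec]
    exact hYmem _ _ _ h1 h2
  have hYx : ∀ D, ∀ m ∈ Y D, ug (xPos .α₁) • m ∈ Y D := fun D => hYstab _ _ fun i e j h1 h2 => by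
    rw [xPos₁_smul_pbwVec_pow]
    refine (Y D).add_mem ?_ ((Y D).smul_mem _ (hYmem _ _ _ h1 h2))
    rcases e with _ | e
    · simp
    · exact (Y D).smul_mem _ (hYmem _ _ _ (by omega) (by omega))
  have hYpow : ∀ D i, ∀ m ∈ Y D, ug (xNeg .α₁) ^ i • m ∈ Y D := by
    intro D i
    induction i with
    | zero => simp
    | succ i ih => intro m hm; rw [pow_succ', mul_smul]; exact hYy _ _ (ih m hm)
  -- Moving `x₁⁻` to the left of `(x_θ⁻)ᵉ (x₂⁻)ʲ`.
  have hmove : ∀ (e j d : ℕ), ug (xNeg .θ) ^ e • ug (xNeg .α₂) ^ j • ug (xNeg .α₁) ^ (d + 1) •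
      hwv l =
      ug (xNeg .α₁) • ug (xNeg .θ) ^ e • ug (xNeg .α₂) ^ j • ug (xNeg .α₁) ^ d • hwv l +
      (j : ℂ) • ug (xNeg .θ) ^ (e + 1) • ug (xNeg .α₂) ^ (j - 1) • ug (xNeg .α₁) ^ d • hwv l := by
    intro e j d
    have h1 : ug (xNeg .α₁) * ug (xNeg .α₂) = ug (xNeg .α₂) * ug (xNeg .α₁) + -ug (xNeg .θ) := by
      rw [ug_mul, lie_xNeg₁_xNeg₂, ug, ug, ug, ug, map_neg]
    have h2 := mul_pow_of_commute h1 xNeg₂_θ_comm.symm.neg_left j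
    have h3 : ug (xNeg .α₂) ^ j * ug (xNeg .α₁) = ug (xNeg .α₁) * ug (xNeg .α₂) ^ j +
        (j : ℂ) • (ug (xNeg .θ) * ug (xNeg .α₂) ^ (j - 1)) := by
      rw [h2, mul_neg, smul_neg, ((xNeg₂_θ_comm.symm).pow_right (j - 1)).eq, neg_add_cancel_right]
    rw [pow_succ', mul_smul (ug (xNeg .α₁)), ← mul_smul (ug (xNeg .α₂) ^ j), h3, add_smul, smul_add,
      mul_smul, ← mul_smul (ug (xNeg .θ) ^ e), ← (xNeg₁_θ_comm.pow_right e).eq, mul_smul,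
      smul_assoc,
      smul_comm _ (j : ℂ), mul_smul (ug (xNeg .θ)), ← mul_smul _ (ug (xNeg .θ)), ← pow_succ]
  have hB : ∀ d e j, e + j = k →
      ug (xNeg .θ) ^ e • ug (xNeg .α₂) ^ j • ug (xNeg .α₁) ^ d • hwv l ∈ Y (e + d) := by
    intro d
    induction d with
    | zero =>
      intro e j h
      simpa [pbwVec] using hYmem (D := e) 0 e j le_rfl h
    | succ d ih =>
      intro e j h
      rw [hmove]
      refine (Y _).add_mem (hYy _ _ (hYmono (by omega) (ih e j h))) ?_
      rcases j with _ | j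
      · simp
      · have := ih (e + 1) j (by omega)
        rw [show e + 1 + d = e + (d + 1) by omega] at this
        exact (Y _).smul_mem _ this
  have hvan : ∀ d, l.1 < d → ug (xNeg .α₁) ^ d • hwv l = 0 := by
    intro d hd
    obtain ⟨n, rfl⟩ := Nat.exists_eq_add_of_lt hd
    have : ug (xNeg .α₁) ^ (l.1 + 1) • hwv l = 0 := xNeg_pow_smul_hwv 0
    rw [show l.1 + n + 1 = n + (l.1 + 1) by omega, pow_add, mul_smul, this, smul_zero]
  have hA : ∀ e j d, e + j = k →
      ug (xNeg .θ) ^ e • ug (xNeg .α₂) ^ j • ug (xNeg .α₁) ^ d • hwv l ∈ Y l.1 := by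
    intro e
    induction e with
    | zero =>
      intro j d h
      by_cases hd : l.1 < d
      · rw [hvan d hd, smul_zero, smul_zero]
        exact (Y _).zero_mem
      · exact hYmono (by omega) (hB d 0 j h)
    | succ e ih =>
      intro j d h
      have h1 := ih (j + 1) (d + 1) (by omega)
      rw [hmove] at h1
      have h2 := ((Y l.1).add_mem_iff_right (hYy _ _ (ih (j + 1) d (by omega)))).1 h1
      exact ((Y l.1).smul_mem_iff (Nat.cast_ne_zero.2 (Nat.succ_ne_zero j))).1 h2
  induction c using Nat.strong_induction_on with
  | _ c ih =>
    intro i j hk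
    have hYP : ∀ D, D < c → Y D ≤ P := fun D hD => Submodule.span_le.2 (by
      rintro _ ⟨i', e, j', h1, h2, rfl⟩
      exact ih e (by omega) i' j' h2)
    by_cases hc : l.1 < c
    · refine hYP _ hc ?_
      rw [h0]
      have := hA c j 0 hk
      rw [pow_zero, one_smul] at this
      refine hYpow _ _ _ ?_
      rwa [pbwVec, pow_zero, one_smul]
    by_cases hj : l.2 < j
    · obtain ⟨n, rfl⟩ := Nat.exists_eq_add_of_lt hj
      have h1 : ug (xNeg .α₂) ^ (l.2 + 1) • hwv l = 0 := xNeg_pow_smul_hwv 1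
      rw [pbwVec, show l.2 + n + 1 = n + (l.2 + 1) by omega, pow_add, mul_smul _ _ (hwv l), h1,
        smul_zero, smul_zero, smul_zero]
      exact P.zero_mem
    by_cases hi : i + c ≤ l.1 + j
    · exact hP i c j (by omega) (by omega) hi
    rw [h0]
    have hw := (coroot_smul_pbwVec (l := l) 0 c j).1
    obtain ⟨N, hN⟩ := exists_xNeg_pow_smul_V 0 (pbwVec l 0 c j)
    rcases c with _ | c
    · have := (isSl2_ug .α₁).pow_smul_mem (P := ⊥) (by simp) (by simp) hw
        (by rw [xPos₁_smul_pbwVec]; simp)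
        ⟨N, by rw [show ug (xNeg .α₁) ^ N • pbwVec l 0 0 j = 0 from hN]; exact Submodule.zero_mem _⟩
        (n := i) (by push_cast; omega)
      rw [(Submodule.mem_bot ℂ).1 this]
      exact P.zero_mem
    · refine hYP c (Nat.lt_succ_self c) ?_
      refine (isSl2_ug .α₁).pow_smul_mem (hYx c) (hYy c) hw ?_ ⟨N, ?_⟩ (by push_cast; omega)
      · rw [xPos₁_smul_pbwVec]
        exact (Y c).smul_mem _ (hYmem _ _ _ le_rfl (by omega))
      · rw [show ug (xNeg .α₁) ^ N • pbwVec l 0 (c + 1) j = 0 from hN]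
        exact (Y c).zero_mem

/-- The upper bound in the Weyl dimension formula, obtained by counting spanning vectors. -/
theorem finrank_V_le (l : Weight) :
    Module.Finite ℂ (V l) ∧ 2 * (Module.finrank ℂ (V l) : ℤ) ≤ weylDim l.1 l.2 := by
  let b : (Σ q : Fin (l.1 + 1) × Fin (l.2 + 1), Fin (l.1 - q.1 + q.2 + 1)) → V l :=
    fun q => pbwVec l q.2 q.1.1 q.1.2
  have hb : Submodule.span ℂ (Set.range b) = ⊤ := by
    refine eq_top_of_pbwVec_mem _ fun i c j => pbwVec_mem _ (fun i c j h1 h2 h3 => ?_) _ c i j rfl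
    exact Submodule.subset_span
      ⟨⟨(⟨c, by omega⟩, ⟨j, by omega⟩), ⟨i, by dsimp only; omega⟩⟩, rfl⟩
  refine ⟨⟨(Submodule.fg_def.2 ⟨_, Set.finite_range b, hb⟩)⟩, ?_⟩
  have h1 := finrank_range_le_card (R := ℂ) b
  rw [Set.finrank, hb, finrank_top] at h1
  have h2 : ((Fintype.card (Σ q : Fin (l.1 + 1) × Fin (l.2 + 1),
      Fin (l.1 - q.1 + q.2 + 1)) : ℕ) : ℤ)
      = ∑ c ∈ Finset.range (l.1 + 1), ∑ j ∈ Finset.range (l.2 + 1), ((l.1 : ℤ) - c + j + 1) := by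
    rw [Fintype.card_sigma, Fintype.sum_prod_type,
      ← Fin.sum_univ_eq_sum_range (fun c : ℕ => ∑ j ∈ Finset.range (l.2 + 1),
      ((l.1 : ℤ) - c + j + 1))]
    push_cast
    refine Finset.sum_congr rfl fun c _ => ?_
    rw [← Fin.sum_univ_eq_sum_range (fun j : ℕ => ((l.1 : ℤ) - c + j + 1))]
    refine Finset.sum_congr rfl fun j _ => ?_
    have := c.2
    simp only [Fintype.card_fin]
    push_cast [Nat.cast_sub (show (c : ℕ) ≤ l.1 by omega)]
    ring
  have h3 : ∀ (a : ℤ) (n : ℕ), 2 * ∑ j ∈ Finset.range n, (a + j + 1) = n * (2 * a + n + 1) := by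
    intro a n
    induction n with
    | zero => simp
    | succ n ih => rw [Finset.sum_range_succ, mul_add, ih]; push_cast; ring
  have h4 : ∀ (a : ℤ) (b n : ℕ), ∑ c ∈ Finset.range n, ((b : ℤ) + 1) * (2 * (a - c) + (b + 1) + 1) =
      n * (b + 1) * (2 * a - n + b + 3) := by
    intro a b n
    induction n with
    | zero => simp
    | succ n ih => rw [Finset.sum_range_succ, ih]; push_cast; ring
  have h5 : 2 * ∑ c ∈ Finset.range (l.1 + 1), ∑ j ∈ Finset.range (l.2 + 1),
      ((l.1 : ℤ) - c + j + 1) =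
      weylDim l.1 l.2 := by
    rw [Finset.mul_sum, Finset.sum_congr rfl fun (c : ℕ) _ => h3 ((l.1 : ℤ) - c) (l.2 + 1)]
    push_cast
    rw [h4, weylDim]
    push_cast
    ring
  rw [← h5, ← h2]
  exact_mod_cast Nat.mul_le_mul_left 2 h1

end Irreducible

/-! ### Modules on which `sl₃ ⊗ t` acts by zero -/

/-- The homomorphism of enveloping algebras induced by `sl₃ → sl₃[t]`, `x ↦ x ⊗ 1`. -/
def uToUt : U →ₐ[ℂ] Ut :=
  UniversalEnvelopingAlgebra.lift ℂ
    { toLinearMap := curₗ 0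
      map_lie' := fun {x y} => by
        change cur ⁅x, y⁆ 0 = ⁅cur x 0, cur y 0⁆
        rw [LieRing.of_associative_ring_bracket, cur_mul x y, add_sub_cancel_left] }

theorem uToUt_ug (x : G) : uToUt (ug x) = cur x 0 := by
  rw [uToUt, ug, UniversalEnvelopingAlgebra.lift_ι_apply]
  rfl

section Evaluation

variable {M : Type*} [AddCommGroup M] [Module ℂ M] [Module Ut M] [IsScalarTower ℂ Ut M] {w : M}
  {ν : Weight} {p : PosRoot → ℕ}

/-- If `p = 0` then `sl₃ ⊗ t` acts by zero. -/
theorem TakiffRel.t_smul_eq_zero (T : TakiffRel w ν p) (hw : Submodule.span Ut {w} = ⊤)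
    (hp : ∀ α, p α = 0) (x : G) (r : ℕ) (hr : 1 ≤ r) (m : M) : cur x r • m = 0 := by
  refine cur_smul_eq_zero hw (fun x r hr => ?_) x r hr m
  rcases Nat.eq_or_lt_of_le hr with rfl | hr
  · refine cur_smul_eq_zero_of_basis (fun α => T.xPos_smul α 1) (fun α => ?_)
      (fun i => T.coroot_one_smul _) x
    have := T.xNeg_t_pow α
    rwa [hp, zero_add, pow_one] at this
  · exact T.two_le x r hr w

/-- A cyclic module with generator satisfying the relations for `p = 0` is a quotient of `V(ν)`. -/
theorem TakiffRel.finrank_le (T : TakiffRel w ν p) (hw : Submodule.span Ut {w} = ⊤)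
    (hp : ∀ α, p α = 0) :
    Module.Finite ℂ M ∧ Module.finrank ℂ M ≤ Module.finrank ℂ (V ν) := by
  obtain ⟨f, hf⟩ := exists_lift_V (l := ν) ((Algebra.lsmul ℂ ℂ M).comp uToUt) (w := w)
    (fun α => by
      change uToUt _ • w = 0
      rw [uToUt_ug, T.xPos_smul])
    (fun i => by
      change uToUt _ • w = _
      rw [uToUt_ug, T.coroot_smul, if_pos rfl])
    (fun i => by
      rw [← map_pow]
      change uToUt _ • w = _
      rw [map_pow, uToUt_ug, T.xNeg_pow])
  have hf' : ∀ y : U, f (y • hwv ν) = uToUt y • w := hf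
  have hsurj : LinearMap.range f = ⊤ := by
    refine eq_top_of_cur hw _ (fun x r m hm => ?_) ⟨hwv ν, by simpa using hf' 1⟩
    obtain ⟨y, rfl⟩ := hm
    obtain ⟨y, rfl⟩ := exists_smul_hwv y
    rcases Nat.eq_zero_or_pos r with rfl | hr
    · exact ⟨ug x • y • hwv ν, by rw [← mul_smul, hf', hf', map_mul, uToUt_ug, mul_smul]⟩
    · rw [T.t_smul_eq_zero hw hp x r hr]
      exact zero_mem _
  have := (finrank_V_le ν).1
  exact ⟨Module.Finite.of_surjective f (LinearMap.range_eq_top.1 hsurj),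
    LinearMap.finrank_le_finrank_of_surjective (LinearMap.range_eq_top.1 hsurj)⟩

end Evaluation

theorem minPart_zero (ν : Weight) (α : PosRoot) : minPart ν 0 α = 0 := by
  cases α <;> simp [minPart, pairing]

/-! ### The dimensions of the trivial representation and of the two fundamental ones -/

/-- A representation generated by a vector which satisfies the relations of `v_λ` is a quotient of
`V(λ)`. -/
theorem finrank_le_finrank_V {l : Weight} {X : Type} [AddCommGroup X] [Module ℂ X]
    (ψ : G →ₗ⁅ℂ⁆ Module.End ℂ X) {w : X} (hx : ∀ α, ψ (xPos α) w = 0)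
    (hh : ∀ i, ψ (coroot (simpleRoot i)) w = (pairing l (simpleRoot i) : ℂ) • w)
    (hy : ∀ i, (ψ (xNeg (simpleRoot i)) ^ (pairing l (simpleRoot i) + 1)) w = 0)
    (hgen : ∀ P : Submodule ℂ X, w ∈ P → (∀ x, ∀ m ∈ P, ψ x m ∈ P) → P = ⊤) :
    Module.finrank ℂ X ≤ Module.finrank ℂ (V l) := by
  have hι : ∀ x, UniversalEnvelopingAlgebra.lift ℂ ψ (ug x) = ψ x := fun x =>
    UniversalEnvelopingAlgebra.lift_ι_apply ℂ ψ x
  obtain ⟨f, hf⟩ := exists_lift_V (l := l) (UniversalEnvelopingAlgebra.lift ℂ ψ) (w := w)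
    (fun α => by rw [hι, hx]) (fun i => by rw [hι, hh]) (fun i => by rw [hι, hy])
  have hsurj : LinearMap.range f = ⊤ := by
    refine hgen _ ⟨hwv l, by simpa using hf 1⟩ fun x m hm => ?_
    obtain ⟨y, rfl⟩ := hm
    obtain ⟨y, rfl⟩ := exists_smul_hwv y
    exact ⟨ug x • y • hwv l, by rw [← mul_smul, hf, hf, map_mul, hι, Module.End.mul_apply]⟩
  have := (finrank_V_le l).1
  exact LinearMap.finrank_le_finrank_of_surjective (LinearMap.range_eq_top.1 hsurj)

theorem one_le_finrank_V_zero : 1 ≤ Module.finrank ℂ (V (0, 0)) := by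
  have := finrank_le_finrank_V (l := (0, 0)) (X := ℂ) 0 (w := 1) (fun α => rfl)
    (fun i => by fin_cases i <;> simp [simpleRoot, pairing])
    (fun i => by fin_cases i <;> simp [simpleRoot, pairing])
    (fun P h _ => by
      refine eq_top_iff.2 fun x _ => ?_
      simpa using P.smul_mem x h)
  simpa using this

/-- The natural representation of `sl₃` on `ℂ³`. -/
def natRep : G →ₗ⁅ℂ⁆ Module.End ℂ (Fin 3 → ℂ) where
  toFun x := Matrix.toLin' x.val
  map_add' x y := map_add Matrix.toLin' x.val y.val
  map_smul' c x := map_smul Matrix.toLin' c x.val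
  map_lie' := fun {x y} => by
    rw [val_bracket, map_sub, Matrix.toLin'_mul, Matrix.toLin'_mul]
    rfl

/-- The dual of the natural representation of `sl₃`. -/
def dualRep : G →ₗ⁅ℂ⁆ Module.End ℂ (Fin 3 → ℂ) where
  toFun x := Matrix.toLin' (-x.val.transpose)
  map_add' x y := by
    rw [← map_add]
    congr 1
    change -(x.val + y.val).transpose = _
    rw [Matrix.transpose_add, neg_add]
  map_smul' c x := by
    rw [← map_smul]
    congr 1
    change -(c • x.val).transpose = c • _
    rw [Matrix.transpose_smul, smul_neg]
  map_lie' := fun {x y} => by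
    rw [val_bracket, LieRing.of_associative_ring_bracket, Module.End.mul_eq_comp,
      Module.End.mul_eq_comp, ← Matrix.toLin'_mul, ← Matrix.toLin'_mul, ← map_sub]
    congr 1
    rw [Matrix.transpose_sub, Matrix.transpose_mul, Matrix.transpose_mul]
    simp

theorem natRep_apply (x : G) (m : Fin 3 → ℂ) : natRep x m = x.val.mulVec m := rfl

theorem dualRep_apply (x : G) (m : Fin 3 → ℂ) : dualRep x m = (-x.val.transpose).mulVec m := rfl

theorem single_mulVec_single (a b j : Fin 3) :
    (Matrix.single a b 1 : Matrix (Fin 3) (Fin 3) ℂ).mulVec (Pi.single j 1) =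
      if j = b then Pi.single a 1 else 0 := by
  rw [Matrix.mulVec_single_one]
  ext i
  rw [Matrix.col_apply, Matrix.single_apply]
  by_cases h : j = b
  · simp [h, Pi.single_apply, eq_comm]
  · rw [if_neg h, if_neg fun h' => h h'.2.symm]
    rfl

theorem natRep_xPos (α : PosRoot) (j : Fin 3) : natRep (xPos α) (Pi.single j 1) =
    if j = α.col then Pi.single α.row 1 else 0 := by
  change (Matrix.single α.row α.col 1 : Matrix (Fin 3) (Fin 3) ℂ).mulVec _ = _
  rw [single_mulVec_single]

theorem natRep_xNeg (α : PosRoot) (j : Fin 3) : natRep (xNeg α) (Pi.single j 1) =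
    if j = α.row then Pi.single α.col 1 else 0 := by
  change (Matrix.single α.col α.row 1 : Matrix (Fin 3) (Fin 3) ℂ).mulVec _ = _
  rw [single_mulVec_single]

theorem dualRep_xPos (α : PosRoot) (j : Fin 3) : dualRep (xPos α) (Pi.single j 1) =
    if j = α.row then -Pi.single α.col 1 else 0 := by
  change (-(Matrix.single α.row α.col 1 : Matrix (Fin 3) (Fin 3) ℂ).transpose).mulVec _ = _
  rw [Matrix.transpose_single, Matrix.neg_mulVec, single_mulVec_single]
  split_ifs <;> simp

theorem dualRep_xNeg (α : PosRoot) (j : Fin 3) : dualRep (xNeg α) (Pi.single j 1) =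
    if j = α.col then -Pi.single α.row 1 else 0 := by
  change (-(Matrix.single α.col α.row 1 : Matrix (Fin 3) (Fin 3) ℂ).transpose).mulVec _ = _
  rw [Matrix.transpose_single, Matrix.neg_mulVec, single_mulVec_single]
  split_ifs <;> simp

theorem eq_top_of_single_mem (P : Submodule ℂ (Fin 3 → ℂ)) (h : ∀ i, Pi.single i 1 ∈ P) :
    P = ⊤ := by
  rw [eq_top_iff, ← (Pi.basisFun ℂ (Fin 3)).span_eq, Submodule.span_le]
  rintro _ ⟨i, rfl⟩
  simpa using h i

theorem three_le_finrank_V_fst : 3 ≤ Module.finrank ℂ (V (1, 0)) := by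
  have := finrank_le_finrank_V (l := (1, 0)) natRep (w := Pi.single 0 1)
    (fun α => by
      rw [natRep_xPos]
      cases α <;> simp [PosRoot.col])
    (fun i => by
      rw [natRep_apply]
      fin_cases i <;> ext j <;> fin_cases j <;> simp [simpleRoot, pairing, val_coroot])
    (fun i => by
      fin_cases i <;>
      simp [simpleRoot, pairing, natRep_xNeg, pow_succ, PosRoot.row, PosRoot.col])
    (fun P h hP => by
      refine eq_top_of_single_mem P fun i => ?_
      fin_cases i
      · exact h
      · have := hP (xNeg .α₁) _ h
        simpa [natRep_xNeg, PosRoot.row, PosRoot.col] using this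
      · have := hP (xNeg .θ) _ h
        simpa [natRep_xNeg, PosRoot.row, PosRoot.col] using this)
  simpa using this

theorem three_le_finrank_V_snd : 3 ≤ Module.finrank ℂ (V (0, 1)) := by
  have := finrank_le_finrank_V (l := (0, 1)) dualRep (w := Pi.single 2 1)
    (fun α => by
      rw [dualRep_xPos]
      cases α <;> simp [PosRoot.row])
    (fun i => by
      rw [dualRep_apply]
      fin_cases i <;> ext j <;> fin_cases j <;> simp [simpleRoot, pairing, val_coroot])
    (fun i => by
      fin_cases i <;>
      simp [simpleRoot, pairing, dualRep_xNeg, pow_succ, PosRoot.row, PosRoot.col])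
    (fun P h hP => by
      refine eq_top_of_single_mem P fun i => ?_
      fin_cases i
      · have := hP (xNeg .θ) _ h
        simpa [dualRep_xNeg, PosRoot.row, PosRoot.col] using this
      · have := hP (xNeg .α₂) _ h
        simpa [dualRep_xNeg, PosRoot.row, PosRoot.col] using this
      · exact h)
  simpa using this

/-! ### The filtration by the submodules generated by monomials -/

theorem finrank_submoduleOf {M : Type*} [AddCommGroup M] [Module ℂ M] [Module Ut M]
    [IsScalarTower ℂ Ut M] {N N' : Submodule Ut M} (h : N ≤ N') [Module.Finite ℂ N]
    [Module.Finite ℂ (N' ⧸ N.submoduleOf N')] : Module.Finite ℂ N' ∧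
      Module.finrank ℂ N' = Module.finrank ℂ N + Module.finrank ℂ (N' ⧸ N.submoduleOf N') := by
  let K : Submodule ℂ N' := (N.submoduleOf N').restrictScalars ℂ
  let e : N ≃ₗ[ℂ] K := ((Submodule.submoduleOfEquivOfLe h).symm).restrictScalars ℂ
  let e' : (N' ⧸ K) ≃ₗ[ℂ] (N' ⧸ N.submoduleOf N') := Submodule.Quotient.restrictScalarsEquiv ℂ _
  have h1 : Module.Finite ℂ K := Module.Finite.equiv e
  have h2 : Module.Finite ℂ (N' ⧸ K) := Module.Finite.equiv e'.symm
  have h3 : Module.Finite ℂ N' := Module.Finite.of_submodule_quotient K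
  refine ⟨h3, ?_⟩
  rw [← K.finrank_quotient_add_finrank, e.finrank_eq, e'.finrank_eq, add_comm]

section Step

variable {M : Type*} [AddCommGroup M] [Module ℂ M] [Module Ut M] [IsScalarTower ℂ Ut M]
  {w : M} {ν : Weight} {p : PosRoot → ℕ}

/-- The weight of the monomial with exponents `(i, j, k)`. -/
def tWeight (ν : Weight) (q : ℕ × ℕ × ℕ) : Weight :=
  (ν.1 + q.2.1 - (2 * q.1 + q.2.2), ν.2 + q.1 - (2 * q.2.1 + q.2.2))

/-- The order on triples of exponents along which the filtration is built: larger exponents of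
`x_{α₁}⁻ ⊗ t`, of `x_{α₂}⁻ ⊗ t`, and larger degree. -/
def ExpLE (q q' : ℕ × ℕ × ℕ) : Prop :=
  q.1 ≤ q'.1 ∧ q.2.1 ≤ q'.2.1 ∧ q.1 + q.2.1 + q.2.2 ≤ q'.1 + q'.2.1 + q'.2.2

/-- Modulo a submodule containing all essential monomials above a given essential one, the latter
satisfies the relations of the generator of `F_{κ,0}`, where `κ` is its weight. -/
theorem TakiffRel.step (T : TakiffRel w ν p) (hw : Submodule.span Ut {w} = ⊤) (hp : IsHalf ν p)
    {i j k : ℕ} (hq : (i, j, k) ∈ essential ν p) {N N' : Submodule Ut M}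
    (hN : ∀ i' j' k', (i', j', k') ∈ essential ν p → ExpLE (i, j, k) (i', j', k') →
      (i', j', k') ≠ (i, j, k) → tMonomial w i' j' k' ∈ N) (hu : tMonomial w i j k ∈ N') :
    TakiffRel (Submodule.Quotient.mk ⟨tMonomial w i j k, hu⟩ : N' ⧸ N.submoduleOf N')
      (tWeight ν (i, j, k)) 0 := by
  obtain ⟨-, hq1, hq2⟩ := mem_essential.1 hq
  have h0 : ∀ y : Ut, y • tMonomial w i j k ∈ N →
      y • (Submodule.Quotient.mk ⟨tMonomial w i j k, hu⟩ : N' ⧸ N.submoduleOf N') = 0 := by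
    intro y hy
    rw [← Submodule.Quotient.mk_smul, Submodule.Quotient.mk_eq_zero]
    exact hy
  have hC : ∀ (y : Ut) (c : ℂ), y • tMonomial w i j k = c • tMonomial w i j k →
      y • (Submodule.Quotient.mk ⟨tMonomial w i j k, hu⟩ : N' ⧸ N.submoduleOf N') =
        c • Submodule.Quotient.mk ⟨tMonomial w i j k, hu⟩ := by
    intro y c hy
    rw [← Submodule.Quotient.mk_smul, ← Submodule.Quotient.mk_smul]
    congr 1
    exact Subtype.ext hy
  have hsmul : ∀ (c : ℂ) m, m ∈ N → c • m ∈ N := fun c m hm =>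
    (N.restrictScalars ℂ).smul_mem c hm
  have hmem : ∀ i' j' k', i ≤ i' → j ≤ j' → i + j + k ≤ i' + j' + k' →
      (i < i' ∨ j < j' ∨ i + j + k < i' + j' + k') → tMonomial w i' j' k' ∈ N := by
    intro i' j' k' h1 h2 h3 h4
    refine T.tMonomial_mem hw hp N fun i'' j'' k'' h h1' h2' h3' => hN _ _ _ h ?_ ?_
    · exact ⟨h1.trans h1', h2.trans h2', by dsimp only; omega⟩
    · rw [Ne, Prod.mk.injEq, Prod.mk.injEq]
      omega
  have hx1 : cur (xPos .α₁) 0 • tMonomial w i j k ∈ N := by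
    rw [T.xPos₁_smul]
    rcases k with _ | k
    · simp
    · exact hsmul _ _ (hmem _ _ _ le_rfl (by omega) (by omega) (by omega))
  have hx2 : cur (xPos .α₂) 0 • tMonomial w i j k ∈ N := by
    rw [T.xPos₂_smul]
    rcases k with _ | k
    · simp
    · exact hsmul _ _ (hmem _ _ _ (by omega) le_rfl (by omega) (by omega))
  have hloc : ∀ s, ∀ m : M, ∃ N, cur (xNeg (simpleRoot s)) 0 ^ N • m = 0 := fun s =>
    exists_xNeg_pow_smul_eq_zero hw ⟨_, T.xNeg_pow s⟩
  have hstab : ∀ y : Ut, ∀ m ∈ N.restrictScalars ℂ, y • m ∈ N.restrictScalars ℂ :=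
    fun y m hm => N.smul_mem y hm
  have htop : ∀ x r, 2 ≤ r → ∀ m : N' ⧸ N.submoduleOf N', cur x r • m = 0 := by
    intro x r hr m
    obtain ⟨⟨m, hm⟩, rfl⟩ := Submodule.Quotient.mk_surjective _ m
    rw [← Submodule.Quotient.mk_smul, Submodule.Quotient.mk_eq_zero]
    change cur x r • m ∈ N
    rw [T.two_le x r hr]
    exact N.zero_mem
  have e1 : (((tWeight ν (i, j, k)).1 : ℕ) : ℤ) = ν.1 - 2 * i + j - k := by
    simp only [tWeight]; omega
  have e2 : (((tWeight ν (i, j, k)).2 : ℕ) : ℤ) = ν.2 - 2 * j + i - k := by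
    simp only [tWeight]; omega
  refine ⟨fun α s => h0 _ ?_, fun α s => ?_, fun s => h0 _ ?_, htop, fun α => h0 _ ?_⟩
  · rcases s with _ | _ | s
    · cases α with
      | α₁ => exact hx1
      | α₂ => exact hx2
      | θ =>
        have h3 := cur_smul_cur_smul (xPos .α₁) (xPos .α₂) 0 0 (tMonomial w i j k)
        rw [lie_xPos₁_xPos₂] at h3
        rw [← N.add_mem_iff_right (N.smul_mem (cur (xPos .α₂) 0) hx1)]
        exact h3 ▸ N.smul_mem _ hx2
    · rw [T.xPos_t_smul]
      exact N.zero_mem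
    · rw [T.two_le _ _ (by omega)]
      exact N.zero_mem
  · rcases s with _ | _ | s
    · refine hC _ _ ?_
      rw [if_pos rfl]
      have c1 : cur (coroot .α₁) 0 • tMonomial w i j k =
          (((tWeight ν (i, j, k)).1 : ℕ) : ℂ) • tMonomial w i j k := by
        rw [T.coroot₁_smul, ← e1, Int.cast_natCast]
      have c2 : cur (coroot .α₂) 0 • tMonomial w i j k =
          (((tWeight ν (i, j, k)).2 : ℕ) : ℂ) • tMonomial w i j k := by
        rw [T.coroot₂_smul, ← e2, Int.cast_natCast]
      cases α with
      | α₁ => exact c1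
      | α₂ => exact c2
      | θ =>
        rw [coroot_θ, cur_add, add_smul, c1, c2, ← add_smul, pairing]
        push_cast
        rfl
    · rw [if_neg (by omega), Nat.cast_zero, zero_smul]
      refine h0 _ ?_
      rw [T.coroot_t_smul]
      exact N.zero_mem
    · rw [if_neg (by omega), Nat.cast_zero, zero_smul, htop _ _ (by omega)]
  · have hN0 : ∀ m, ∃ n, cur (xNeg (simpleRoot s)) 0 ^ n • m ∈ N.restrictScalars ℂ := fun m => by
      obtain ⟨n, hn⟩ := hloc s m
      exact ⟨n, hn ▸ zero_mem _⟩
    fin_cases s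
    · exact (isSl2_cur .α₁).pow_smul_mem (P := N.restrictScalars ℂ) (hstab _) (hstab _)
        (T.coroot₁_smul i j k) hx1 (hN0 _) (by
          rw [← e1]; exact_mod_cast Nat.lt_succ_self _)
    · exact (isSl2_cur .α₂).pow_smul_mem (P := N.restrictScalars ℂ) (hstab _) (hstab _)
        (T.coroot₂_smul i j k) hx2 (hN0 _) (by
          rw [← e2]; exact_mod_cast Nat.lt_succ_self _)
  · rw [Pi.zero_apply, zero_add, pow_one, t_smul_tMonomial T.two_le]
    cases α with
    | α₁ =>
      rw [tMonomial_succ_left T.two_le]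
      exact hmem _ _ _ (by omega) le_rfl (by omega) (by omega)
    | α₂ =>
      rw [tMonomial_succ_mid T.two_le]
      exact hmem _ _ _ le_rfl (by omega) (by omega) (by omega)
    | θ =>
      rw [tMonomial_succ_right]
      exact hmem _ _ _ le_rfl le_rfl (by omega) (by omega)

/-- The submodule generated by the monomials with exponents in `A`. -/
def tSpan (w : M) (A : Finset (ℕ × ℕ × ℕ)) : Submodule Ut M :=
  Submodule.span Ut {m | ∃ i j k, (i, j, k) ∈ A ∧ m = tMonomial w i j k}

omit [Module ℂ M] [IsScalarTower ℂ Ut M] in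
theorem tMonomial_mem_tSpan {A : Finset (ℕ × ℕ × ℕ)} {i j k : ℕ} (h : (i, j, k) ∈ A) :
    tMonomial w i j k ∈ tSpan w A := Submodule.subset_span ⟨i, j, k, h, rfl⟩

omit [Module ℂ M] [IsScalarTower ℂ Ut M] in
theorem tSpan_mono {A B : Finset (ℕ × ℕ × ℕ)} (h : A ⊆ B) : tSpan w A ≤ tSpan w B :=
  Submodule.span_mono (by rintro _ ⟨i, j, k, hA, rfl⟩; exact ⟨i, j, k, h hA, rfl⟩)

omit [Module ℂ M] [IsScalarTower ℂ Ut M] in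
theorem tSpan_empty : tSpan w ∅ = ⊥ := by simp [tSpan]

theorem tSpan_essential (T : TakiffRel w ν p) (hw : Submodule.span Ut {w} = ⊤) (hp : IsHalf ν p) :
    tSpan w (essential ν p) = ⊤ := by
  rw [eq_top_iff, ← hw, Submodule.span_le, Set.singleton_subset_iff]
  have h0 : tMonomial w 0 0 0 = w := by simp [tMonomial]
  have := T.tMonomial_mem (i := 0) (j := 0) (k := 0) hw hp (tSpan w (essential ν p))
    fun _ _ _ h _ _ _ => tMonomial_mem_tSpan h
  rwa [h0] at this

/-- `A` is an upper set in the set of essential triples. -/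
def IsUpper (ν : Weight) (p : PosRoot → ℕ) (A : Finset (ℕ × ℕ × ℕ)) : Prop :=
  A ⊆ essential ν p ∧ ∀ q ∈ A, ∀ q' ∈ essential ν p, ExpLE q q' → q' ∈ A

/-- Removing from `B` an element of `B \ A` minimal for the order leaves an upper set. -/
theorem IsUpper.exists_erase {A B : Finset (ℕ × ℕ × ℕ)} (hA : IsUpper ν p A) (hB : IsUpper ν p B)
    (hne : (B \ A).Nonempty) : ∃ q ∈ B, q ∉ A ∧ IsUpper ν p (B.erase q) := by
  obtain ⟨q, hq, hmin⟩ := (B \ A).exists_min_image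
    (fun q => 2 * q.1 + 2 * q.2.1 + q.2.2) hne
  obtain ⟨hqB, hqA⟩ := Finset.mem_sdiff.1 hq
  refine ⟨q, hqB, hqA, (Finset.erase_subset _ _).trans hB.1, fun q₁ hq₁ q' hq' hle => ?_⟩
  obtain ⟨hne', hq₁B⟩ := Finset.mem_erase.1 hq₁
  refine Finset.mem_erase.2 ⟨?_, hB.2 q₁ hq₁B q' hq' hle⟩
  rintro rfl
  have hq₁A : q₁ ∉ A := fun h => hqA (hA.2 q₁ h q' hq' hle)
  have := hmin q₁ (Finset.mem_sdiff.2 ⟨hq₁B, hq₁A⟩)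
  obtain ⟨h1, h2, h3⟩ := hle
  obtain ⟨i, j, k⟩ := q₁
  obtain ⟨i', j', k'⟩ := q'
  rw [Ne, Prod.mk.injEq, Prod.mk.injEq] at hne'
  dsimp only at *
  omega

omit [IsScalarTower ℂ Ut M] [Module ℂ M] in
theorem span_mk_tMonomial {B : Finset (ℕ × ℕ × ℕ)} {i j k : ℕ} (h : (i, j, k) ∈ B) :
    Submodule.span Ut {(Submodule.Quotient.mk ⟨tMonomial w i j k, tMonomial_mem_tSpan h⟩ :
      tSpan w B ⧸ (tSpan w (B.erase (i, j, k))).submoduleOf (tSpan w B))} = ⊤ := by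
  rw [eq_top_iff]
  rintro x -
  obtain ⟨⟨x, hx⟩, rfl⟩ := Submodule.Quotient.mk_surjective _ x
  induction hx using Submodule.span_induction with
  | mem x hx =>
    obtain ⟨i', j', k', h', rfl⟩ := hx
    by_cases hq : (i', j', k') = (i, j, k)
    · simp only [Prod.mk.injEq] at hq
      obtain ⟨rfl, rfl, rfl⟩ := hq
      exact Submodule.mem_span_singleton_self _
    · have h0 : (⟨tMonomial w i' j' k', tMonomial_mem_tSpan h'⟩ : tSpan w B) ∈
          (tSpan w (B.erase (i, j, k))).submoduleOf (tSpan w B) :=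
        tMonomial_mem_tSpan (w := w) (Finset.mem_erase.2 ⟨hq, h'⟩)
      rw [← Submodule.Quotient.mk_eq_zero] at h0
      exact h0 ▸ zero_mem _
  | zero => exact zero_mem _
  | add a b ha hb h1 h2 => exact add_mem h1 h2
  | smul c a ha h1 => exact Submodule.smul_mem _ c h1

/-- The class of the monomial removed from an upper set satisfies the relations of the generator of
`F_{κ,0}`. -/
theorem TakiffRel.step_tSpan (T : TakiffRel w ν p) (hw : Submodule.span Ut {w} = ⊤)
    (hp : IsHalf ν p) {B : Finset (ℕ × ℕ × ℕ)} (hB : IsUpper ν p B) {i j k : ℕ}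
    (h : (i, j, k) ∈ B) :
    TakiffRel (Submodule.Quotient.mk ⟨tMonomial w i j k, tMonomial_mem_tSpan h⟩ :
      tSpan w B ⧸ (tSpan w (B.erase (i, j, k))).submoduleOf (tSpan w B))
      (tWeight ν (i, j, k)) 0 :=
  T.step hw hp (hB.1 h) (fun _ _ _ h' hle hne =>
    tMonomial_mem_tSpan (Finset.mem_erase.2 ⟨hne, hB.2 _ h _ h' hle⟩)) _

/-- The dimension grows along the filtration by at most the dimensions of the irreducible modules
attached to the added monomials. -/
theorem TakiffRel.finrank_tSpan_le (T : TakiffRel w ν p) (hw : Submodule.span Ut {w} = ⊤)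
    (hp : IsHalf ν p) {A B : Finset (ℕ × ℕ × ℕ)} (hA : IsUpper ν p A) (hB : IsUpper ν p B)
    (hAB : A ⊆ B) [hfin : Module.Finite ℂ (tSpan w A)] : Module.Finite ℂ (tSpan w B) ∧
      Module.finrank ℂ (tSpan w B) ≤ Module.finrank ℂ (tSpan w A) +
        ∑ q ∈ B \ A, Module.finrank ℂ (V (tWeight ν q)) := by
  induction hn : (B \ A).card generalizing B with
  | zero =>
    have : B = A := (Finset.sdiff_eq_empty_iff_subset.1 (Finset.card_eq_zero.1 hn)).antisymm hAB
    subst this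
    simpa using hfin
  | succ n ih =>
    obtain ⟨⟨i, j, k⟩, hqB, hqA, hup⟩ := hA.exists_erase hB (Finset.card_pos.1 (by omega))
    have hsub : A ⊆ B.erase (i, j, k) := fun q hq =>
      Finset.mem_erase.2 ⟨fun h => hqA (h ▸ hq), hAB hq⟩
    have hsd : B \ A = insert (i, j, k) (B.erase (i, j, k) \ A) := by
      rw [← Finset.insert_sdiff_of_notMem _ hqA, Finset.insert_erase hqB]
    have hnot : (i, j, k) ∉ B.erase (i, j, k) \ A := by simp
    rw [hsd, Finset.card_insert_of_notMem hnot] at hn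
    obtain ⟨h1, h2⟩ := ih hup hsub (by omega)
    obtain ⟨h3, h4⟩ := (T.step_tSpan hw hp hB hqB).finrank_le (span_mk_tMonomial hqB) fun _ => rfl
    obtain ⟨h5, h6⟩ := finrank_submoduleOf (tSpan_mono (w := w) (B.erase_subset (i, j, k)))
    refine ⟨h5, ?_⟩
    rw [h6, hsd, Finset.sum_insert hnot]
    omega

theorem isUpper_empty : IsUpper ν p ∅ := ⟨Finset.empty_subset _, by simp⟩

theorem isUpper_essential : IsUpper ν p (essential ν p) := ⟨subset_rfl, fun _ _ _ h _ => h⟩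

/-- The upper bound for the dimension of a cyclic module with these relations. -/
theorem TakiffRel.finrank_le_sum (T : TakiffRel w ν p) (hw : Submodule.span Ut {w} = ⊤)
    (hp : IsHalf ν p) : Module.Finite ℂ M ∧
      Module.finrank ℂ M ≤ ∑ q ∈ essential ν p, Module.finrank ℂ (V (tWeight ν q)) := by
  have h0 : Module.Finite ℂ (tSpan w ∅) := by rw [tSpan_empty]; infer_instance
  obtain ⟨h1, h2⟩ :=
    T.finrank_tSpan_le hw hp isUpper_empty isUpper_essential (Finset.empty_subset _)
  let e : tSpan w (essential ν p) ≃ₗ[ℂ] M :=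
    ((LinearEquiv.ofEq _ _ (tSpan_essential T hw hp)).trans Submodule.topEquiv).restrictScalars ℂ
  refine ⟨Module.Finite.equiv e, ?_⟩
  have h3 : Module.finrank ℂ (tSpan w ∅) = 0 := by
    rw [tSpan_empty]
    exact Module.finrank_zero_of_subsingleton
  rw [← e.finrank_eq]
  simpa [h3] using h2

/-- If the total dimension is as large as possible, then so is that of each submodule of the
filtration. -/
theorem TakiffRel.finrank_tSpan (T : TakiffRel w ν p) (hw : Submodule.span Ut {w} = ⊤)
    (hp : IsHalf ν p)
    (hM : ∑ q ∈ essential ν p, Module.finrank ℂ (V (tWeight ν q)) ≤ Module.finrank ℂ M)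
    {A : Finset (ℕ × ℕ × ℕ)} (hA : IsUpper ν p A) :
    Module.finrank ℂ (tSpan w A) = ∑ q ∈ A, Module.finrank ℂ (V (tWeight ν q)) := by
  have h0 : Module.Finite ℂ (tSpan w ∅) := by rw [tSpan_empty]; infer_instance
  have h3 : Module.finrank ℂ (tSpan w ∅) = 0 := by
    rw [tSpan_empty]
    exact Module.finrank_zero_of_subsingleton
  obtain ⟨h1, h2⟩ := T.finrank_tSpan_le hw hp isUpper_empty hA (Finset.empty_subset _)
  obtain ⟨h4, h5⟩ := T.finrank_tSpan_le hw hp hA isUpper_essential hA.1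
  let e : tSpan w (essential ν p) ≃ₗ[ℂ] M :=
    ((LinearEquiv.ofEq _ _ (tSpan_essential T hw hp)).trans Submodule.topEquiv).restrictScalars ℂ
  rw [e.finrank_eq] at h5
  rw [h3, Finset.sdiff_empty] at h2
  have := Finset.sum_sdiff (f := fun q => Module.finrank ℂ (V (tWeight ν q))) hA.1
  omega

end Step

/-! ### Integrability in finite-dimensional modules -/

section Integrable

variable {A M : Type*} [Ring A] [Algebra ℂ A] [AddCommGroup M] [Module ℂ M] [Module A M]
  [IsScalarTower ℂ A M] {e f h : A}

theorem IsSl2.map {B : Type*} [Ring B] [Algebra ℂ B] (t : IsSl2 e f h) (φ : A →ₐ[ℂ] B) :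
    IsSl2 (φ e) (φ f) (φ h) where
  ef := by rw [← map_mul, t.ef, map_add, map_mul]
  hf := by rw [← map_mul, t.hf, map_sub, map_mul, map_smul]
  he := by rw [← map_mul, t.he, map_add, map_mul, map_smul]

/-- A highest weight vector of weight `n` in a finite-dimensional module is killed by `f ^ (n + 1)`:
otherwise its images under the powers of `f` would be infinitely many eigenvectors of `h` with
different eigenvalues. -/
theorem IsSl2.pow_succ_smul_eq_zero [Module.Finite ℂ M] (t : IsSl2 e f h) {u : M} {n : ℕ}
    (hu : h • u = (n : ℂ) • u) (heu : e • u = 0) : f ^ (n + 1) • u = 0 := by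
  have hN : ∃ N : ℕ, f ^ N • u = 0 := by
    by_contra! hne
    have hev : ∀ k : ℕ, Module.End.HasEigenvector (Algebra.lsmul ℂ ℂ M h : Module.End ℂ M)
        ((n : ℂ) - 2 * k) (f ^ k • u) := fun k =>
      ⟨Module.End.mem_eigenspace_iff.2 (t.h_smul_pow hu k), hne k⟩
    have hli := Module.End.eigenvectors_linearIndependent' (Algebra.lsmul ℂ ℂ M h : Module.End ℂ M)
      (fun k : ℕ => (n : ℂ) - 2 * k) (fun a b hab => by simpa using hab) _ hev
    exact not_finite_iff_infinite.2 (inferInstanceAs (Infinite ℕ)) hli.finite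
  have := t.pow_smul_mem (P := (⊥ : Submodule ℂ M)) (by simp) (by simp) (c := n)
    (by simpa using hu) (by simpa using heu) (n := n + 1) (by simpa using hN) (by push_cast; omega)
  simpa using this

end Integrable

/-- The integrability relation holds for `θ` as well, `V(λ)` being finite-dimensional. -/
theorem xNeg_pow_smul_hwv' (l : Weight) (α : PosRoot) :
    ug (xNeg α) ^ (pairing l α + 1) • hwv l = 0 := by
  have := (finrank_V_le l).1
  exact (isSl2_ug α).pow_succ_smul_eq_zero (coroot_smul_hwv α) (xPos_smul_hwv α)

/-! ### The associated graded space -/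

section AssociatedGraded

variable {M : Type} [AddCommGroup M] [Module ℂ M] (ρ : Gt →ₗ⁅ℂ⁆ Module.End ℂ M) (v : M)

theorem grMk_eq_zero {k : ℕ} {m : M} (hm : m ∈ fil ρ v k) (h : m ∈ filPred ρ v k) :
    grMk ρ v k m hm = 0 := by
  rw [grMk, (Submodule.Quotient.mk_eq_zero _).2, map_zero]
  exact h

theorem fil_mono {k k' : ℕ} (h : k ≤ k') : fil ρ v k ≤ fil ρ v k' :=
  iSup₂_le fun r hr => le_iSup₂_of_le (f := fun r _ => degSpan ρ v r) r (le_trans hr h) le_rfl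

theorem filPred_le (k : ℕ) : filPred ρ v k ≤ fil ρ v k := by
  cases k with
  | zero => exact bot_le
  | succ k => exact fil_mono ρ v k.le_succ

theorem fil_le_filPred {k k' : ℕ} (h : k < k') : fil ρ v k ≤ filPred ρ v k' := by
  cases k' with
  | zero => omega
  | succ k' => exact fil_mono ρ v (by omega)

theorem degSpan_le_fil {r k : ℕ} (h : r ≤ k) : degSpan ρ v r ≤ fil ρ v k :=
  le_iSup₂_of_le (f := fun r _ => degSpan ρ v r) r h le_rfl

theorem gen_mem_fil (k : ℕ) : v ∈ fil ρ v k :=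
  degSpan_le_fil ρ v (Nat.zero_le k) ⟨1, one_mem_UtDeg, by simp⟩

/-- The associated graded space is at least as large as the union of the filtration. -/
theorem finrank_le_finrank_gr [Module.Finite ℂ (Gr ρ v)]
    (h : ∀ P : Submodule ℂ M, v ∈ P → (∀ x r, ∀ m ∈ P, ρ ((Polynomial.X ^ r : ℂ[X]) ⊗ₜ x) m ∈ P) →
      P = ⊤) : Module.finrank ℂ M ≤ Module.finrank ℂ (Gr ρ v) := by
  have hsec : ∀ k, ∃ s : GrPart ρ v k →ₗ[ℂ] fil ρ v k,
      ((filPred ρ v k).submoduleOf (fil ρ v k)).mkQ ∘ₗ s = LinearMap.id := fun k =>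
    LinearMap.exists_rightInverse_of_surjective _ (Submodule.range_mkQ _)
  choose s hs using hsec
  let g : Gr ρ v →ₗ[ℂ] M := DirectSum.toModule ℂ ℕ M (M := GrPart ρ v)
    fun k => (fil ρ v k).subtype ∘ₗ s k
  have hg : ∀ k (x : GrPart ρ v k), g (grIncl ρ v k x) = (s k x : M) := fun k x =>
    DirectSum.toModule_lof ℂ k x
  have hfil : ∀ k, fil ρ v k ≤ LinearMap.range g := by
    have key : ∀ k, filPred ρ v k ≤ LinearMap.range g → fil ρ v k ≤ LinearMap.range g := by
      intro k hk m hm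
      let x : GrPart ρ v k := Submodule.Quotient.mk ⟨m, hm⟩
      have h1 : (Submodule.Quotient.mk (s k x) : GrPart ρ v k) = Submodule.Quotient.mk ⟨m, hm⟩ :=
        LinearMap.congr_fun (hs k) x
      rw [Submodule.Quotient.eq] at h1
      have h2 : (s k x : M) - m ∈ LinearMap.range g := hk h1
      have h3 : (s k x : M) ∈ LinearMap.range g := ⟨_, hg k x⟩
      exact (Submodule.sub_mem_iff_right _ h3).1 h2
    intro k
    induction k with
    | zero => exact key 0 bot_le
    | succ k ih => exact key (k + 1) ih
  have htop : ⨆ k, fil ρ v k = ⊤ := by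
    refine h _ (Submodule.mem_iSup_of_mem 0 (gen_mem_fil ρ v 0)) fun x r m hm => ?_
    refine Submodule.iSup_induction (fil ρ v)
      (motive := fun m => ρ ((Polynomial.X ^ r : ℂ[X]) ⊗ₜ x) m ∈ ⨆ k, fil ρ v k) hm ?_ ?_ ?_
    · intro k m hm
      exact Submodule.mem_iSup_of_mem _ (act_fil ρ v x r k hm)
    · rw [map_zero]
      exact zero_mem _
    · intro a b ha hb
      rw [map_add]
      exact add_mem ha hb
  have hrange : LinearMap.range g = ⊤ := eq_top_iff.2 (htop ▸ iSup_le hfil)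
  exact LinearMap.finrank_le_finrank_of_surjective (LinearMap.range_eq_top.1 hrange)

/-- The action of `U(sl₃[t])` on the associated graded space. -/
instance : Module Ut (Gr ρ v) :=
  Module.compHom (Gr ρ v) (UniversalEnvelopingAlgebra.lift ℂ (grRep ρ v)).toRingHom

theorem smul_gr (y : Ut) (x : Gr ρ v) :
    y • x = UniversalEnvelopingAlgebra.lift ℂ (grRep ρ v) y x := rfl

instance : IsScalarTower ℂ Ut (Gr ρ v) where
  smul_assoc c y x := by rw [smul_gr, smul_gr, map_smul, LinearMap.smul_apply]

theorem cur_smul_gr (x : G) (r : ℕ) (y : Gr ρ v) : cur x r • y = actGr ρ v x r y := by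
  rw [smul_gr, cur, UniversalEnvelopingAlgebra.lift_ι_apply]
  change grLin ρ v ((Polynomial.X ^ r : ℂ[X]) ⊗ₜ x) y = _
  rw [Polynomial.X_pow_eq_monomial, grLin_monomial, one_smul]

theorem cur_smul_grMk (x : G) (r k : ℕ) (u : M) (hu : u ∈ fil ρ v k) :
    cur x r • grMk ρ v k u hu =
      grMk ρ v (k + r) (ρ ((Polynomial.X ^ r : ℂ[X]) ⊗ₜ x) u) (act_fil _ _ x r k hu) := by
  rw [cur_smul_gr, actGr_grMk]

/-- The generator of the associated graded module. -/
def grGen : Gr ρ v := grMk ρ v 0 v (gen_mem_fil _ _ 0)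

theorem lift_mem_fil {s : ℕ} {y : Ut} (hy : y ∈ UtDeg s) :
    UniversalEnvelopingAlgebra.lift ℂ ρ y v ∈ fil ρ v s :=
  degSpan_le_fil _ _ le_rfl ⟨y, hy, rfl⟩

/-- An element of degree `s` maps the generator to the class in degree `s` of its value on the
cyclic vector. -/
theorem smul_grGen {s : ℕ} {y : Ut} (hy : y ∈ UtDeg s) :
    y • grGen ρ v = grMk ρ v s (UniversalEnvelopingAlgebra.lift ℂ ρ y v) (lift_mem_fil ρ v hy) := by
  have key : ∀ w : List (G × ℕ), ∃ hu, (w.map fun p => cur p.1 p.2).prod • grGen ρ v =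
      grMk ρ v (w.map Prod.snd).sum
        (UniversalEnvelopingAlgebra.lift ℂ ρ (w.map fun p => cur p.1 p.2).prod v) hu := by
    intro w
    induction w with
    | nil => exact ⟨by simpa using gen_mem_fil ρ v 0, by simp [grGen]⟩
    | cons p w ih =>
      obtain ⟨hu, ih⟩ := ih
      have h1 : UniversalEnvelopingAlgebra.lift ℂ ρ ((p :: w).map fun p => cur p.1 p.2).prod v =
          ρ ((Polynomial.X ^ p.2 : ℂ[X]) ⊗ₜ p.1)
            (UniversalEnvelopingAlgebra.lift ℂ ρ (w.map fun p => cur p.1 p.2).prod v) := by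
        rw [List.map_cons, List.prod_cons, map_mul, Module.End.mul_apply, cur,
          UniversalEnvelopingAlgebra.lift_ι_apply]
      have h2 : ((p :: w).map Prod.snd).sum = (w.map Prod.snd).sum + p.2 := by
        rw [List.map_cons, List.sum_cons, add_comm]
      refine ⟨h2 ▸ h1 ▸ act_fil ρ v p.1 p.2 _ hu, ?_⟩
      have h3 : ((p :: w).map fun p => cur p.1 p.2).prod • grGen ρ v =
          cur p.1 p.2 • (w.map fun p => cur p.1 p.2).prod • grGen ρ v := by
        rw [List.map_cons, List.prod_cons, mul_smul]
      rw [grMk_congr ρ v h2 h1, ← cur_smul_grMk ρ v _ _ _ _ hu, ← ih]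
      exact h3
  induction hy using Submodule.span_induction with
  | mem y h =>
    obtain ⟨w, hw, rfl⟩ := h
    obtain ⟨hu, h⟩ := key w
    rw [h, grMk_congr ρ v hw rfl]
  | zero =>
    rw [zero_smul, grMk_congr ρ v rfl (by rw [map_zero]; rfl : _ = (0 : M))]
    exact (grMk_eq_zero ρ v _ (zero_mem _)).symm
  | add a b ha hb h1 h2 =>
    rw [add_smul, h1, h2, ← grMk_add]
    exact grMk_congr ρ v rfl (by rw [map_add, LinearMap.add_apply]) _
  | smul c a ha h1 =>
    rw [smul_assoc, h1, ← grMk_smul]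
    exact grMk_congr ρ v rfl (by rw [map_smul, LinearMap.smul_apply]) _

theorem span_grGen : Submodule.span Ut {grGen ρ v} = ⊤ := by
  have hmem : ∀ k u hu, grMk ρ v k u hu ∈ Submodule.span Ut {grGen ρ v} := by
    intro k u hu
    have : fil ρ v k ≤ filPred ρ v k ⊔ degSpan ρ v k := by
      refine iSup₂_le fun r hr => ?_
      rcases Nat.eq_or_lt_of_le hr with rfl | hr
      · exact le_sup_right
      · exact le_sup_of_le_left ((degSpan_le_fil _ _ le_rfl).trans (fil_le_filPred _ _ hr))
    obtain ⟨a, ha, b, ⟨y, hy, rfl⟩, rfl⟩ := Submodule.mem_sup.1 (this hu)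
    have h1 := grMk_add ρ v k a _ (filPred_le _ _ k ha) (lift_mem_fil ρ v hy)
    rw [grMk_eq_zero ρ v _ ha, zero_add, ← smul_grGen ρ v hy] at h1
    exact h1 ▸ Submodule.smul_mem _ _ (Submodule.mem_span_singleton_self _)
  rw [eq_top_iff]
  rintro x -
  induction x using DirectSum.induction_on with
  | zero => exact zero_mem _
  | of k x =>
    obtain ⟨⟨u, hu⟩, rfl⟩ := Submodule.Quotient.mk_surjective _ x
    exact hmem k u hu
  | add a b ha hb => exact add_mem ha hb

/-- If `x ⊗ tʳ` acts on `M` as a combination of elements of lower degree in `t`, then it acts by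
zero on the associated graded module. -/
theorem cur_smul_gr_eq_zero {x : G} {r : ℕ}
    (h : ∀ k, ∀ u ∈ fil ρ v k, ρ ((Polynomial.X ^ r : ℂ[X]) ⊗ₜ x) u ∈ filPred ρ v (k + r))
    (y : Gr ρ v) : cur x r • y = 0 := by
  have h0 : actGr ρ v x r = 0 := gr_hom_ext _ _ fun k u hu => by
    rw [actGr_grMk]
    exact grMk_eq_zero _ _ _ (h k u hu)
  rw [cur_smul_gr, h0]
  rfl

/-- In the associated graded module, powers of `x ⊗ t` can be replaced by powers of
`x ⊗ (t - z)`. -/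
theorem t_pow_smul_grGen (x : G) (z : ℂ) (n : ℕ) :
    ∃ hu, cur x 1 ^ n • grGen ρ v =
      grMk ρ v n ((ρ ((Polynomial.X - Polynomial.C z) ⊗ₜ x) ^ n) v) hu := by
  have hsub : ∀ u, ρ ((Polynomial.X - Polynomial.C z) ⊗ₜ x) u =
      ρ ((Polynomial.X ^ 1 : ℂ[X]) ⊗ₜ x) u - z • ρ ((Polynomial.X ^ 0 : ℂ[X]) ⊗ₜ x) u := by
    intro u
    have : ((Polynomial.X - Polynomial.C z) ⊗ₜ x : Gt) =
        (Polynomial.X ^ 1 : ℂ[X]) ⊗ₜ x - z • (Polynomial.X ^ 0 : ℂ[X]) ⊗ₜ x := by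
      rw [TensorProduct.smul_tmul', ← TensorProduct.sub_tmul, pow_one, pow_zero,
        Polynomial.smul_eq_C_mul, mul_one]
    rw [this, map_sub, map_smul, LinearMap.sub_apply, LinearMap.smul_apply]
  induction n with
  | zero => exact ⟨gen_mem_fil _ _ _, by simp [grGen]⟩
  | succ n ih =>
    obtain ⟨hu, h⟩ := ih
    rw [pow_succ' (ρ ((Polynomial.X - Polynomial.C z) ⊗ₜ x)) n, Module.End.mul_apply, hsub,
      pow_succ' (cur x 1) n, mul_smul, h, cur_smul_grMk]
    have h1 := act_fil ρ v x 1 n hu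
    have h0 : z • ρ ((Polynomial.X ^ 0 : ℂ[X]) ⊗ₜ x)
        ((ρ ((Polynomial.X - Polynomial.C z) ⊗ₜ x) ^ n) v) ∈ filPred ρ v (n + 1) :=
      Submodule.smul_mem _ _ (act_fil ρ v x 0 n hu)
    refine ⟨Submodule.sub_mem _ h1 (filPred_le _ _ _ h0), ?_⟩
    rw [grMk_sub ρ v _ _ _ h1 (filPred_le _ _ _ h0), grMk_eq_zero ρ v _ h0, sub_zero]

theorem t_pow_smul_grGen_eq_zero {x : G} (z : ℂ) {n : ℕ}
    (h : (ρ ((Polynomial.X - Polynomial.C z) ⊗ₜ x) ^ n) v = 0) : cur x 1 ^ n • grGen ρ v = 0 := by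
  obtain ⟨hu, h'⟩ := t_pow_smul_grGen ρ v x z n
  rw [h']
  exact grMk_eq_zero ρ v _ (h ▸ zero_mem _)

end AssociatedGraded

/-! ### Fusion products -/

section Fusion

variable {l m : Weight} {z₁ z₂ : ℂ}

theorem evalRep_tmul (f : ℂ[X]) (x : G) (a : V l) (b : V m) :
    evalRep l m z₁ z₂ (f ⊗ₜ x) (a ⊗ₜ b) =
      f.eval z₁ • (ug x • a) ⊗ₜ b + f.eval z₂ • a ⊗ₜ (ug x • b) := by
  have h1 : (irrRep l).comp (ev z₁) (f ⊗ₜ x) a = f.eval z₁ • ug x • a := by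
    rw [LieHom.comp_apply, ev_tmul, map_smul]
    rfl
  have h2 : (irrRep m).comp (ev z₂) (f ⊗ₜ x) b = f.eval z₂ • ug x • b := by
    rw [LieHom.comp_apply, ev_tmul, map_smul]
    rfl
  change (irrRep l).comp (ev z₁) (f ⊗ₜ x) a ⊗ₜ b + a ⊗ₜ (irrRep m).comp (ev z₂) (f ⊗ₜ x) b = _
  rw [h1, h2, TensorProduct.tmul_smul]
  rfl

/-- For distinct points, the tensor product of the generators is a cyclic vector of the evaluation
module. -/
theorem eq_top_of_evalRep (hz : z₁ ≠ z₂) (P : Submodule ℂ (V l ⊗[ℂ] V m))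
    (hv : hwv l ⊗ₜ hwv m ∈ P)
    (hP : ∀ x r, ∀ m' ∈ P, evalRep l m z₁ z₂ ((Polynomial.X ^ r : ℂ[X]) ⊗ₜ x) m' ∈ P) : P = ⊤ := by
  -- The combinations `x ⊗ (t - z₂)` and `x ⊗ (t - z₁)` act on one factor only.
  have hl : ∀ x a b, a ⊗ₜ b ∈ P → (ug x • a) ⊗ₜ[ℂ] b ∈ P := by
    intro x a b hab
    have h0 := hP x 0 _ hab
    have h1 := hP x 1 _ hab
    have h2 := P.sub_mem h1 (P.smul_mem z₂ h0)
    rw [evalRep_tmul, evalRep_tmul] at h2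
    have h3 : (z₁ - z₂) • (ug x • a) ⊗ₜ[ℂ] b ∈ P := by
      convert h2 using 1
      simp only [pow_one, pow_zero, Polynomial.eval_X, Polynomial.eval_one]
      generalize (ug x • a) ⊗ₜ[ℂ] b = u
      generalize a ⊗ₜ[ℂ] (ug x • b) = u'
      module
    exact (P.smul_mem_iff (sub_ne_zero.2 hz)).1 h3
  have hr : ∀ x a b, a ⊗ₜ b ∈ P → a ⊗ₜ[ℂ] (ug x • b) ∈ P := by
    intro x a b hab
    have h0 := hP x 0 _ hab
    rw [evalRep_tmul] at h0
    simp only [pow_zero, Polynomial.eval_one, one_smul] at h0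
    exact (P.add_mem_iff_right (hl x a b hab)).1 h0
  have h1 : ∀ a, a ⊗ₜ[ℂ] hwv m ∈ P := by
    intro a
    obtain ⟨y, rfl⟩ := exists_smul_hwv a
    exact smul_mem_of_adjoin uea_adjoin (P.comap ((TensorProduct.mk ℂ (V l) (V m)).flip (hwv m)))
      (by rintro _ ⟨x, rfl⟩ a ha; exact hl x a _ ha) y _ hv
  have h2 : ∀ a b, a ⊗ₜ[ℂ] b ∈ P := by
    intro a b
    obtain ⟨y, rfl⟩ := exists_smul_hwv b
    exact smul_mem_of_adjoin uea_adjoin (P.comap (TensorProduct.mk ℂ (V l) (V m) a))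
      (by rintro _ ⟨x, rfl⟩ b hb; exact hr x a b hb) y _ (h1 a)
  rw [eq_top_iff, ← TensorProduct.span_tmul_eq_top, Submodule.span_le]
  rintro _ ⟨a, b, rfl⟩
  exact h2 a b

/-- The product of `x ⊗ tʳ` with `(t - z₁)(t - z₂)` acts by zero on the evaluation module. -/
theorem evalRep_X_pow_add_two (x : G) (r : ℕ) (u : V l ⊗[ℂ] V m) :
    evalRep l m z₁ z₂ ((Polynomial.X ^ (r + 2) : ℂ[X]) ⊗ₜ x) u =
      (z₁ + z₂) • evalRep l m z₁ z₂ ((Polynomial.X ^ (r + 1) : ℂ[X]) ⊗ₜ x) u -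
        (z₁ * z₂) • evalRep l m z₁ z₂ ((Polynomial.X ^ r : ℂ[X]) ⊗ₜ x) u := by
  have h : ∀ a b, evalRep l m z₁ z₂ ((Polynomial.X ^ (r + 2) : ℂ[X]) ⊗ₜ x) (a ⊗ₜ b) =
      (z₁ + z₂) • evalRep l m z₁ z₂ ((Polynomial.X ^ (r + 1) : ℂ[X]) ⊗ₜ x) (a ⊗ₜ b) -
        (z₁ * z₂) • evalRep l m z₁ z₂ ((Polynomial.X ^ r : ℂ[X]) ⊗ₜ x) (a ⊗ₜ b) := by
    intro a b
    rw [evalRep_tmul, evalRep_tmul, evalRep_tmul]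
    simp only [Polynomial.eval_pow, Polynomial.eval_X]
    generalize (ug x • a) ⊗ₜ[ℂ] b = u
    generalize a ⊗ₜ[ℂ] (ug x • b) = u'
    module
  induction u using TensorProduct.induction_on with
  | zero => simp only [map_zero, smul_zero, sub_zero]
  | tmul a b => exact h a b
  | add a b ha hb =>
    rw [map_add, map_add, map_add, ha, hb, smul_add, smul_add]
    abel

theorem evalRep_sub_pow_left (x : G) (n : ℕ) :
    (evalRep l m z₁ z₂ ((Polynomial.X - Polynomial.C z₂) ⊗ₜ x) ^ n) (hwv l ⊗ₜ hwv m) =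
      (z₁ - z₂) ^ n • (ug x ^ n • hwv l) ⊗ₜ hwv m := by
  induction n with
  | zero => rw [pow_zero, pow_zero, pow_zero, one_smul, one_smul, Module.End.one_apply]
  | succ n ih =>
    rw [pow_succ' (evalRep _ _ _ _ _), Module.End.mul_apply, ih, map_smul, evalRep_tmul,
      ← mul_smul (ug x), ← pow_succ']
    simp only [Polynomial.eval_sub, Polynomial.eval_X, Polynomial.eval_C, sub_self, zero_smul,
      add_zero, smul_smul, ← pow_succ]

theorem evalRep_sub_pow_right (x : G) (n : ℕ) :
    (evalRep l m z₁ z₂ ((Polynomial.X - Polynomial.C z₁) ⊗ₜ x) ^ n) (hwv l ⊗ₜ hwv m) =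
      (z₂ - z₁) ^ n • hwv l ⊗ₜ (ug x ^ n • hwv m) := by
  induction n with
  | zero => rw [pow_zero, pow_zero, pow_zero, one_smul, one_smul, Module.End.one_apply]
  | succ n ih =>
    rw [pow_succ' (evalRep _ _ _ _ _), Module.End.mul_apply, ih, map_smul, evalRep_tmul,
      ← mul_smul (ug x), ← pow_succ']
    simp only [Polynomial.eval_sub, Polynomial.eval_X, Polynomial.eval_C, sub_self, zero_smul,
      zero_add, smul_smul, ← pow_succ]

/-- The generator of the fusion product. -/
abbrev fusGen (l m : Weight) (z₁ z₂ : ℂ) : Gr (evalRep l m z₁ z₂) (hwv l ⊗ₜ hwv m) :=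
  grGen (evalRep l m z₁ z₂) (hwv l ⊗ₜ hwv m)

theorem evalRep_xPos (α : PosRoot) (s : ℕ) :
    evalRep l m z₁ z₂ ((Polynomial.X ^ s : ℂ[X]) ⊗ₜ xPos α) (hwv l ⊗ₜ hwv m) = 0 := by
  rw [evalRep_tmul, xPos_smul_hwv, xPos_smul_hwv, TensorProduct.zero_tmul, TensorProduct.tmul_zero,
    smul_zero, smul_zero, add_zero]

theorem evalRep_coroot (α : PosRoot) (s : ℕ) :
    evalRep l m z₁ z₂ ((Polynomial.X ^ s : ℂ[X]) ⊗ₜ coroot α) (hwv l ⊗ₜ hwv m) =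
      (z₁ ^ s * pairing l α + z₂ ^ s * pairing m α) • hwv l ⊗ₜ[ℂ] hwv m := by
  rw [evalRep_tmul, coroot_smul_hwv, coroot_smul_hwv, TensorProduct.tmul_smul,
    TensorProduct.smul_tmul, TensorProduct.tmul_smul, smul_smul, smul_smul, add_smul,
    Polynomial.eval_pow, Polynomial.eval_pow, Polynomial.eval_X, Polynomial.eval_X]

theorem coroot_smul_fusGen (α : PosRoot) (s : ℕ) : cur (coroot α) s • fusGen l m z₁ z₂ =
    ((if s = 0 then pairing (l + m) α else 0 : ℕ) : ℂ) • fusGen l m z₁ z₂ := by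
  rw [fusGen, grGen, cur_smul_grMk]
  rcases s with _ | s
  · rw [← grMk_smul]
    refine grMk_congr _ _ rfl ?_ _
    rw [evalRep_coroot, if_pos rfl, pairing_add, pow_zero, pow_zero, one_mul, one_mul, Nat.cast_add]
  · rw [if_neg s.succ_ne_zero, Nat.cast_zero, zero_smul]
    refine grMk_eq_zero _ _ _ ?_
    rw [evalRep_coroot]
    exact Submodule.smul_mem _ _ (gen_mem_fil _ _ _)

theorem xNeg_pow_smul_fusGen (α : PosRoot) :
    cur (xNeg α) 0 ^ (pairing (l + m) α + 1) • fusGen l m z₁ z₂ = 0 := by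
  have := (finrank_V_le l).1
  have := (finrank_V_le m).1
  rw [smul_grGen _ _ (pow_mem_UtDeg (cur_mem_UtDeg (xNeg α) 0) _)]
  refine grMk_eq_zero _ _ _ ?_
  have hι : ∀ x, UniversalEnvelopingAlgebra.lift ℂ (evalRep l m z₁ z₂) (cur x 0) =
      evalRep l m z₁ z₂ ((Polynomial.X ^ 0 : ℂ[X]) ⊗ₜ x) := fun x =>
    UniversalEnvelopingAlgebra.lift_ι_apply _ _ _
  have h0 := ((isSl2_cur α).map
    (UniversalEnvelopingAlgebra.lift ℂ (evalRep l m z₁ z₂))).pow_succ_smul_eq_zero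
    (u := hwv l ⊗ₜ[ℂ] hwv m) (n := pairing (l + m) α)
    (by
      rw [Module.End.smul_def, hι, evalRep_coroot, pairing_add, pow_zero, pow_zero, one_mul,
          one_mul,
        Nat.cast_add])
    (by rw [Module.End.smul_def, hι, evalRep_xPos])
  rw [Module.End.smul_def] at h0
  rw [map_pow, h0]
  exact zero_mem _

theorem cur_smul_fusion_eq_zero (x : G) (r : ℕ) (hr : 2 ≤ r)
    (y : Gr (evalRep l m z₁ z₂) (hwv l ⊗ₜ hwv m)) : cur x r • y = 0 := by
  obtain ⟨r, rfl⟩ := Nat.exists_eq_add_of_le' hr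
  refine cur_smul_gr_eq_zero _ _ (fun k u hu => ?_) y
  rw [evalRep_X_pow_add_two]
  refine Submodule.sub_mem _ (Submodule.smul_mem _ _ ?_) (Submodule.smul_mem _ _ ?_)
  · exact fil_le_filPred _ _ (by omega) (act_fil _ _ x (r + 1) k hu)
  · exact fil_le_filPred _ _ (by omega) (act_fil _ _ x r k hu)

/-- With `z` chosen among the two points, `x_α⁻ ⊗ (t - z)` acts on one of the factors only. -/
theorem xNeg_t_pow_smul_fusGen (α : PosRoot) :
    cur (xNeg α) 1 ^ (minPart l m α + 1) • fusGen l m z₁ z₂ = 0 := by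
  rcases le_total (pairing l α) (pairing m α) with hle | hle
  · rw [minPart, min_eq_left hle]
    exact t_pow_smul_grGen_eq_zero _ _ z₂ (by
      rw [evalRep_sub_pow_left, xNeg_pow_smul_hwv', TensorProduct.zero_tmul, smul_zero])
  · rw [minPart, min_eq_right hle]
    exact t_pow_smul_grGen_eq_zero _ _ z₁ (by
      rw [evalRep_sub_pow_right, xNeg_pow_smul_hwv', TensorProduct.tmul_zero, smul_zero])

/-- The generator of the fusion product satisfies the simplified relations of `F_{λ,μ}`, which gives
a surjection from `F_{λ,μ}` onto the fusion product. -/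
theorem takiffRel_fusGen (l m : Weight) (z₁ z₂ : ℂ) :
    TakiffRel (fusGen l m z₁ z₂) (l + m) (minPart l m) where
  xPos_smul α s := by
    rw [fusGen, grGen, cur_smul_grMk]
    exact grMk_eq_zero _ _ _ (by rw [evalRep_xPos]; exact zero_mem _)
  coroot_smul := coroot_smul_fusGen
  xNeg_pow i := xNeg_pow_smul_fusGen (simpleRoot i)
  two_le := cur_smul_fusion_eq_zero
  xNeg_t_pow := xNeg_t_pow_smul_fusGen

theorem finrank_mul_le_finrank_gr (hz : z₁ ≠ z₂)
    [Module.Finite ℂ (Gr (evalRep l m z₁ z₂) (hwv l ⊗ₜ hwv m))] :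
    Module.finrank ℂ (V l) * Module.finrank ℂ (V m) ≤
      Module.finrank ℂ (Gr (evalRep l m z₁ z₂) (hwv l ⊗ₜ hwv m)) := by
  rw [← Module.finrank_tensorProduct]
  exact finrank_le_finrank_gr _ _ fun P hv hP => eq_top_of_evalRep hz P hv hP

end Fusion

/-! ### The dimension formula and the isomorphism with the fusion product -/

section Dimension

variable {l m : Weight}

/-- The upper bound for the dimension of `F_{λ,μ}`, by the filtration by essential monomials. -/
theorem finrank_F_le (l m : Weight) : Module.Finite ℂ (F l m) ∧ Module.finrank ℂ (F l m) ≤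
    ∑ q ∈ essential (l + m) (minPart l m), Module.finrank ℂ (V (tWeight (l + m) q)) :=
  (takiffRel_fGen l m).finrank_le_sum span_cvGen (isHalf_minPart l m)

theorem exists_F_to_gr (l m : Weight) (z₁ z₂ : ℂ) :
    ∃ g : F l m →ₗ[Ut] Gr (evalRep l m z₁ z₂) (hwv l ⊗ₜ hwv m), Function.Surjective g := by
  obtain ⟨g, hg⟩ := (takiffRel_fusGen l m z₁ z₂).exists_lift fun α => le_rfl
  exact ⟨g, surjective_of_map_gen (span_grGen _ _) g hg⟩

/-- The lower bound for the dimension of `F_{λ,μ}`, by its quotient the fusion product. -/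
theorem finrank_mul_le_finrank_gr_le (l m : Weight) {z₁ z₂ : ℂ} (hz : z₁ ≠ z₂) :
    Module.finrank ℂ (V l) * Module.finrank ℂ (V m) ≤
        Module.finrank ℂ (Gr (evalRep l m z₁ z₂) (hwv l ⊗ₜ hwv m)) ∧
      Module.finrank ℂ (Gr (evalRep l m z₁ z₂) (hwv l ⊗ₜ hwv m)) ≤ Module.finrank ℂ (F l m) := by
  obtain ⟨g, hg⟩ := exists_F_to_gr l m z₁ z₂
  have := (finrank_F_le l m).1
  have : Module.Finite ℂ (Gr (evalRep l m z₁ z₂) (hwv l ⊗ₜ hwv m)) :=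
    Module.Finite.of_surjective (g.restrictScalars ℂ) hg
  exact ⟨finrank_mul_le_finrank_gr hz,
    LinearMap.finrank_le_finrank_of_surjective (f := g.restrictScalars ℂ) hg⟩

theorem finrank_mul_le_finrank_F (l m : Weight) :
    Module.finrank ℂ (V l) * Module.finrank ℂ (V m) ≤ Module.finrank ℂ (F l m) :=
  (finrank_mul_le_finrank_gr_le l m (zero_ne_one (α := ℂ))).1.trans
    (finrank_mul_le_finrank_gr_le l m zero_ne_one).2

theorem two_mul_finrank_V_tWeight_le {q : ℕ × ℕ × ℕ}
    (hq : q ∈ essential (l + m) (minPart l m)) :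
    2 * (Module.finrank ℂ (V (tWeight (l + m) q)) : ℤ) ≤ weylDimAt (l + m) q := by
  obtain ⟨i, j, k⟩ := q
  obtain ⟨-, h1, h2⟩ := mem_essential.1 hq
  have h := (finrank_V_le (tWeight (l + m) (i, j, k))).2
  have e1 : (((tWeight (l + m) (i, j, k)).1 : ℕ) : ℤ) = (l + m).1 - 2 * i - k + j := by
    simp only [tWeight]; omega
  have e2 : (((tWeight (l + m) (i, j, k)).2 : ℕ) : ℤ) = (l + m).2 - 2 * j - k + i := by
    simp only [tWeight]; omega
  rwa [e1, e2] at h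

/-- The dimension formula passes from `λ` and `μ` to `λ + μ`, which is the weight of one of the
irreducible modules occurring in the filtration of `F_{λ,μ}`. -/
theorem finrank_V_add (hsize : m.1 + m.2 ≤ l.1 + l.2) (hfst : m.1 ≤ l.1)
    (hl : 2 * (Module.finrank ℂ (V l) : ℤ) = weylDim l.1 l.2)
    (hm : 2 * (Module.finrank ℂ (V m) : ℤ) = weylDim m.1 m.2) :
    2 * (Module.finrank ℂ (V (l + m)) : ℤ) = weylDim ((l + m).1 : ℕ) ((l + m).2 : ℕ) := by
  have h1 := (finrank_mul_le_finrank_F l m).trans (finrank_F_le l m).2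
  have h2 := sum_essential_minPart l m hsize hfst
  rw [← hl, ← hm] at h2
  have h3 : ∑ q ∈ essential (l + m) (minPart l m), weylDimAt (l + m) q =
      ∑ q ∈ essential (l + m) (minPart l m),
        2 * (Module.finrank ℂ (V (tWeight (l + m) q)) : ℤ) := by
    refine le_antisymm ?_ (Finset.sum_le_sum fun q hq => two_mul_finrank_V_tWeight_le hq)
    rw [← Finset.mul_sum]
    have h1' : (Module.finrank ℂ (V l) : ℤ) * Module.finrank ℂ (V m) ≤
      ∑ q ∈ essential (l + m) (minPart l m), (Module.finrank ℂ (V (tWeight (l + m) q)) : ℤ) := by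
      exact_mod_cast h1
    linarith
  have h0 : ((0, 0, 0) : ℕ × ℕ × ℕ) ∈ essential (l + m) (minPart l m) :=
    mem_essential.2 ⟨by omega, by omega, by omega⟩
  have h4 :=
    (Finset.sum_eq_sum_iff_of_le fun q hq => two_mul_finrank_V_tWeight_le hq).1 h3.symm _ h0
  have ht : tWeight (l + m) (0, 0, 0) = l + m := Prod.ext (by simp [tWeight]) (by simp [tWeight])
  rw [ht] at h4
  simpa [weylDimAt] using h4

/-- The dimension formula of Weyl. -/
theorem two_mul_finrank_V (l : Weight) :
    2 * (Module.finrank ℂ (V l) : ℤ) = weylDim l.1 l.2 := by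
  have h10 : 2 * (Module.finrank ℂ (V (1, 0)) : ℤ) = weylDim 1 0 := by
    have h1 := (finrank_V_le (1, 0)).2
    have h2 := three_le_finrank_V_fst
    norm_num [weylDim] at h1 ⊢
    omega
  have h01 : 2 * (Module.finrank ℂ (V (0, 1)) : ℤ) = weylDim 0 1 := by
    have h1 := (finrank_V_le (0, 1)).2
    have h2 := three_le_finrank_V_snd
    norm_num [weylDim] at h1 ⊢
    omega
  obtain ⟨a, b⟩ := l
  induction hn : a + b generalizing a b with
  | zero =>
    obtain ⟨rfl, rfl⟩ : a = 0 ∧ b = 0 := by omega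
    have h1 := (finrank_V_le (0, 0)).2
    have h2 := one_le_finrank_V_zero
    norm_num [weylDim] at h1 ⊢
    omega
  | succ n ih =>
    rcases b with _ | b
    · rcases a with _ | _ | a
      · omega
      · exact h10
      · exact finrank_V_add (l := (a + 1, 0)) (m := (1, 0)) (by simp) (by simp)
          (ih (a + 1) 0 (by omega)) h10
    · rcases Nat.eq_zero_or_pos (a + b) with h | h
      · obtain ⟨rfl, rfl⟩ : a = 0 ∧ b = 0 := by omega
        exact h01
      · exact finrank_V_add (l := (a, b)) (m := (0, 1)) (by dsimp only; omega) (by simp)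
          (ih a b (by omega)) h01

/-- All the inequalities between dimensions are equalities. -/
theorem sum_finrank_V (hsize : m.1 + m.2 ≤ l.1 + l.2) (hfst : m.1 ≤ l.1) :
    ∑ q ∈ essential (l + m) (minPart l m), Module.finrank ℂ (V (tWeight (l + m) q)) =
      Module.finrank ℂ (V l) * Module.finrank ℂ (V m) := by
  have h1 := (finrank_mul_le_finrank_F l m).trans (finrank_F_le l m).2
  have h2 := sum_essential_minPart l m hsize hfst
  rw [← two_mul_finrank_V, ← two_mul_finrank_V] at h2
  have h3 := Finset.sum_le_sum fun q hq =>
    two_mul_finrank_V_tWeight_le (l := l) (m := m) (q := q) hq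
  rw [← Finset.mul_sum] at h3
  refine le_antisymm ?_ h1
  have h4 : ∑ q ∈ essential (l + m) (minPart l m), (Module.finrank ℂ (V (tWeight (l + m) q)) : ℤ) ≤
      Module.finrank ℂ (V l) * Module.finrank ℂ (V m) := by linarith
  exact_mod_cast h4

theorem finrank_F (hsize : m.1 + m.2 ≤ l.1 + l.2) (hfst : m.1 ≤ l.1) :
    Module.finrank ℂ (F l m) =
      ∑ q ∈ essential (l + m) (minPart l m), Module.finrank ℂ (V (tWeight (l + m) q)) :=
  le_antisymm (finrank_F_le l m).2
    ((sum_finrank_V hsize hfst).trans_le (finrank_mul_le_finrank_F l m))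

theorem bijective_of_finrank_le {X Y : Type*} [AddCommGroup X] [AddCommGroup Y] [Module ℂ X]
    [Module ℂ Y] [Module Ut X] [Module Ut Y] [IsScalarTower ℂ Ut X] [IsScalarTower ℂ Ut Y]
    [Module.Finite ℂ X] {g : X →ₗ[Ut] Y} (hg : Function.Surjective g)
    (h : Module.finrank ℂ X ≤ Module.finrank ℂ Y) : Function.Bijective g := by
  have : Module.Finite ℂ Y := Module.Finite.of_surjective (g.restrictScalars ℂ) hg
  have h' : Module.finrank ℂ X = Module.finrank ℂ Y :=
    h.antisymm (LinearMap.finrank_le_finrank_of_surjective (f := g.restrictScalars ℂ) hg)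
  exact ⟨(LinearMap.injective_iff_surjective_of_finrank_eq_finrank
    (f := g.restrictScalars ℂ) h').2 hg, hg⟩

/-- The surjection from `F_{λ,μ}` onto the fusion product is bijective, since both have the
dimension of `V(λ) ⊗ V(μ)`. -/
theorem nonempty_equiv_fusion (hsize : m.1 + m.2 ≤ l.1 + l.2) (hfst : m.1 ≤ l.1) {z₁ z₂ : ℂ}
    (hz : z₁ ≠ z₂) : Nonempty (F l m ≃ₗ[Ut] Fusion l m z₁ z₂) := by
  obtain ⟨g, hg⟩ := exists_F_to_gr l m z₁ z₂
  have := (finrank_F_le l m).1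
  have hle : Module.finrank ℂ (F l m) ≤
      Module.finrank ℂ (Gr (evalRep l m z₁ z₂) (hwv l ⊗ₜ hwv m)) := by
    rw [finrank_F hsize hfst, sum_finrank_V hsize hfst]
    exact (finrank_mul_le_finrank_gr_le l m hz).1
  exact ⟨LinearEquiv.ofBijective g (bijective_of_finrank_le hg hle)⟩

end Dimension

/-! ### The filtration as a filtration by graded submodules -/

section Graded

variable {l m : Weight}

theorem tMonomial_mem_fDeg (i j k : ℕ) : tMonomial (fGen l m) i j k ∈ fDeg l m (i + j + k) := by
  have h1 : fGen l m ∈ fDeg l m 0 := mem_cvDeg.2 ⟨1, one_mem_UtDeg, (one_smul _ _).symm⟩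
  have h2 : ∀ (x : G) n, cur x 1 ^ n ∈ UtDeg n := fun x n => by
    simpa using pow_mem_UtDeg (cur_mem_UtDeg x 1) n
  have := smul_mem_cvDeg (h2 (xNeg .α₁) i) (smul_mem_cvDeg (h2 (xNeg .α₂) j)
    (smul_mem_cvDeg (h2 (xNeg .θ) k) h1))
  rwa [show 0 + k + j + i = i + j + k by ring] at this

/-- The submodules generated by monomials are graded, the monomials being homogeneous. -/
theorem cvComp_mem_tSpan (A : Finset (ℕ × ℕ × ℕ)) (s : ℕ) {x : F l m}
    (hx : x ∈ tSpan (fGen l m) A) :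
    cvComp (l + m) (pairPartition l m) s x ∈ tSpan (fGen l m) A := by
  induction hx using Submodule.closure_induction with
  | zero => rw [map_zero]; exact zero_mem _
  | add a b _ _ ha hb => rw [map_add]; exact add_mem ha hb
  | smul_mem y u hu =>
    obtain ⟨i, j, k, hA, rfl⟩ := hu
    rw [cvComp_smul_of_mem (tMonomial_mem_fDeg i j k)]
    split_ifs
    · exact Submodule.smul_mem _ _ (tMonomial_mem_tSpan hA)
    · exact zero_mem _

theorem isGradedSub_tSpan (A : Finset (ℕ × ℕ × ℕ)) : IsGradedSub l m (tSpan (fGen l m) A) := by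
  refine le_antisymm (fun x hx => ?_) (iSup_le fun s => inf_le_left)
  obtain ⟨n, hn⟩ := exists_sum_cvComp x
  rw [hn]
  exact sum_mem fun s _ => Submodule.mem_iSup_of_mem s ⟨cvComp_mem_tSpan A s hx, cvComp_mem s x⟩

/-- Each step of the filtration is isomorphic to `F_{κ,0}`, where `κ` is the weight of the removed
monomial, up to a shift by the degree of the monomial. -/
theorem quotientIsSumOfCV_tSpan (hsize : m.1 + m.2 ≤ l.1 + l.2) (hfst : m.1 ≤ l.1)
    {B : Finset (ℕ × ℕ × ℕ)} (hB : IsUpper (l + m) (minPart l m) B) {q : ℕ × ℕ × ℕ} (hq : q ∈ B)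
    (hup : IsUpper (l + m) (minPart l m) (B.erase q)) :
    QuotientIsSumOfCV l m (tSpan (fGen l m) (B.erase q)) (tSpan (fGen l m) B) := by
  obtain ⟨i, j, k⟩ := q
  have T := takiffRel_fGen l m
  have hw : Submodule.span Ut {fGen l m} = ⊤ := span_cvGen
  have hp := isHalf_minPart l m
  have hfr := (finrank_F hsize hfst).ge
  set N := tSpan (fGen l m) (B.erase (i, j, k)) with hN
  set N' := tSpan (fGen l m) B with hN'
  have hNN' : N ≤ N' := tSpan_mono (B.erase_subset _)
  have hu : tMonomial (fGen l m) i j k ∈ N' := tMonomial_mem_tSpan hq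
  set κ := tWeight (l + m) (i, j, k) with hκ
  set u : N' ⧸ N.submoduleOf N' := Submodule.Quotient.mk ⟨tMonomial (fGen l m) i j k, hu⟩ with hu'
  have hspan : Submodule.span Ut {u} = ⊤ := span_mk_tMonomial hq
  have T' : TakiffRel u (κ + 0) 0 := T.step_tSpan hw hp hB hq
  obtain ⟨g, hg⟩ := T'.exists_lift (fun α => Nat.zero_le _)
  have hsurj := surjective_of_map_gen hspan g hg
  -- The quotient has the dimension of `V(κ)`, so that the surjection onto it is bijective.
  have hF := (takiffRel_fGen κ 0).finrank_le span_cvGen (minPart_zero κ)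
  have := hF.1
  have := (finrank_F_le l m).1
  have hbij : Function.Bijective g := by
    refine bijective_of_finrank_le hsurj (hF.2.trans ?_)
    have : Module.Finite ℂ N := Module.Finite.of_injective (N.subtype.restrictScalars ℂ)
      N.subtype_injective
    have : Module.Finite ℂ (N' ⧸ N.submoduleOf N') :=
      Module.Finite.of_surjective (g.restrictScalars ℂ) hsurj
    have h1 := (finrank_submoduleOf hNN').2
    have h2 : Module.finrank ℂ N' = _ := T.finrank_tSpan hw hp hfr hB
    have h3 : Module.finrank ℂ N = _ := T.finrank_tSpan hw hp hfr hup
    rw [h2, h3, ← Finset.add_sum_erase B _ hq, add_comm] at h1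
    exact (Nat.add_left_cancel h1).le
  let e := LinearEquiv.ofBijective g hbij
  refine ⟨1, fun _ => κ + 0, fun _ => pairPartition κ 0, fun _ => i + j + k,
    e.symm.trans (DirectSum.lid Ut (F κ 0) (Fin 1)).symm, fun s x hx t => ?_⟩
  obtain rfl : t = 0 := Subsingleton.elim _ _
  change (DirectSum.of (fun _ : Fin 1 => F κ 0) 0 (e.symm (Submodule.Quotient.mk x))) 0 ∈
    shift (i + j + k) (fDeg κ 0) s
  rw [DirectSum.of_eq_same]
  obtain ⟨y, hy⟩ := Submodule.mem_span_singleton.1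
    (show (Submodule.Quotient.mk x : N' ⧸ N.submoduleOf N') ∈ Submodule.span Ut {u} from
      hspan ▸ Submodule.mem_top)
  have hsub : y • tMonomial (fGen l m) i j k - x ∈ N := by
    rw [hu', ← Submodule.Quotient.mk_smul, Submodule.Quotient.eq] at hy
    exact hy
  have hcomp := cvComp_mem_tSpan (B.erase (i, j, k)) s hsub
  rw [map_sub, cvComp_of_mem hx, if_pos rfl, cvComp_smul_of_mem (tMonomial_mem_fDeg i j k)] at hcomp
  have hgen : e (fGen κ 0) = u := hg
  rw [shift]
  split_ifs at hcomp ⊢ with hs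
  · refine mem_cvDeg.2 ⟨utComp (s - (i + j + k)) y, utComp_mem _ _, ?_⟩
    rw [LinearEquiv.symm_apply_eq, map_smul, hgen, hu', ← Submodule.Quotient.mk_smul, eq_comm,
      Submodule.Quotient.eq]
    exact hcomp
  · rw [zero_sub, neg_mem_iff] at hcomp
    rw [Submodule.mem_bot, (Submodule.Quotient.mk_eq_zero (N.submoduleOf N') (x := x)).2 hcomp,
      map_zero]

/-- A submodule attached to an upper set is filtered by removing minimal elements of the upper set
one at a time. -/
theorem exists_filtration (hsize : m.1 + m.2 ≤ l.1 + l.2) (hfst : m.1 ≤ l.1)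
    {A : Finset (ℕ × ℕ × ℕ)} (hA : IsUpper (l + m) (minPart l m) A) :
    ∃ (n : ℕ) (W : Fin (n + 1) → Submodule Ut (F l m)),
      W 0 = ⊥ ∧ W (Fin.last n) = tSpan (fGen l m) A ∧ Monotone W ∧
      (∀ i, IsGradedSub l m (W i)) ∧
      ∀ i : Fin n, QuotientIsSumOfCV l m (W i.castSucc) (W i.succ) := by
  induction hn : A.card generalizing A with
  | zero =>
    obtain rfl := Finset.card_eq_zero.1 hn
    refine ⟨0, fun _ => tSpan (fGen l m) ∅, tSpan_empty, rfl, fun _ _ _ => le_rfl,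
      fun _ => isGradedSub_tSpan _, fun i => i.elim0⟩
  | succ n ih =>
    obtain ⟨q, hq, -, hup⟩ := isUpper_empty.exists_erase hA
      (by rw [Finset.sdiff_empty]; exact Finset.card_pos.1 (by omega))
    obtain ⟨n, W, h0, hlast, hmono, hgr, hquot⟩ :=
      ih hup (by rw [Finset.card_erase_of_mem hq]; omega)
    refine ⟨n + 1, Fin.snoc W (tSpan (fGen l m) A), ?_, Fin.snoc_last _ _, ?_, fun i => ?_,
      fun i => ?_⟩
    · exact (Fin.snoc_castSucc (α := fun _ => Submodule Ut (F l m)) _ _ 0).trans h0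
    · rw [Fin.monotone_iff_le_succ]
      intro i
      refine Fin.lastCases ?_ (fun i => ?_) i
      · rw [Fin.snoc_castSucc, Fin.succ_last, Fin.snoc_last, hlast]
        exact tSpan_mono (A.erase_subset q)
      · rw [Fin.snoc_castSucc, ← Fin.castSucc_succ, Fin.snoc_castSucc]
        exact hmono (Fin.castSucc_le_succ i)
    · refine Fin.lastCases ?_ (fun i => ?_) i
      · rw [Fin.snoc_last]
        exact isGradedSub_tSpan A
      · rw [Fin.snoc_castSucc]
        exact hgr i
    · refine Fin.lastCases ?_ (fun i => ?_) i
      · rw [Fin.snoc_castSucc, Fin.succ_last, Fin.snoc_last, hlast]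
        exact quotientIsSumOfCV_tSpan hsize hfst hA hq hup
      · rw [Fin.snoc_castSucc, ← Fin.castSucc_succ, Fin.snoc_castSucc]
        exact hquot i

end Graded

/-! ### The map onto `F⁺` and its kernel -/

section Plus

variable {l m : Weight}

/-- The pair of weights defining `F⁺` has the same sum, satisfies the same inequalities, and its
smaller parts are not larger. -/
theorem plusPair_spec (hsize : m.1 + m.2 ≤ l.1 + l.2) (hfst : m.1 ≤ l.1) (hm : m ≠ 0) :
    (plusPair l m).1 + (plusPair l m).2 = l + m ∧
    (∀ α, minPart (plusPair l m).1 (plusPair l m).2 α ≤ minPart l m α) ∧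
    (plusPair l m).2.1 + (plusPair l m).2.2 ≤ (plusPair l m).1.1 + (plusPair l m).1.2 ∧
    (plusPair l m).2.1 ≤ (plusPair l m).1.1 := by
  obtain ⟨a, b⟩ := l
  obtain ⟨c, d⟩ := m
  have hm' : ¬(c = 0 ∧ d = 0) := fun h => hm (by rw [h.1, h.2]; rfl)
  dsimp only at hsize hfst
  simp only [plusPair]
  split_ifs with h1 h2 <;> refine ⟨?_, fun α => ?_, ?_, ?_⟩ <;>
    first
    | (cases α <;> simp only [minPart, pairing] <;> omega)
    | (refine Prod.ext ?_ ?_ <;> dsimp only [Prod.fst_add, Prod.snd_add] <;> omega)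
    | (dsimp only; omega)

theorem TakiffRel.congr_weight {M : Type*} [AddCommGroup M] [Module ℂ M] [Module Ut M] {w : M}
    {ν ν' : Weight} {p : PosRoot → ℕ} (T : TakiffRel w ν p) (h : ν = ν') : TakiffRel w ν' p := h ▸ T

/-- If the smaller parts decrease, then `F_{λ',μ'}` is a graded quotient of `F_{λ,μ}`, and the
kernel is generated by the essential monomials which become zero. -/
theorem exists_map_plus (hsize : m.1 + m.2 ≤ l.1 + l.2) (hfst : m.1 ≤ l.1) {l' m' : Weight}
    (hadd : l' + m' = l + m) (hle : ∀ α, minPart l' m' α ≤ minPart l m α)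
    (hsize' : m'.1 + m'.2 ≤ l'.1 + l'.2) (hfst' : m'.1 ≤ l'.1) :
    ∃ φ : F l m →ₗ[Ut] F l' m', Function.Surjective φ ∧ φ (fGen l m) = fGen l' m' ∧
      (∀ s, ∀ x ∈ fDeg l m s, φ x ∈ fDeg l' m' s) ∧
      ∃ A, IsUpper (l + m) (minPart l m) A ∧ LinearMap.ker φ = tSpan (fGen l m) A := by
  have T' := (takiffRel_fGen l' m').congr_weight hadd
  obtain ⟨φ, hφ⟩ := T'.exists_lift hle
  have hsurj := surjective_of_map_gen span_cvGen φ hφ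
  refine ⟨φ, hsurj, hφ, fun s x hx => ?_, ?_⟩
  · obtain ⟨y, hy, rfl⟩ := mem_cvDeg.1 hx
    rw [map_smul]
    exact mem_cvDeg.2 ⟨y, hy, by rw [hφ]⟩
  set S := essential (l + m) (minPart l m) with hS
  set S' := essential (l + m) (minPart l' m') with hS'
  have h1 := hle .α₁
  have h2 := hle .α₂
  have h3 := hle .θ
  have hsub : S' ⊆ S := by
    rintro ⟨i, j, k⟩ h
    rw [hS', mem_essential] at h
    rw [hS, mem_essential]
    omega
  have hup : IsUpper (l + m) (minPart l m) (S \ S') := by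
    refine ⟨Finset.sdiff_subset, ?_⟩
    rintro ⟨i, j, k⟩ hq ⟨i', j', k'⟩ hq' ⟨e1, e2, e3⟩
    dsimp only at e1 e2 e3
    rw [Finset.mem_sdiff, hS, hS', mem_essential, mem_essential] at hq
    rw [Finset.mem_sdiff]
    refine ⟨hq', ?_⟩
    rw [mem_essential] at hq' ⊢
    omega
  refine ⟨S \ S', hup, ?_⟩
  have hker : tSpan (fGen l m) (S \ S') ≤ LinearMap.ker φ := by
    refine Submodule.span_le.2 ?_
    rintro _ ⟨i, j, k, hq, rfl⟩
    rw [Finset.mem_sdiff, hS, hS', mem_essential, mem_essential] at hq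
    have : φ (tMonomial (fGen l m) i j k) = tMonomial (fGen l' m') i j k := by
      rw [tMonomial, map_smul, map_smul, map_smul, hφ, tMonomial]
    rw [SetLike.mem_coe, LinearMap.mem_ker, this, T'.tMonomial_eq_zero (by omega)]
  -- The two submodules have the same dimension.
  have := (finrank_F_le l m).1
  have hd1 : Module.finrank ℂ (tSpan (fGen l m) (S \ S')) = _ :=
    (takiffRel_fGen l m).finrank_tSpan span_cvGen (isHalf_minPart l m) (finrank_F hsize hfst).ge hup
  have hd0 : Module.finrank ℂ (F l' m') = ∑ q ∈ S', Module.finrank ℂ (V (tWeight (l + m) q)) := by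
    rw [hS', ← hadd]
    exact finrank_F hsize' hfst'
  have hd2 := LinearMap.finrank_range_add_finrank_ker (φ.restrictScalars ℂ)
  rw [LinearMap.range_eq_top.2 (show Function.Surjective (φ.restrictScalars ℂ) from hsurj),
    finrank_top, finrank_F hsize hfst, hd0, ← hS,
    ← Finset.sum_sdiff hsub, add_comm] at hd2
  have hd3 := Nat.add_right_cancel hd2
  have heq := Submodule.eq_of_le_of_finrank_eq
    (show (tSpan (fGen l m) (S \ S')).restrictScalars ℂ ≤ LinearMap.ker (φ.restrictScalars ℂ)
      from hker) (hd1.trans hd3.symm)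
  exact Submodule.restrictScalars_injective ℂ Ut (F l m) heq.symm

end Plus

end SL3

end

open SL3 in
theorem mainTheorem1 (l m : SL3.Weight) (hsize : m.1 + m.2 ≤ l.1 + l.2) (hfst : m.1 ≤ l.1) :
    (m ≠ 0 →
      IsGradedRep (F l m) (fDeg l m) ∧
      IsGradedRep (FPlus l m) (fDeg (plusPair l m).1 (plusPair l m).2) ∧
      ∃ φ : F l m →ₗ[Ut] FPlus l m,
        Function.Surjective φ ∧
        φ (fGen l m) = fGen (plusPair l m).1 (plusPair l m).2 ∧
        (∀ s, ∀ x ∈ fDeg l m s, φ x ∈ fDeg (plusPair l m).1 (plusPair l m).2 s) ∧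
        ∃ (n : ℕ) (W : Fin (n + 1) → Submodule Ut (F l m)),
          W 0 = ⊥ ∧ W (Fin.last n) = LinearMap.ker φ ∧ Monotone W ∧
          (∀ i, IsGradedSub l m (W i)) ∧
          ∀ i : Fin n, QuotientIsSumOfCV l m (W i.castSucc) (W i.succ)) ∧
    (∀ z₁ z₂ : ℂ, z₁ ≠ z₂ → Nonempty (F l m ≃ₗ[Ut] Fusion l m z₁ z₂)) ∧
    (∀ z₁ z₂ w₁ w₂ : ℂ, z₁ ≠ z₂ → w₁ ≠ w₂ →
      Nonempty (Fusion l m z₁ z₂ ≃ₗ[Ut] Fusion l m w₁ w₂)) := by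
  refine ⟨fun hm => ⟨isGradedRep_CV _ _, isGradedRep_CV _ _, ?_⟩,
    fun z₁ z₂ hz => nonempty_equiv_fusion hsize hfst hz, fun z₁ z₂ w₁ w₂ hz hw => ?_⟩
  · obtain ⟨hadd, hle, hsize', hfst'⟩ := plusPair_spec hsize hfst hm
    obtain ⟨φ, hsurj, hgen, hdeg, A, hA, hker⟩ := exists_map_plus hsize hfst hadd hle hsize' hfst'
    refine ⟨φ, hsurj, hgen, hdeg, ?_⟩
    rw [hker]
    exact exists_filtration hsize hfst hA
  · obtain ⟨e⟩ := nonempty_equiv_fusion (l := l) (m := m) hsize hfst hz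
    obtain ⟨e'⟩ := nonempty_equiv_fusion (l := l) (m := m) hsize hfst hw
    exact ⟨e.symm.trans e'⟩
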